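/- Let $\kappa>0$ and let $\mathbb H^3_{-\kappa^2}=\{X\in\mathbb R^{3,1}: X\cdot X=-\kappa^{-2},\ t>0\}$, where $\cdot$ is the Lorentz inner product $dx_1^2+dx_2^2+dx_3^2-dt^2$. Let $\Sigma$ be a compact connected smooth surface and $F_0:\Sigma\to\mathbb H^3_{-\kappa^2}$ a smooth embedding with outward unit normal $N$ and positive definite second fundamental form. Let $F(p,r)=\cosh(\kappa r)\,F_0(p)+\kappa^{-1}\sinh(\kappa r)\,N(p)$, $r\ge 0$, be the normal geodesic flow, which identifies the exterior $M$ of $F_0(\Sigma)$ with $\Sigma\times[0,\infty)$ and the hyperbolic metric with $g'=dr^2+g_{ab}(r)$, where $g_{ab}(r)$ is the induced metric of $\Sigma_r=F(\Sigma,r)$. Let $H_0$, $R^r$, $\Delta_r$ be the mean curvature in $g'$, the scalar curvature and the Laplacian of $\Sigma_r$. Let $\mathcal H_{\rm in}$ be a positive function on $\Sigma$, let $u>0$ (continuous on $\Sigma\times[0,\infty)$, smooth on $\Sigma\times(0,\infty)$) solve $$2H_0\,\partial_r u=2u^2\Delta_r u+(u-u^3)(R^r+6\kappa^2),\qquad u(p,0)=H_0(p,0)/\mathcal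 H_{\rm in}(p),$$ let $g''=u^2dr^2+g_{ab}(r)$, and let $\mathcal H$ be the mean curvature of $\Sigma_r$ in $g''$ (so $\mathcal H=H_0/u$). For $a=(a_1,a_2)\in\mathbb C^2$ let $\phi'_{0,a}$ be the Killing spinor of $\mathbb H^3_{-\kappa^2}$ which, in the orthonormal frame of the geodesic polar coordinates $X=\kappa^{-1}(\sinh\kappa r'\cos\theta,\ \sinh\kappa r'\sin\theta\cos\psi,\ \sinh\kappa r'\sin\theta\sin\psi,\ \cosh\kappa r')$, has the components $$\begin{bmatrix} e^{\frac{\kappa r'}2+\frac{i\psi}2}\cos\frac\theta2 & e^{\frac{\kappa r'}2-\frac{i\psi}2}\sin\frac\theta2\\ -e^{-\frac{\kappa r'}2+\frac{i\psi}2}\sin\frac\theta2 & e^{-\frac{\kappa r'}2-\frac{i\psi}2}\cos\frac\theta2\end{bmatrix}\begin{bmatrix}a_1\\a_2\end{bmatrix},$$ and let $\phi_{0,a}=A\phi'_{0,a}$, where $A:(TM,g')\to(TM,g'')$, $A(\partial_r)=u^{-1}\partial_r$, $A(X)=X$ for $X\in T\Sigma_r$, is the gauge transformation, acting on spinors by keeping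 the components and applying $A$ to the frame. Put $$\zeta(a)=\bigl(-(|a_1|^2-|a_2|^2),\,-(a_1\bar a_2+\bar a_1a_2),\,-\sqrt{-1}(a_1\bar a_2-\bar a_1a_2),\,|a_1|^2+|a_2|^2\bigr).$$ Then, pointwise on $\Sigma$, the limits $$\gamma_0=\lim_{r\to\infty}e^{-\kappa r}\kappa F(\cdot,r)=\tfrac12(\kappa F_0+N),\qquad g_{ab}(\infty)=\lim_{r\to\infty}e^{-2\kappa r}g_{ab}(r),\qquad v_\infty=\lim_{r\to\infty}e^{3\kappa r}(u-1)$$ exist, $g_{ab}(\infty)$ is the pull-back of the Lorentz inner product by $\kappa^{-1}\gamma_0$, and for every $a\in\mathbb C^2$ $$\lim_{r\to\infty}\int_{\Sigma_r}(H_0-\mathcal H)\,|\phi_{0,a}|^2=-2\kappa\int_{\Sigma_\infty}v_\infty\,\gamma_0\cdot\zeta(a),$$ where $\Sigma_\infty$ is $\Sigma$ with the metric $g_{ab}(\infty)$. -/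

import Mathlib

open Set Filter Topology Manifold
open scoped ContDiff

noncomputable section

namespace WangYau

/-! ### Minkowski space and the hyperboloid -/

/-- Minkowski space `ℝ^{3,1}` with coordinates `(x₁, x₂, x₃, t) = (x 0, x 1, x 2, x 3)`. -/
abbrev Mink : Type := Fin 4 → ℝ

/-- The Lorentz inner product `dx₁² + dx₂² + dx₃² - dt²`. -/
def mink (x y : Mink) : ℝ := x 0 * y 0 + x 1 * y 1 + x 2 * y 2 - x 3 * y 3

/-- Hyperbolic three-space of curvature `-κ²`, as the upper sheet of the hyperboloid.
Its tangent space at `x` is the Lorentz-orthogonal complement of `x`, and its metric is the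
restriction of `mink`. -/
def hyperboloid (κ : ℝ) : Set Mink := {x | mink x x = -(1 / κ ^ 2) ∧ 0 < x 3}

theorem mink_comm (x y : Mink) : mink x y = mink y x := by
  simp only [mink]; ring

theorem mink_add_left (x y z : Mink) : mink (x + y) z = mink x z + mink y z := by
  simp only [mink, Pi.add_apply]; ring

theorem mink_smul_left (c : ℝ) (x z : Mink) : mink (c • x) z = c * mink x z := by
  simp only [mink, Pi.smul_apply, smul_eq_mul]; ring

theorem mink_add_right (x y z : Mink) : mink x (y + z) = mink x y + mink x z := by
  rw [mink_comm, mink_add_left, mink_comm y, mink_comm z]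

theorem mink_smul_right (c : ℝ) (x z : Mink) : mink x (c • z) = c * mink x z := by
  rw [mink_comm, mink_smul_left, mink_comm z]

/-! ### Riemannian geometry of a surface, in charts -/

/-- The coordinate plane. -/
abbrev Plane : Type := EuclideanSpace ℝ (Fin 2)

/-- Partial derivative of a function of two real variables. -/
def pd (i : Fin 2) (f : Plane → ℝ) (y : Plane) : ℝ :=
  fderiv ℝ f y (EuclideanSpace.single i 1)

section Surface

variable {S : Type*} [TopologicalSpace S] [ChartedSpace Plane S]

variable (S) in
/-- A field of (not necessarily symmetric) bilinear forms on the tangent spaces of `S`. -/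
abbrev TwoTensor : Type _ :=
  (p : S) → TangentSpace (𝓡 2) p → TangentSpace (𝓡 2) p → ℝ

/-- The `i`-th coordinate vector field of the chart around `x`, at the point with
coordinates `y`. -/
def coordVec (x : S) (y : Plane) (i : Fin 2) :
    TangentSpace (𝓡 2) ((extChartAt (𝓡 2) x).symm y) :=
  mfderiv 𝓘(ℝ, Plane) (𝓡 2) (extChartAt (𝓡 2) x).symm y (EuclideanSpace.single i (1 : ℝ) : Plane)

/-- The matrix `T_{ij}` of a 2-tensor in the chart around `x`, as a function of the
coordinates `y`. -/
def coordMatrix (T : TwoTensor S) (x : S) (y : Plane) : Matrix (Fin 2) (Fin 2) ℝ :=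
  Matrix.of fun i j => T _ (coordVec x y i) (coordVec x y j)

/-- The trace `g^{ij} T_{ij}` of a 2-tensor with respect to a metric. -/
def traceWrt (g T : TwoTensor S) (p : S) : ℝ :=
  ((coordMatrix g p (extChartAt (𝓡 2) p p))⁻¹ *
    coordMatrix T p (extChartAt (𝓡 2) p p)).trace

/-- The Laplace-Beltrami operator
`Δ f = (det g)^{-1/2} ∂_i ((det g)^{1/2} g^{ij} ∂_j f)`, computed in the chart around `p`. -/
def laplacian (g : TwoTensor S) (f : S → ℝ) (p : S) : ℝ :=
  (√(coordMatrix g p (extChartAt (𝓡 2) p p)).det)⁻¹ *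
    ∑ i : Fin 2, ∑ j : Fin 2,
      pd i (fun y => √(coordMatrix g p y).det * (coordMatrix g p y)⁻¹ i j *
        pd j (fun z => f ((extChartAt (𝓡 2) p).symm z)) y) (extChartAt (𝓡 2) p p)

/-- Christoffel symbols of the first kind
`Γ_{k,ij} = (∂_i g_{jk} + ∂_j g_{ik} - ∂_k g_{ij}) / 2` of a metric in coordinates. -/
def christoffel (G : Plane → Matrix (Fin 2) (Fin 2) ℝ) (k i j : Fin 2) (y : Plane) : ℝ :=
  (pd i (fun z => G z j k) y + pd j (fun z => G z i k) y - pd k (fun z => G z i j) y) / 2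

/-- The Riemann curvature tensor of a metric in coordinates,
`R_{iklm} = (∂_k∂_l g_{im} + ∂_i∂_m g_{kl} - ∂_k∂_m g_{il} - ∂_i∂_l g_{km}) / 2
  + g^{ab} (Γ_{a,kl} Γ_{b,im} - Γ_{a,km} Γ_{b,il})`
(so that `R_{1212}` is the Gaussian curvature times `det g`). -/
def riemann (G : Plane → Matrix (Fin 2) (Fin 2) ℝ) (i k l m : Fin 2) (y : Plane) : ℝ :=
  (pd k (pd l fun z => G z i m) y + pd i (pd m fun z => G z k l) y
    - pd k (pd m fun z => G z i l) y - pd i (pd l fun z => G z k m) y) / 2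
  + ∑ a : Fin 2, ∑ b : Fin 2, (G y)⁻¹ a b *
      (christoffel G a k l y * christoffel G b i m y
        - christoffel G a k m y * christoffel G b i l y)

/-- The scalar curvature `g^{il} g^{km} R_{iklm}`, computed in the chart around `p`. -/
def scalarCurvature (g : TwoTensor S) (p : S) : ℝ :=
  ∑ i : Fin 2, ∑ k : Fin 2, ∑ l : Fin 2, ∑ m : Fin 2,
    (coordMatrix g p (extChartAt (𝓡 2) p p))⁻¹ i l *
      (coordMatrix g p (extChartAt (𝓡 2) p p))⁻¹ k m *
        riemann (coordMatrix g p) i k l m (extChartAt (𝓡 2) p p)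

variable (S) in
/-- A smooth partition of unity subordinate to the chart domains. -/
def chartPartition [IsManifold (𝓡 2) ∞ S] [CompactSpace S] [T2Space S] :
    SmoothPartitionOfUnity S (𝓡 2) S univ :=
  (SmoothPartitionOfUnity.exists_isSubordinate_chartAt_source (𝓡 2) S).choose

theorem chartPartition_isSubordinate [IsManifold (𝓡 2) ∞ S] [CompactSpace S] [T2Space S] :
    (chartPartition S).IsSubordinate fun x => (chartAt Plane x).source :=
  (SmoothPartitionOfUnity.exists_isSubordinate_chartAt_source (𝓡 2) S).choose_spec

/-- The integral `∫_S f dA_g` of a function against the area form of the metric `g`: the sum over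
the chart domains of the integrals of `ρ f (det g)^{1/2} dy¹ dy²`, for a partition of unity `ρ`
(only finitely many members of which are non-zero, as `S` is compact). -/
def surfaceIntegral [IsManifold (𝓡 2) ∞ S] [CompactSpace S] [T2Space S]
    (g : TwoTensor S) (f : S → ℝ) : ℝ :=
  ∑ᶠ x : S, ∫ y in (extChartAt (𝓡 2) x).target,
    chartPartition S x ((extChartAt (𝓡 2) x).symm y) * f ((extChartAt (𝓡 2) x).symm y) *
      √(coordMatrix g x y).det

/-- The pull-back of `mink (dY ·) (dZ ·)` for two maps into Minkowski space. -/
def pullback (Y Z : S → Mink) : TwoTensor S := fun p V W =>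
  mink (mfderiv (𝓡 2) 𝓘(ℝ, Mink) Y p V) (mfderiv (𝓡 2) 𝓘(ℝ, Mink) Z p W)

variable (S) in
/-- A closed embedded convex surface in hyperbolic space of curvature `-κ²`: a smooth injective
immersion `F₀` of `S` (which will be compact), with a smooth unit normal `N`, such that the second
fundamental form `⟨dN, dF₀⟩` with respect to `N` is positive definite. When `S` is compact and
connected, the last condition forces `N` to be the normal pointing out of the region enclosed by
the surface. -/
structure ConvexSurface (κ : ℝ) where
  F₀ : S → Mink
  N : S → Mink
  F₀_smooth : ContMDiff (𝓡 2) 𝓘(ℝ, Mink) ∞ F₀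
  N_smooth : ContMDiff (𝓡 2) 𝓘(ℝ, Mink) ∞ N
  F₀_mem : ∀ p, F₀ p ∈ hyperboloid κ
  F₀_injective : Function.Injective F₀
  F₀_immersion : ∀ p, Function.Injective (mfderiv (𝓡 2) 𝓘(ℝ, Mink) F₀ p)
  N_unit : ∀ p, mink (N p) (N p) = 1
  N_tangent : ∀ p, mink (F₀ p) (N p) = 0
  N_normal : ∀ p (V : TangentSpace (𝓡 2) p),
    mink (mfderiv (𝓡 2) 𝓘(ℝ, Mink) F₀ p V) (N p) = 0
  convex : ∀ p (V : TangentSpace (𝓡 2) p), V ≠ 0 → 0 < pullback N F₀ p V V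

namespace ConvexSurface

variable {κ : ℝ} (D : ConvexSurface S κ)

/-- The normal flow: `r ↦ F(p, r)` is the unit speed geodesic of the hyperboloid which starts at
`F₀ p` in the direction `N p`. The maps `F(·, r)`, `r ≥ 0`, parametrize the leaves `Σ_r`, and
`F` identifies `S × [0, ∞)` with the exterior `M` of the surface. -/
def flow (r : ℝ) (p : S) : Mink :=
  Real.cosh (κ * r) • D.F₀ p + (Real.sinh (κ * r) / κ) • D.N p

/-- The outward unit normal `N(p, r) = ∂F/∂r` of `Σ_r` in hyperbolic space. -/
def normal (r : ℝ) (p : S) : Mink :=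
  (κ * Real.sinh (κ * r)) • D.F₀ p + Real.cosh (κ * r) • D.N p

/-- The induced metric `g_{ab}(r)` of `Σ_r`, on the fixed surface `S`. -/
def metric (r : ℝ) : TwoTensor S := pullback (D.flow r) (D.flow r)

/-- The second fundamental form `h_{ab}(r)` of `Σ_r` in hyperbolic space. -/
def secondFF (r : ℝ) : TwoTensor S := pullback (D.normal r) (D.flow r)

/-- The mean curvature `H₀` of `Σ_r` in the hyperbolic metric `g'`. -/
def meanCurv (r : ℝ) (p : S) : ℝ := traceWrt (D.metric r) (D.secondFF r) p

/-- `u` is a solution on `S × [0, ∞)`, with initial value `H₀ / Hbd`, of the prescribed scalar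
curvature equation `2 H₀ ∂u/∂r = 2 u² Δ_r u + (u - u³) (R^r + 6 κ²)`: a positive function,
continuous on `S × [0, ∞)` and smooth on `S × (0, ∞)`. -/
structure IsLapse (Hbd : S → ℝ) (u : S → ℝ → ℝ) : Prop where
  pos : ∀ p r, 0 ≤ r → 0 < u p r
  cont : ContinuousOn (fun q : S × ℝ => u q.1 q.2) (univ ×ˢ Ici 0)
  smooth : ContMDiffOn ((𝓡 2).prod 𝓘(ℝ, ℝ)) 𝓘(ℝ, ℝ) ∞
    (fun q : S × ℝ => u q.1 q.2) (univ ×ˢ Ioi 0)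
  eqn : ∀ p r, 0 < r →
    2 * D.meanCurv r p * deriv (u p) r =
      2 * u p r ^ 2 * laplacian (D.metric r) (fun q => u q r) p
        + (u p r - u p r ^ 3) * (scalarCurvature (D.metric r) p + 6 * κ ^ 2)
  init : ∀ p, u p 0 = D.meanCurv 0 p / Hbd p

/-- The second fundamental form of `Σ_r` in the metric `g'' = u² dr² + g_{ab}(r)`: half the Lie
derivative of the metric along the unit normal `u⁻¹ ∂/∂r`. -/
def secondFF'' (u : S → ℝ → ℝ) (r : ℝ) : TwoTensor S := fun p V W =>
  (1 / 2) * ((u p r)⁻¹ * deriv (fun s => D.metric s p V W) r)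

/-- The mean curvature `𝓗` of `Σ_r` in the metric `g''`. -/
def meanCurv'' (u : S → ℝ → ℝ) (r : ℝ) (p : S) : ℝ :=
  traceWrt (D.metric r) (D.secondFF'' u r) p

/-- The 1-form `dr` on the tangent space of `M ⊆ ℍ³` at `F(p, r)`. -/
def dr (r : ℝ) (p : S) (V : Mink) : ℝ := mink V (D.normal r p)

/-- The metric `g'' = u² dr² + g_{ab}(r) = u² dr² + (g' - dr²)` on the tangent space of `M` at
`F(p, r)`; here `c` is the value of `u`. -/
def metric'' (c r : ℝ) (p : S) (V W : Mink) : ℝ :=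
  c ^ 2 * (D.dr r p V * D.dr r p W) + (mink V W - D.dr r p V * D.dr r p W)

/-- The gauge transformation `A : (TM, g') → (TM, g'')` at `F(p, r)`: `A (∂/∂r) = u⁻¹ ∂/∂r` and
`A X = X` for `X` tangent to `Σ_r`; here `c` is the value of `u`. -/
def gauge (c r : ℝ) (p : S) (V : Mink) : Mink :=
  V + ((c⁻¹ - 1) * D.dr r p V) • D.normal r p

/-- The Gauss map into the light cone, normalized so that `γ₀ = lim e^{-κ r} κ X(F(·, r))`. -/
def gaussMap (p : S) : Mink := (1 / 2 : ℝ) • (κ • D.F₀ p + D.N p)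

/-- The metric of `Σ_∞`: the pull-back of the Lorentz inner product by `κ⁻¹ γ₀`. -/
def metricInfty : TwoTensor S :=
  pullback (fun p => κ⁻¹ • D.gaussMap p) (fun p => κ⁻¹ • D.gaussMap p)

theorem mink_F₀_F₀ (hκ : 0 < κ) (p : S) : κ ^ 2 * mink (D.F₀ p) (D.F₀ p) = -1 := by
  rw [(D.F₀_mem p).1]; field_simp

theorem mink_normal_normal (hκ : 0 < κ) (r : ℝ) (p : S) :
    mink (D.normal r p) (D.normal r p) = 1 := by
  have h1 := D.mink_F₀_F₀ hκ p
  have h2 := D.N_tangent p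
  have h3 := mink_comm (D.N p) (D.F₀ p)
  have h4 := D.N_unit p
  have h5 := Real.cosh_sq (κ * r)
  simp only [normal, mink_add_left, mink_add_right, mink_smul_left, mink_smul_right, h3, h2, h4]
  linear_combination (Real.sinh (κ * r)) ^ 2 * h1 + h5

theorem mink_flow_normal (hκ : 0 < κ) (r : ℝ) (p : S) :
    mink (D.flow r p) (D.normal r p) = 0 := by
  have h1 := D.mink_F₀_F₀ hκ p
  have h2 := D.N_tangent p
  have h3 := mink_comm (D.N p) (D.F₀ p)
  have h4 := D.N_unit p
  simp only [flow, normal, mink_add_left, mink_add_right, mink_smul_left, mink_smul_right, h3, h2,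
    h4]
  field_simp
  linear_combination (Real.sinh (κ * r)) * (Real.cosh (κ * r)) * h1

theorem mink_flow_flow (hκ : 0 < κ) (r : ℝ) (p : S) :
    mink (D.flow r p) (D.flow r p) = -(1 / κ ^ 2) := by
  have h1 := (D.F₀_mem p).1
  have h2 := D.N_tangent p
  have h3 := mink_comm (D.N p) (D.F₀ p)
  have h4 := D.N_unit p
  have h5 := Real.cosh_sq (κ * r)
  simp only [flow, mink_add_left, mink_add_right, mink_smul_left, mink_smul_right, h3, h2,
    h4, h1]
  field_simp
  linear_combination -h5

theorem flow_mem (hκ : 0 < κ) (r : ℝ) (p : S) : D.flow r p ∈ hyperboloid κ := by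
  refine ⟨D.mink_flow_flow hκ r p, ?_⟩
  obtain ⟨h1, h1'⟩ := D.F₀_mem p
  have h2 := D.N_tangent p
  have h4 := D.N_unit p
  have h5 := Real.cosh_sq (κ * r)
  have hc := Real.cosh_pos (κ * r)
  simp only [flow, Pi.add_apply, Pi.smul_apply, smul_eq_mul]
  set X := D.F₀ p
  set n := D.N p
  simp only [mink] at h1 h2 h4
  have hk : κ ^ 2 * (X 0 * X 0 + X 1 * X 1 + X 2 * X 2) = κ ^ 2 * (X 3 * X 3) - 1 := by
    have : X 0 * X 0 + X 1 * X 1 + X 2 * X 2 = X 3 * X 3 - 1 / κ ^ 2 := by linarith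
    rw [this]; field_simp
  -- Cauchy-Schwarz for the spatial parts bounds the time component of the normal
  have hcs : (X 0 * n 0 + X 1 * n 1 + X 2 * n 2) ^ 2 ≤
      (X 0 * X 0 + X 1 * X 1 + X 2 * X 2) * (n 0 * n 0 + n 1 * n 1 + n 2 * n 2) := by
    nlinarith [sq_nonneg (X 0 * n 1 - X 1 * n 0), sq_nonneg (X 0 * n 2 - X 2 * n 0),
      sq_nonneg (X 1 * n 2 - X 2 * n 1)]
  have e1 : X 0 * n 0 + X 1 * n 1 + X 2 * n 2 = X 3 * n 3 := by linarith
  have e2 : n 0 * n 0 + n 1 * n 1 + n 2 * n 2 = 1 + n 3 * n 3 := by linarith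
  rw [e1, e2] at hcs
  have hle : n 3 ^ 2 + 1 ≤ (κ * X 3) ^ 2 := by
    have := mul_le_mul_of_nonneg_left hcs (sq_nonneg κ)
    rw [← mul_assoc, hk] at this
    nlinarith
  have hpos : 0 < κ * X 3 := mul_pos hκ h1'
  have hs : |Real.sinh (κ * r)| < Real.cosh (κ * r) :=
    abs_lt_of_sq_lt_sq (by linarith) hc.le
  have hn : |n 3| < κ * X 3 := abs_lt_of_sq_lt_sq (by linarith) hpos.le
  have hprod : |Real.sinh (κ * r) * n 3| < Real.cosh (κ * r) * (κ * X 3) := by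
    rw [abs_mul]
    exact mul_lt_mul'' hs hn (abs_nonneg _) (abs_nonneg _)
  have hneg := neg_abs_le (Real.sinh (κ * r) * n 3)
  have : 0 < κ * (Real.cosh (κ * r) * X 3 + Real.sinh (κ * r) / κ * n 3) := by
    have : κ * (Real.cosh (κ * r) * X 3 + Real.sinh (κ * r) / κ * n 3) =
        Real.cosh (κ * r) * (κ * X 3) + Real.sinh (κ * r) * n 3 := by field_simp
    rw [this]; linarith
  exact pos_of_mul_pos_right this hκ.le

theorem hasDerivAt_flow (hκ : 0 < κ) (r : ℝ) (p : S) :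
    HasDerivAt (fun s => D.flow s p) (D.normal r p) r := by
  have h0 : HasDerivAt (fun s : ℝ => κ * s) κ r := by simpa using (hasDerivAt_id r).const_mul κ
  have hc := (h0.cosh.smul_const (D.F₀ p)).add ((h0.sinh.div_const κ).smul_const (D.N p))
  have : D.normal r p = (Real.sinh (κ * r) * κ) • D.F₀ p +
      (Real.cosh (κ * r) * κ / κ) • D.N p := by
    rw [normal, mul_div_cancel_right₀ _ hκ.ne', mul_comm κ]
  rw [this]
  exact hc

end ConvexSurface

end Surface

/-! ### Spinors -/

/-- A spinor at the point `x` of the hyperboloid, for the inner product `B` on the tangent space at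
`x`, given by a `B`-orthonormal frame of the tangent space and by its components in `ℂ²` in the
trivialization of the spinor bundle defined by this frame. In this trivialization, Clifford
multiplication by the three frame vectors is given by the constant matrices
`[[i, 0], [0, -i]]`, `[[0, i], [i, 0]]`, `[[0, 1], [-1, 0]]`. -/
structure Spinor (B : Mink → Mink → ℝ) (x : Mink) where
  frame : Fin 3 → Mink
  tangent : ∀ i, mink x (frame i) = 0
  orthonormal : ∀ i j, B (frame i) (frame j) = if i = j then 1 else 0
  comp : EuclideanSpace ℂ (Fin 2)

/-- The square norm of a spinor, for the Hermitian inner product of the spinor bundle. -/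
def Spinor.normSq {B : Mink → Mink → ℝ} {x : Mink} (s : Spinor B x) : ℝ := ‖s.comp‖ ^ 2

/-- The point of the hyperboloid with geodesic polar coordinates `(r', θ, ψ)`. -/
def polarPoint (κ r' θ ψ : ℝ) : Mink :=
  κ⁻¹ • ![Real.sinh (κ * r') * Real.cos θ, Real.sinh (κ * r') * Real.sin θ * Real.cos ψ,
    Real.sinh (κ * r') * Real.sin θ * Real.sin ψ, Real.cosh (κ * r')]

/-- The orthonormal frame `∂/∂r'`, `κ (sinh κr')⁻¹ ∂/∂θ`, `κ (sinh κr' sin θ)⁻¹ ∂/∂ψ`. -/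
def polarFrame (κ r' θ ψ : ℝ) : Fin 3 → Mink :=
  ![![Real.cosh (κ * r') * Real.cos θ, Real.cosh (κ * r') * Real.sin θ * Real.cos ψ,
      Real.cosh (κ * r') * Real.sin θ * Real.sin ψ, Real.sinh (κ * r')],
    ![-Real.sin θ, Real.cos θ * Real.cos ψ, Real.cos θ * Real.sin ψ, 0],
    ![0, -Real.sin ψ, Real.cos ψ, 0]]

/-- The components, with respect to the polar frame, of the Killing spinor `φ'_{0,a}` of
hyperbolic space, a solution of `∇'_V φ' + (i/2) κ c'(V) φ' = 0`. -/
def killingComp (κ : ℝ) (a : EuclideanSpace ℂ (Fin 2)) (r' θ ψ : ℝ) : EuclideanSpace ℂ (Fin 2) :=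
  !₂[Complex.exp (κ * r' / 2 + Complex.I * ψ / 2) * Real.cos (θ / 2) * a 0
      + Complex.exp (κ * r' / 2 - Complex.I * ψ / 2) * Real.sin (θ / 2) * a 1,
    -Complex.exp (-(κ * r') / 2 + Complex.I * ψ / 2) * Real.sin (θ / 2) * a 0
      + Complex.exp (-(κ * r') / 2 - Complex.I * ψ / 2) * Real.cos (θ / 2) * a 1]

/-- Euclidean length of the spatial part. -/
def spaceNorm (x : Mink) : ℝ := √(x 0 ^ 2 + x 1 ^ 2 + x 2 ^ 2)

/-- The polar coordinate `r'` of a point of the hyperboloid. -/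
def polarR (κ : ℝ) (x : Mink) : ℝ := Real.arsinh (κ * spaceNorm x) / κ

/-- The polar coordinate `θ` of a point of the hyperboloid. -/
def polarθ (x : Mink) : ℝ := Real.arccos (x 0 / spaceNorm x)

/-- The polar coordinate `ψ` of a point of the hyperboloid. -/
def polarψ (x : Mink) : ℝ := Complex.arg ⟨x 1, x 2⟩

theorem polarPoint_polar {κ : ℝ} (hκ : 0 < κ) {x : Mink} (hx : x ∈ hyperboloid κ) :
    polarPoint κ (polarR κ x) (polarθ x) (polarψ x) = x := by
  obtain ⟨h1, h2⟩ := hx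
  have hsn : 0 ≤ spaceNorm x := Real.sqrt_nonneg _
  have hs2 : spaceNorm x ^ 2 = x 0 ^ 2 + x 1 ^ 2 + x 2 ^ 2 := Real.sq_sqrt (by positivity)
  have hR : κ * polarR κ x = Real.arsinh (κ * spaceNorm x) := by
    rw [polarR]; field_simp
  have hle : |x 0| ≤ spaceNorm x := abs_le_of_sq_le_sq (by nlinarith [sq_nonneg (x 1), sq_nonneg (x 2)]) hsn
  have hq : |x 0 / spaceNorm x| ≤ 1 := by
    rw [abs_div, abs_of_nonneg hsn]
    exact div_le_one_of_le₀ hle hsn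
  have hcos : spaceNorm x * Real.cos (polarθ x) = x 0 := by
    rw [polarθ, Real.cos_arccos (abs_le.1 hq).1 (abs_le.1 hq).2]
    rcases hsn.eq_or_lt with h | h
    · rw [← h] at hle
      rw [← h, abs_nonpos_iff.1 hle]; simp
    · field_simp
  have hn2 : ‖(⟨x 1, x 2⟩ : ℂ)‖ ^ 2 = x 1 ^ 2 + x 2 ^ 2 := by
    rw [← Complex.normSq_eq_norm_sq, Complex.normSq_mk]; ring
  have hsin : spaceNorm x * Real.sin (polarθ x) = ‖(⟨x 1, x 2⟩ : ℂ)‖ := by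
    have hθ : 0 ≤ Real.sin (polarθ x) := by
      rw [polarθ, Real.sin_arccos]; exact Real.sqrt_nonneg _
    have := Real.sin_sq_add_cos_sq (polarθ x)
    refine (sq_eq_sq₀ (by positivity) (by positivity)).1 ?_
    rw [hn2]
    have e : (spaceNorm x * Real.cos (polarθ x)) ^ 2 = x 0 ^ 2 := by rw [hcos]
    nlinarith
  have hcψ : ‖(⟨x 1, x 2⟩ : ℂ)‖ * Real.cos (polarψ x) = x 1 := Complex.norm_mul_cos_arg _
  have hsψ : ‖(⟨x 1, x 2⟩ : ℂ)‖ * Real.sin (polarψ x) = x 2 := Complex.norm_mul_sin_arg _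
  have hcosh : Real.cosh (κ * polarR κ x) = κ * x 3 := by
    rw [hR, Real.cosh_arsinh, Real.sqrt_eq_iff_mul_self_eq (by positivity) (by positivity)]
    simp only [mink] at h1
    have : x 0 ^ 2 + x 1 ^ 2 + x 2 ^ 2 = x 3 ^ 2 - 1 / κ ^ 2 := by linarith
    rw [mul_pow, hs2, this]; field_simp; ring
  have hsinh : Real.sinh (κ * polarR κ x) = κ * spaceNorm x := by
    rw [hR, Real.sinh_arsinh]
  ext i
  fin_cases i
  · simp [polarPoint, hsinh, hcosh]
    field_simp; linarith
  · simp [polarPoint, hsinh, hcosh]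
    field_simp; rw [hsin, hcψ]
  · simp [polarPoint, hsinh, hcosh]
    field_simp; rw [hsin, hsψ]
  · simp [polarPoint, hsinh, hcosh]
    field_simp

theorem polarFrame_tangent (κ r' θ ψ : ℝ) (i : Fin 3) :
    mink (polarPoint κ r' θ ψ) (polarFrame κ r' θ ψ i) = 0 := by
  have h1 := Real.sin_sq_add_cos_sq θ
  have h2 := Real.sin_sq_add_cos_sq ψ
  fin_cases i <;> simp [mink, polarPoint, polarFrame]
  · linear_combination κ⁻¹ * Real.sinh (κ * r') * Real.cosh (κ * r') *
      (h1 + Real.sin θ ^ 2 * h2)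
  · linear_combination κ⁻¹ * Real.sinh (κ * r') * Real.sin θ * Real.cos θ * h2
  · ring

theorem polarFrame_orthonormal (κ r' θ ψ : ℝ) (i j : Fin 3) :
    mink (polarFrame κ r' θ ψ i) (polarFrame κ r' θ ψ j) = if i = j then 1 else 0 := by
  have h1 := Real.sin_sq_add_cos_sq θ
  have h2 := Real.sin_sq_add_cos_sq ψ
  have h3 := Real.cosh_sq (κ * r')
  fin_cases i <;> fin_cases j <;> simp [mink, polarFrame]
  · linear_combination Real.cosh (κ * r') ^ 2 * (h1 + Real.sin θ ^ 2 * h2) + h3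
  · linear_combination Real.cosh (κ * r') * Real.sin θ * Real.cos θ * h2
  · ring
  · linear_combination Real.cosh (κ * r') * Real.sin θ * Real.cos θ * h2
  · linear_combination h1 + Real.cos θ ^ 2 * h2
  · ring
  · ring
  · ring
  · linear_combination h2

/-- The Killing spinor `φ'_{0,a}` at a point of hyperbolic space. -/
def killingSpinor {κ : ℝ} (hκ : 0 < κ) (a : EuclideanSpace ℂ (Fin 2)) (x : Mink)
    (hx : x ∈ hyperboloid κ) : Spinor mink x where
  frame := polarFrame κ (polarR κ x) (polarθ x) (polarψ x)
  tangent i := by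
    have h := polarFrame_tangent κ (polarR κ x) (polarθ x) (polarψ x) i
    rwa [polarPoint_polar hκ hx] at h
  orthonormal := polarFrame_orthonormal κ (polarR κ x) (polarθ x) (polarψ x)
  comp := killingComp κ a (polarR κ x) (polarθ x) (polarψ x)

section Gauge

variable {S : Type*} [TopologicalSpace S] [ChartedSpace Plane S] {κ : ℝ}

/-- The action of the gauge transformation `A` on spinors: the spinor with given components in a
`g'`-orthonormal frame goes to the spinor for `g''` with the same components in the image of this
frame under `A`; here `c` is the value of `u`. -/
def ConvexSurface.gaugeSpinor (D : ConvexSurface S κ) (hκ : 0 < κ) {c : ℝ} (hc : 0 < c) (r : ℝ)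
    (p : S) (s : Spinor mink (D.flow r p)) : Spinor (D.metric'' c r p) (D.flow r p) where
  frame i := D.gauge c r p (s.frame i)
  tangent i := by
    rw [gauge, mink_add_right, mink_smul_right, D.mink_flow_normal hκ, s.tangent]; simp
  orthonormal i j := by
    rw [← s.orthonormal i j]
    have h1 := D.mink_normal_normal hκ r p
    have h2 : c * c⁻¹ = 1 := mul_inv_cancel₀ hc.ne'
    simp only [metric'', gauge, dr, mink_add_left, mink_add_right, mink_smul_left,
      mink_smul_right, h1, mink_comm (D.normal r p) (s.frame j)]
    linear_combination (mink (s.frame i) (D.normal r p) * mink (s.frame j) (D.normal r p)) *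
      (c * c⁻¹ + 1) * h2
  comp := s.comp

/-- The asymptotically Killing spinor `φ_{0,a} = A φ'_{0,a}` on `(M, g'')` at `F(p, r)`. -/
def ConvexSurface.asympKilling (D : ConvexSurface S κ) (hκ : 0 < κ)
    (a : EuclideanSpace ℂ (Fin 2)) {u : S → ℝ → ℝ} {r : ℝ} {p : S} (hu : 0 < u p r) :
    Spinor (D.metric'' (u p r) r p) (D.flow r p) :=
  D.gaugeSpinor hκ hu r p (killingSpinor hκ a (D.flow r p) (D.flow_mem hκ r p))

end Gauge

/-- The vector `ζ(a)` of the future light cone attached to a constant spinor `a`. -/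
def zeta (a : EuclideanSpace ℂ (Fin 2)) : Mink :=
  ![-(‖a 0‖ ^ 2 - ‖a 1‖ ^ 2),
    (-(a 0 * star (a 1) + star (a 0) * a 1)).re,
    (-Complex.I * (a 0 * star (a 1) - star (a 0) * a 1)).re,
    ‖a 0‖ ^ 2 + ‖a 1‖ ^ 2]

end WangYau

end

/-!
# Asymptotics of the lapse and of the mass integrals along the normal flow

Put `s = e^{-2κr}`. The leaf at distance `r` is `e^{κr}` times the rescaled leaf
`X_s = ((1 + s)/2) F₀ + ((1 - s)/(2κ)) N` (`ConvexSurface.slice`), which is affine in `s` and extends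
to `s = 0`, where it equals `κ⁻¹ γ₀`. This gives the limits of the flow and of the metrics. Convexity
of the initial surface keeps the rescaled metrics positive definite up to and including `s = 0`
(`ConvexSurface.gram_slice_pos`), so everything computed from `X_s` is bounded uniformly in `s`; in
particular `H₀ = 2κ + O(s)` and, by the Gauss equation (`scalCoord_gram`), `R^r = O(s)`
(`ConvexSurface.exists_curvature_bound`). The Laplacian of the leaf is `s` times that of `X_s`.

The lapse. With these bounds the maximum principle applies to `(u⁻² - 1) e^{3κr + bs}` for a large
constant `b`, and `|u - 1| = O(e^{-3κr})` (`ConvexSurface.IsLapse.exists_decay`). Hence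
`w = e^{3κr} (u - 1)` is bounded. Since `ds = -2κ s dr`, and the Laplacian of the leaf carries a
factor `s`, in the time variable `s` the function `w` solves a linear uniformly parabolic equation
with bounded coefficients, whose final time `s = 0` is finite. Only pointwise convergence of `w` is
needed, and for this no regularity of the coefficients: in coordinates which are orthonormal at the
point for the metric of `X_0`, the second order coefficients are close to multiples of the identity.
In this situation the doubling of variables of Ishii and Lions, with the modulus `|x - y|^{1/2}`,
bounds the oscillation of `w` at the point uniformly in time
(`IsParabolicSolution.exists_modulus`): at an interior maximum of the doubled function the concavity
of the modulus, seen along the reflected pair of directions `(n, -n)` with `n` parallel to `x - y`,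
produces a negative second order term which beats all the others. A parabolic barrier then turns
equicontinuity in space into the Cauchy property in time (`IsParabolicSolution.exists_tendsto`).

The integrals. In the polar frame `|φ_{0,a}|² = -κ F · ζ(a)`, an explicit computation
(`norm_sq_killingComp`), and the gauge transformation preserves the norm; moreover `𝓗 = H₀ / u`
(`ConvexSurface.meanCurv''_eq`). So the integrand against the area element of the rescaled leaf is
`s⁻¹ · H₀ (1 - u⁻¹) · (-κ F · ζ(a))`, in which `s⁻¹ = e^{2κr}`, `1 - u⁻¹ = O(e^{-3κr})` and
`F = e^{κr} X_s`. The exponentials cancel, the integrand is bounded and converges pointwise, and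
dominated convergence in the finitely many charts which contribute
(`ConvexSurface.IsLapse.tendsto_chart_integral`) gives the limit.

The Laplacian and the scalar curvature are defined in one chart at each point, while the estimates
use other coordinates. For metrics induced by maps into Minkowski space the change of coordinates is
cheap: `Δf` is the trace of the coordinate Hessian of `f - ⟨V, X⟩`, where the fixed vector `V` is the
gradient of `f` at the point. This function has a critical point there, so that its Hessian transforms
as a tensor (`lapDiv_gram`, `lapEmb_comp`).
-/

noncomputable section

namespace WangYau

/-! ### Partial derivatives and second-order tests -/

/-- Partial derivative of a vector-valued function of two real variables. -/
def pdv {E : Type*} [NormedAddCommGroup E] [NormedSpace ℝ E] (i : Fin 2) (f : Plane → E)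
    (y : Plane) : E :=
  fderiv ℝ f y (EuclideanSpace.single i 1)

/-- The second derivative `∂_v ∂_v f` of a function at `x`. -/
def hess (f : Plane → ℝ) (x v : Plane) : ℝ :=
  ∑ i : Fin 2, ∑ j : Fin 2, v i * v j * pd i (pd j f) x

section Calculus

variable {E : Type*} [NormedAddCommGroup E] [NormedSpace ℝ E]

theorem fderiv_eq_sum_pdv (f : Plane → E) (y v : Plane) :
    fderiv ℝ f y v = v 0 • pdv 0 f y + v 1 • pdv 1 f y := by
  have hv : v = v 0 • EuclideanSpace.single (0 : Fin 2) (1 : ℝ) +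
      v 1 • EuclideanSpace.single (1 : Fin 2) (1 : ℝ) := by
    ext i; fin_cases i <;> simp
  conv_lhs => rw [hv]
  simp [pdv]

theorem contDiffOn_pdv {f : Plane → E} {U : Set Plane} (hU : IsOpen U) {n m : WithTop ℕ∞}
    (hf : ContDiffOn ℝ n f U) (hmn : m + 1 ≤ n) (i : Fin 2) : ContDiffOn ℝ m (pdv i f) U :=
  (hf.fderiv_of_isOpen hU hmn).clm_apply contDiffOn_const

theorem contDiffOn_pd {f : Plane → ℝ} {U : Set Plane} (hU : IsOpen U) {n m : WithTop ℕ∞}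
    (hf : ContDiffOn ℝ n f U) (hmn : m + 1 ≤ n) (i : Fin 2) : ContDiffOn ℝ m (pd i f) U :=
  contDiffOn_pdv hU hf hmn i

theorem hasDerivAt_line {f : Plane → ℝ} {U : Set Plane} (hU : IsOpen U)
    (hf : ContDiffOn ℝ 1 f U) {x v : Plane} {t : ℝ} (hx : x + t • v ∈ U) :
    HasDerivAt (fun t : ℝ => f (x + t • v))
      (v 0 * pd 0 f (x + t • v) + v 1 * pd 1 f (x + t • v)) t := by
  have h1 : HasFDerivAt f (fderiv ℝ f (x + t • v)) (x + t • v) :=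
    ((hf.contDiffAt (hU.mem_nhds hx)).differentiableAt (by simp)).hasFDerivAt
  have h2 : HasDerivAt (fun t : ℝ => x + t • v) v t := by
    simpa using ((hasDerivAt_id t).smul_const v).const_add x
  have h3 := h1.comp_hasDerivAt t h2
  rw [fderiv_eq_sum_pdv] at h3
  exact h3

theorem hasDerivAt_line_deriv {f : Plane → ℝ} {U : Set Plane} (hU : IsOpen U)
    (hf : ContDiffOn ℝ 2 f U) {x v : Plane} (hx : x ∈ U) :
    HasDerivAt (fun t : ℝ => v 0 * pd 0 f (x + t • v) + v 1 * pd 1 f (x + t • v))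
      (hess f x v) 0 := by
  have h := fun i => hasDerivAt_line (v := v) (t := 0) hU
    (contDiffOn_pd hU hf (m := 1) (by norm_num [one_add_one_eq_two]) i) (by simpa using hx)
  have := ((h 0).const_mul (v 0)).add ((h 1).const_mul (v 1))
  refine this.congr_deriv ?_
  simp only [zero_smul, add_zero, hess, Fin.sum_univ_two]
  ring

/-- If a twice differentiable function lies below a parabola which it touches at `0`, then its
first two derivatives at `0` compare with those of the parabola. -/
theorem deriv_le_of_touching {h h' : ℝ → ℝ} {h2 β γ : ℝ}
    (hd : ∀ᶠ t in 𝓝 (0 : ℝ), HasDerivAt h (h' t) t) (hd2 : HasDerivAt h' h2 0)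
    (hle : ∀ᶠ t in 𝓝 (0 : ℝ), h t ≤ h 0 + β * t + γ / 2 * t ^ 2) : h' 0 = β ∧ h2 ≤ γ := by
  set k : ℝ → ℝ := fun t => h t - β * t - γ / 2 * t ^ 2 with hk
  set k' : ℝ → ℝ := fun t => h' t - β - γ * t with hk'
  have hkd : ∀ᶠ t in 𝓝 (0 : ℝ), HasDerivAt k (k' t) t := by
    filter_upwards [hd] with t ht
    have := (ht.sub ((hasDerivAt_id t).const_mul β)).sub ((hasDerivAt_pow 2 t).const_mul (γ / 2))
    refine this.congr_deriv ?_
    simp only [hk']; push_cast; ring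
  have hkd2 : HasDerivAt k' (h2 - γ) 0 := by
    exact ((hd2.sub_const β).sub ((hasDerivAt_id (0 : ℝ)).const_mul γ)).congr_deriv (by ring)
  have hmax : IsLocalMax k 0 := by
    filter_upwards [hle] with t ht
    simp only [hk]; linarith
  have h0 : k' 0 = 0 := hmax.hasDerivAt_eq_zero hkd.self_of_nhds
  refine ⟨by simp [hk'] at h0; linarith, ?_⟩
  by_contra hc
  push Not at hc
  have hdk : deriv k =ᶠ[𝓝 0] k' := by
    filter_upwards [hkd] with t ht using ht.deriv
  have e2 : deriv (deriv k) 0 = h2 - γ := by rw [hdk.deriv_eq, hkd2.deriv]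
  have hmin : IsLocalMin k 0 := isLocalMin_of_deriv_deriv_pos (by rw [e2]; linarith)
    (by rw [hkd.self_of_nhds.deriv, h0]) hkd.self_of_nhds.continuousAt
  have hconst : k =ᶠ[𝓝 0] fun _ => k 0 := by
    filter_upwards [hmin, hmax] with t h1 h2 using le_antisymm h2 h1
  have hz : deriv k =ᶠ[𝓝 0] fun _ => (0 : ℝ) := by
    filter_upwards [hconst.eventuallyEq_nhds] with t ht
    rw [ht.deriv_eq]; simp
  have : deriv (deriv k) 0 = 0 := by rw [hz.deriv_eq]; simp
  linarith

/-- The second-order test for the difference of two functions, along a pair of lines. -/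
theorem touching_pair {f g : Plane → ℝ} {U : Set Plane} (hU : IsOpen U)
    (hf : ContDiffOn ℝ 2 f U) (hg : ContDiffOn ℝ 2 g U) {x y v v' : Plane} (hx : x ∈ U)
    (hy : y ∈ U) {β γ : ℝ}
    (hle : ∀ᶠ t in 𝓝 (0 : ℝ),
      f (x + t • v) - g (y + t • v') ≤ f x - g y + β * t + γ / 2 * t ^ 2) :
    (v 0 * pd 0 f x + v 1 * pd 1 f x) - (v' 0 * pd 0 g y + v' 1 * pd 1 g y) = β ∧
      hess f x v - hess g y v' ≤ γ := by
  have ev : ∀ (x v : Plane), x ∈ U → ∀ᶠ t in 𝓝 (0 : ℝ), x + t • v ∈ U := by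
    intro x v hx
    have : Continuous fun t : ℝ => x + t • v := by fun_prop
    exact this.continuousAt.eventually (hU.mem_nhds (by simpa using hx))
  have := deriv_le_of_touching (h := fun t => f (x + t • v) - g (y + t • v')) (β := β) (γ := γ)
    (h' := fun t => (v 0 * pd 0 f (x + t • v) + v 1 * pd 1 f (x + t • v)) -
      (v' 0 * pd 0 g (y + t • v') + v' 1 * pd 1 g (y + t • v')))
    (by
      filter_upwards [ev x v hx, ev y v' hy] with t h1 h2
      exact (hasDerivAt_line hU (hf.of_le (by norm_num)) h1).sub
        (hasDerivAt_line hU (hg.of_le (by norm_num)) h2))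
    ((hasDerivAt_line_deriv hU hf hx).sub (hasDerivAt_line_deriv hU hg hy))
    (by simpa using hle)
  simpa using this

/-- A function whose left difference quotients at `b` are nonnegative has nonnegative derivative. -/
theorem deriv_nonneg_of_le_left {h : ℝ → ℝ} {h' a b : ℝ} (hab : a < b) (hd : HasDerivAt h h' b)
    (hle : ∀ r ∈ Icc a b, h r ≤ h b) : 0 ≤ h' := by
  have h1 := hd.hasDerivWithinAt (s := Iio b)
  rw [hasDerivWithinAt_iff_tendsto_slope' (by simp)] at h1
  refine ge_of_tendsto h1 ?_
  filter_upwards [Ioo_mem_nhdsLT hab] with r hr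
  rw [slope_def_field]
  exact div_nonneg_of_nonpos (by linarith [hle r ⟨hr.1.le, hr.2.le⟩]) (by linarith [hr.2])

end Calculus

/-- The trace of the product of a positive semidefinite matrix and a bounded quadratic form. -/
theorem trace_mul_le {a b d w00 w01 w10 w11 c : ℝ} (ha : 0 ≤ a) (hd : 0 ≤ d)
    (hdet : b ^ 2 ≤ a * d)
    (hW : ∀ v0 v1 : ℝ, v0 * v0 * w00 + v0 * v1 * w01 + v1 * v0 * w10 + v1 * v1 * w11 ≤
      c * (v0 ^ 2 + v1 ^ 2)) :
    a * w00 + b * w01 + b * w10 + d * w11 ≤ c * (a + d) := by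
  rcases ha.eq_or_lt with h | h
  · subst h
    have hb : b = 0 := by nlinarith
    subst hb
    nlinarith [hW 0 1]
  · have h1 := hW a b
    have h2 := hW 0 1
    have h3 : 0 ≤ a * d - b ^ 2 := by linarith
    have h4 := mul_le_mul_of_nonneg_left h2 h3
    have h5 : a * (a * w00 + b * w01 + b * w10 + d * w11) ≤ a * (c * (a + d)) := by
      nlinarith
    exact le_of_mul_le_mul_left h5 h

/-! ### Bounded solutions of linear parabolic equations up to the final time -/

/-- A bounded solution `w` on the ball of radius `δ`, for `r ≥ r₀`, of the linear parabolic equation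
`∂_r w = e^{-2κr} (A^{ij} ∂_i ∂_j w + B^i ∂_i w + c)` with bounded `B` and `c`, where the symmetric
matrix `A` is bounded below by `lam` and has trace at most `9/4 lam`. In the time variable
`e^{-2κr}` this is a uniformly parabolic equation with finite final time `r = ∞`; the coefficients
need not have any regularity. -/
structure IsParabolicSolution (κ C lam δ r₀ : ℝ) (w : Plane → ℝ → ℝ)
    (A : Plane → ℝ → Matrix (Fin 2) (Fin 2) ℝ) (B : Plane → ℝ → Fin 2 → ℝ)
    (c : Plane → ℝ → ℝ) : Prop where
  smooth : ∀ r, r₀ ≤ r → ContDiffOn ℝ 2 (fun y => w y r) (Metric.ball 0 δ)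
  cont : ContinuousOn (fun q : Plane × ℝ => w q.1 q.2) (Metric.ball 0 δ ×ˢ Ici r₀)
  eqn : ∀ y ∈ Metric.ball (0 : Plane) δ, ∀ r, r₀ ≤ r →
    HasDerivAt (w y) (Real.exp (-(2 * κ * r)) *
      (∑ i, ∑ j, A y r i j * pd i (pd j fun z => w z r) y
        + ∑ i, B y r i * pd i (fun z => w z r) y + c y r)) r
  w_le : ∀ y ∈ Metric.ball (0 : Plane) δ, ∀ r, r₀ ≤ r → |w y r| ≤ C
  B_le : ∀ y ∈ Metric.ball (0 : Plane) δ, ∀ r, r₀ ≤ r → ∀ i, |B y r i| ≤ C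
  c_le : ∀ y ∈ Metric.ball (0 : Plane) δ, ∀ r, r₀ ≤ r → |c y r| ≤ C
  symm : ∀ y ∈ Metric.ball (0 : Plane) δ, ∀ r, r₀ ≤ r → A y r 1 0 = A y r 0 1
  le₀ : ∀ y ∈ Metric.ball (0 : Plane) δ, ∀ r, r₀ ≤ r → lam ≤ A y r 0 0
  le₁ : ∀ y ∈ Metric.ball (0 : Plane) δ, ∀ r, r₀ ≤ r → lam ≤ A y r 1 1
  det_le : ∀ y ∈ Metric.ball (0 : Plane) δ, ∀ r, r₀ ≤ r →
    A y r 0 1 ^ 2 ≤ (A y r 0 0 - lam) * (A y r 1 1 - lam)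
  trace_le : ∀ y ∈ Metric.ball (0 : Plane) δ, ∀ r, r₀ ≤ r →
    A y r 0 0 + A y r 1 1 ≤ 9 / 4 * lam

/-- The square root of a norm lies below a parabola in the norm which touches it at `d₀`; unlike the
norm, the square of the norm is quadratic along lines. -/
theorem sqrt_le_parabola {d₀ d : ℝ} (h₀ : 0 < d₀) (hd : 0 ≤ d) :
    √d ≤ √d₀ + (d ^ 2 - d₀ ^ 2) / (4 * (d₀ * √d₀)) := by
  obtain ⟨a, ha, rfl⟩ : ∃ a : ℝ, 0 < a ∧ a ^ 2 = d₀ :=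
    ⟨√d₀, Real.sqrt_pos.2 h₀, Real.sq_sqrt h₀.le⟩
  obtain ⟨b, hb, rfl⟩ : ∃ b : ℝ, 0 ≤ b ∧ b ^ 2 = d := ⟨√d, Real.sqrt_nonneg _, Real.sq_sqrt hd⟩
  rw [Real.sqrt_sq ha.le, Real.sqrt_sq hb, ← sub_le_iff_le_add', le_div_iff₀ (by positivity)]
  nlinarith [mul_nonneg (sq_nonneg (b - a)) (by positivity : 0 ≤ b ^ 2 + 2 * a * b + 3 * a ^ 2)]

/-- A second order upper bound for the square root which keeps half of its concavity. The increment
is `2t` because `|x - y|` grows twice as fast as `t` when `x` and `y` move apart along `x - y`. -/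
theorem sqrt_add_le {d₀ t : ℝ} (h₀ : 0 < d₀) (ht : |2 * t| ≤ d₀) :
    √(d₀ + 2 * t) ≤ √d₀ + 1 / √d₀ * t + -(1 / (2 * (d₀ * √d₀))) / 2 * t ^ 2 := by
  obtain ⟨a, ha, rfl⟩ : ∃ a : ℝ, 0 < a ∧ a ^ 2 = d₀ :=
    ⟨√d₀, Real.sqrt_pos.2 h₀, Real.sq_sqrt h₀.le⟩
  rw [Real.sqrt_sq ha.le]
  obtain ⟨x, rfl⟩ : ∃ x, t = a ^ 2 * x := ⟨t / a ^ 2, by field_simp⟩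
  have hx : |2 * x| ≤ 1 := by
    have : |2 * (a ^ 2 * x)| = a ^ 2 * |2 * x| := by
      rw [show 2 * (a ^ 2 * x) = a ^ 2 * (2 * x) by ring, abs_mul, abs_of_pos h₀]
    rw [this] at ht
    nlinarith
  obtain ⟨hx1, hx2⟩ := abs_le.1 hx
  have e : a + 1 / a * (a ^ 2 * x) + -(1 / (2 * (a ^ 2 * a))) / 2 * (a ^ 2 * x) ^ 2 =
      a * (1 + x - x ^ 2 / 4) := by field_simp; ring
  rw [e]
  refine Real.sqrt_le_iff.2 ⟨mul_nonneg ha.le (by nlinarith), ?_⟩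
  have : 1 + 2 * x ≤ (1 + x - x ^ 2 / 4) ^ 2 := by nlinarith [sq_nonneg (x ^ 2), sq_nonneg x]
  nlinarith [mul_le_mul_of_nonneg_left this h₀.le]

theorem plane_norm_sq (v : Plane) : ‖v‖ ^ 2 = v 0 ^ 2 + v 1 ^ 2 := by
  rw [EuclideanSpace.norm_sq_eq, Fin.sum_univ_two]; simp

namespace IsParabolicSolution

variable {κ C lam δ r₀ : ℝ} {w : Plane → ℝ → ℝ}
  {A : Plane → ℝ → Matrix (Fin 2) (Fin 2) ℝ} {B : Plane → ℝ → Fin 2 → ℝ} {c : Plane → ℝ → ℝ}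

theorem neg (h : IsParabolicSolution κ C lam δ r₀ w A B c) :
    IsParabolicSolution κ C lam δ r₀ (fun y r => -w y r) A B (fun y r => -c y r) where
  smooth r hr := (h.smooth r hr).neg
  cont := h.cont.neg
  eqn y hy r hr := by
    refine (h.eqn y hy r hr).neg.congr_deriv ?_
    have e1 : ∀ (f : Plane → ℝ) (i : Fin 2), pd i (fun z => -f z) = fun z => -pd i f z := by
      intro f i; ext z
      simp only [pd]
      rw [fderiv_fun_neg]; simp
    simp only [e1, Fin.sum_univ_two]
    ring
  w_le y hy r hr := by simpa using h.w_le y hy r hr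
  B_le := h.B_le
  c_le y hy r hr := by simpa using h.c_le y hy r hr
  symm := h.symm
  le₀ := h.le₀
  le₁ := h.le₁
  det_le := h.det_le
  trace_le := h.trace_le

/-- At the initial time the solution is Lipschitz, hence dominated by a multiple of `|x - y|^{1/2}`. -/
theorem exists_initial_holder (h : IsParabolicSolution κ C lam δ r₀ w A B c) {δ' : ℝ}
    (hδ : δ' < δ) (hδ' : 0 < δ') : ∃ M₀ : ℝ, 0 ≤ M₀ ∧ ∀ x ∈ Metric.closedBall (0 : Plane) δ',
      ∀ y ∈ Metric.closedBall (0 : Plane) δ', w x r₀ - w y r₀ ≤ M₀ * √‖x - y‖ := by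
  obtain ⟨L, hL⟩ := ((h.smooth r₀ le_rfl).mono
    (Metric.closedBall_subset_ball hδ)).exists_lipschitzOnWith (by norm_num)
    (convex_closedBall 0 δ') (isCompact_closedBall 0 δ')
  refine ⟨L * √(2 * δ'), by positivity, fun x hx y hy => ?_⟩
  have h1 := hL.dist_le_mul x hx y hy
  rw [Real.dist_eq, dist_eq_norm] at h1
  have h2 : ‖x - y‖ ≤ 2 * δ' := by
    have := norm_sub_le x y
    simp at hx hy; linarith
  have h3 : ‖x - y‖ ≤ √(2 * δ') * √‖x - y‖ := by
    nth_rw 1 [← Real.mul_self_sqrt (norm_nonneg (x - y))]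
    gcongr
  calc w x r₀ - w y r₀ ≤ L * ‖x - y‖ := (le_abs_self _).trans h1
    _ ≤ L * (√(2 * δ') * √‖x - y‖) := by gcongr
    _ = _ := by ring

/-- The first and second order conditions at an interior maximum of the doubled function
`w(x) - w(y) - M |x - y|^{1/2} - K (|x|² + |y|²)`. The concavity of the modulus enters in the last
line, through the reflection `(n, -n)`. -/
theorem doubled_max_conditions {f : Plane → ℝ} {M K : ℝ} (hM : 0 ≤ M)
    (hf : ContDiffOn ℝ 2 f (Metric.ball 0 δ)) {x y : Plane}
    (hx : x ∈ Metric.ball (0 : Plane) δ) (hy : y ∈ Metric.ball (0 : Plane) δ) (hxy : x ≠ y)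
    (hmax : ∀ᶠ p in 𝓝 (x, y),
      f p.1 - f p.2 - M * √‖p.1 - p.2‖ - K * (‖p.1‖ ^ 2 + ‖p.2‖ ^ 2) ≤
        f x - f y - M * √‖x - y‖ - K * (‖x‖ ^ 2 + ‖y‖ ^ 2)) :
    ∃ β, β = M / (2 * (‖x - y‖ * √‖x - y‖)) ∧
      (∀ i, pd i f x = β * (x - y) i + 2 * K * x i) ∧
      (∀ i, pd i f y = β * (x - y) i - 2 * K * y i) ∧
      (∀ v, hess f x v ≤ (β + 2 * K) * ‖v‖ ^ 2) ∧
      (∀ v, -hess f y v ≤ (β + 2 * K) * ‖v‖ ^ 2) ∧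
      (pd 0 (pd 0 f) x + pd 1 (pd 1 f) x) - (pd 0 (pd 0 f) y + pd 1 (pd 1 f) y) ≤
        8 * K - β := by
  have hd : 0 < ‖x - y‖ := norm_pos_iff.2 (sub_ne_zero.2 hxy)
  set d := ‖x - y‖ with hd_def
  set β := M / (2 * (d * √d)) with hβ
  have hs : 0 < √d := Real.sqrt_pos.2 hd
  have hβ0 : 0 ≤ β := by positivity
  have hline : ∀ v v' : Plane, ∀ᶠ t in 𝓝 (0 : ℝ),
      f (x + t • v) - f (y + t • v') - M * √‖x + t • v - (y + t • v')‖
        - K * (‖x + t • v‖ ^ 2 + ‖y + t • v'‖ ^ 2) ≤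
        f x - f y - M * √d - K * (‖x‖ ^ 2 + ‖y‖ ^ 2) := by
    intro v v'
    have : Continuous fun t : ℝ => (x + t • v, y + t • v') := by fun_prop
    have h0 := this.tendsto 0
    simp only [zero_smul, add_zero] at h0
    exact h0.eventually hmax
  have hsq : ∀ (a v : Plane) (t : ℝ), ‖a + t • v‖ ^ 2 =
      ‖a‖ ^ 2 + 2 * t * (a 0 * v 0 + a 1 * v 1) + t ^ 2 * ‖v‖ ^ 2 := by
    intro a v t
    simp only [plane_norm_sq, PiLp.add_apply, PiLp.smul_apply, smul_eq_mul]; ring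
  have gen : ∀ v v' : Plane,
      (v 0 * pd 0 f x + v 1 * pd 1 f x) - (v' 0 * pd 0 f y + v' 1 * pd 1 f y) =
        β * ((x - y) 0 * (v - v') 0 + (x - y) 1 * (v - v') 1)
          + 2 * K * (x 0 * v 0 + x 1 * v 1 + y 0 * v' 0 + y 1 * v' 1) ∧
      hess f x v - hess f y v' ≤ β * ‖v - v'‖ ^ 2 + 2 * K * (‖v‖ ^ 2 + ‖v'‖ ^ 2) := by
    intro v v'
    refine touching_pair Metric.isOpen_ball hf hf hx hy ?_
    filter_upwards [hline v v'] with t ht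
    have h1 := sqrt_le_parabola hd (norm_nonneg (x + t • v - (y + t • v')))
    have e : x + t • v - (y + t • v') = (x - y) + t • (v - v') := by
      rw [smul_sub]; abel
    rw [e, hsq (x - y), ← hd_def] at h1
    have h2 := mul_le_mul_of_nonneg_left h1 hM
    have e2 : M * (√d + (d ^ 2 + 2 * t * ((x - y) 0 * (v - v') 0 + (x - y) 1 * (v - v') 1) +
        t ^ 2 * ‖v - v'‖ ^ 2 - d ^ 2) / (4 * (d * √d))) = M * √d +
        β * (t * ((x - y) 0 * (v - v') 0 + (x - y) 1 * (v - v') 1)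
          + t ^ 2 * ‖v - v'‖ ^ 2 / 2) := by
      rw [hβ]; field_simp; ring
    rw [e2, ← e] at h2
    rw [hsq x, hsq y] at ht
    linarith
  have hess0 : ∀ z : Plane, hess f z 0 = 0 := by intro z; simp [hess]
  refine ⟨β, rfl, ?_, ?_, ?_, ?_, ?_⟩
  · intro i
    have := (gen (EuclideanSpace.single i 1) 0).1
    fin_cases i <;> simp at this ⊢ <;> linarith
  · intro i
    have := (gen 0 (EuclideanSpace.single i 1)).1
    fin_cases i <;> simp at this ⊢ <;> linarith
  · intro v
    have := (gen v 0).2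
    simp [hess0] at this; linarith
  · intro v
    have := (gen 0 v).2
    simp [hess0] at this; linarith
  -- the unit vector in the direction of `x - y` and its rotation by a right angle
  set n : Plane := d⁻¹ • (x - y) with hn
  set m : Plane := !₂[-n 1, n 0] with hm
  have hn1 : ‖n‖ = 1 := by
    rw [hn, norm_smul, norm_inv, norm_norm, ← hd_def, inv_mul_cancel₀ hd.ne']
  have hnn : n 0 ^ 2 + n 1 ^ 2 = 1 := by rw [← plane_norm_sq, hn1]; norm_num
  have hm1 : ‖m‖ ^ 2 = 1 := by rw [plane_norm_sq]; simp [hm]; linarith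
  have h1 := (gen m m).2
  have h2 : hess f x n - hess f y (-n) ≤ -β + 4 * K := by
    refine (touching_pair (β := M * (1 / √d) + 2 * K * ((x 0 - y 0) * n 0 + (x 1 - y 1) * n 1))
      Metric.isOpen_ball hf hf hx hy ?_).2
    have hsmall : ∀ᶠ t in 𝓝 (0 : ℝ), |2 * t| ≤ d := by
      have : Continuous fun t : ℝ => |2 * t| := by fun_prop
      have := this.continuousAt (x := 0)
      exact this.eventually (ge_mem_nhds (by simpa using hd))
    filter_upwards [hline n (-n), hsmall] with t ht hts
    have e : x + t • n - (y + t • -n) = (1 + 2 * t / d) • (x - y) := by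
      rw [hn]; ext i; simp; field_simp; ring
    have ht2 := abs_le.1 hts
    have e2 : ‖x + t • n - (y + t • -n)‖ = d + 2 * t := by
      have : 1 + 2 * t / d = (d + 2 * t) / d := by field_simp
      rw [e, norm_smul, ← hd_def, this, Real.norm_of_nonneg (div_nonneg (by linarith) hd.le)]
      field_simp
    rw [e2, hsq x, hsq y] at ht
    have h3 := mul_le_mul_of_nonneg_left (sqrt_add_le hd hts) hM
    have e3 : M * (√d + 1 / √d * t + -(1 / (2 * (d * √d))) / 2 * t ^ 2) =
        M * √d + M * (1 / √d) * t - β / 2 * t ^ 2 := by rw [hβ]; field_simp; ring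
    rw [e3] at h3
    rw [norm_neg, hn1] at ht
    simp only [PiLp.neg_apply] at ht
    linarith
  simp only [sub_self, norm_zero, hm1] at h1
  have hneg : hess f y (-n) = hess f y n := by simp [hess, Fin.sum_univ_two]
  rw [hneg] at h2
  have sumh : ∀ z, hess f z n + hess f z m = pd 0 (pd 0 f) z + pd 1 (pd 1 f) z := by
    intro z
    simp only [hess, Fin.sum_univ_two, hm]
    simp
    linear_combination (pd 0 (pd 0 f) z + pd 1 (pd 1 f) z) * hnn
  rw [← sumh, ← sumh]
  linarith

/-- Under the structure conditions, the second order part is controlled by `lam` times the Laplacian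
and an upper bound for the Hessian. -/
theorem second_order_le (h : IsParabolicSolution κ C lam δ r₀ w A B c) {y : Plane} {r γ : ℝ}
    (hy : y ∈ Metric.ball (0 : Plane) δ) (hr : r₀ ≤ r) (hγ : 0 ≤ γ) {f : Plane → ℝ} {ε : ℝ}
    (hf : ∀ v, ε * hess f y v ≤ γ * ‖v‖ ^ 2) :
    ε * ∑ i, ∑ j, A y r i j * pd i (pd j f) y ≤
      ε * (lam * (pd 0 (pd 0 f) y + pd 1 (pd 1 f) y)) + γ * (lam / 4) := by
  have h0 := h.le₀ y hy r hr
  have h1 := h.le₁ y hy r hr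
  have h3 := h.det_le y hy r hr
  have h4 := h.trace_le y hy r hr
  have h5 := h.symm y hy r hr
  have := trace_mul_le (w00 := ε * pd 0 (pd 0 f) y) (w01 := ε * pd 0 (pd 1 f) y)
    (w10 := ε * pd 1 (pd 0 f) y) (w11 := ε * pd 1 (pd 1 f) y) (c := γ)
    (sub_nonneg.2 h0) (sub_nonneg.2 h1) h3 (by
      intro v0 v1
      have := hf !₂[v0, v1]
      rw [plane_norm_sq] at this
      simp only [hess, Fin.sum_univ_two] at this
      simp at this
      linarith)
  simp only [Fin.sum_univ_two, h5]
  have h6 : γ * (A y r 0 0 - lam + (A y r 1 1 - lam)) ≤ γ * (lam / 4) := by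
    apply mul_le_mul_of_nonneg_left _ hγ; linarith
  linarith

theorem first_order_le (h : IsParabolicSolution κ C lam δ r₀ w A B c) {y : Plane} {r G : ℝ}
    (hy : y ∈ Metric.ball (0 : Plane) δ) (hr : r₀ ≤ r) {f : Plane → ℝ}
    (hf : ∀ i, |pd i f y| ≤ G) :
    |∑ i, B y r i * pd i f y| ≤ 2 * (C * G) := by
  have hC : 0 ≤ C := (abs_nonneg _).trans (h.c_le y hy r hr)
  have : ∀ i, |B y r i * pd i f y| ≤ C * G := by
    intro i
    rw [abs_mul]
    exact mul_le_mul (h.B_le y hy r hr i) (hf i) (abs_nonneg _) hC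
  rw [Fin.sum_univ_two]
  have := abs_add_le (B y r 0 * pd 0 f y) (B y r 1 * pd 1 f y)
  linarith [‹∀ i, |B y r i * pd i f y| ≤ C * G› 0, ‹∀ i, |B y r i * pd i f y| ≤ C * G› 1]

theorem plane_abs_le (v : Plane) (i : Fin 2) : |v i| ≤ ‖v‖ := by
  simpa using PiLp.norm_apply_le v i

/-- Equicontinuity at the origin, uniformly up to the final time. -/
theorem exists_modulus (h : IsParabolicSolution κ C lam δ r₀ w A B c) (hδ : 0 < δ)
    (hlam : 0 < lam) : ∃ δ' M K : ℝ, 0 < δ' ∧ δ' < δ ∧ 0 ≤ M ∧ 0 ≤ K ∧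
      ∀ r, r₀ ≤ r → ∀ x ∈ Metric.closedBall (0 : Plane) δ',
        w x r - w 0 r ≤ M * √‖x‖ + K * ‖x‖ ^ 2 := by
  have h0δ : (0 : Plane) ∈ Metric.ball 0 δ := Metric.mem_ball_self hδ
  have hC : 0 ≤ C := (abs_nonneg _).trans (h.c_le 0 h0δ r₀ le_rfl)
  -- on a small ball, the concavity of the modulus beats the first order terms
  obtain ⟨δ', hδ', hδ'1, hδ'2⟩ : ∃ δ' : ℝ, 0 < δ' ∧ δ' < δ ∧ 4 * C * (2 * δ') ≤ lam / 4 := by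
    refine ⟨min (δ / 2) (lam / (32 * (C + 1))), by positivity,
      (min_le_left _ _).trans_lt (by linarith), ?_⟩
    have h1 := min_le_right (δ / 2) (lam / (32 * (C + 1)))
    rw [le_div_iff₀ (by positivity)] at h1
    nlinarith [lt_min (half_pos hδ) (by positivity : 0 < lam / (32 * (C + 1)))]
  set K : ℝ := (2 * C + 1) / δ' ^ 2 with hK
  have hK0 : 0 ≤ K := by positivity
  obtain ⟨M₀, hM₀, hinit⟩ := h.exists_initial_holder hδ'1 hδ'
  set D : ℝ := 2 * δ' with hD
  set R : ℝ := 9 * lam * K + 8 * C * K * δ' + 2 * C with hR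
  have hR0 : 0 ≤ R := by positivity
  set M : ℝ := M₀ + 8 * (D * √D) * (R + 1) / lam with hM
  have hM0 : 0 ≤ M := by positivity
  refine ⟨δ', M, K, hδ', hδ'1, hM0, hK0, ?_⟩
  have key : ∀ r₁, r₀ ≤ r₁ → ∀ r ∈ Icc r₀ r₁, ∀ x ∈ Metric.closedBall (0 : Plane) δ',
      ∀ y ∈ Metric.closedBall (0 : Plane) δ',
      w x r - w y r - M * √‖x - y‖ - K * (‖x‖ ^ 2 + ‖y‖ ^ 2) ≤ 0 := by
    intro r₁ hr₁
    set Ψ : Plane × Plane × ℝ → ℝ := fun q =>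
      w q.1 q.2.2 - w q.2.1 q.2.2 - M * √‖q.1 - q.2.1‖ - K * (‖q.1‖ ^ 2 + ‖q.2.1‖ ^ 2) with hΨ
    set Ω : Set (Plane × Plane × ℝ) :=
      Metric.closedBall 0 δ' ×ˢ Metric.closedBall 0 δ' ×ˢ Icc r₀ r₁ with hΩ
    have hsub : Metric.closedBall (0 : Plane) δ' ⊆ Metric.ball 0 δ :=
      Metric.closedBall_subset_ball hδ'1
    have hΩc : IsCompact Ω :=
      (isCompact_closedBall _ _).prod ((isCompact_closedBall _ _).prod isCompact_Icc)
    have hΩn : Ω.Nonempty := ⟨(0, 0, r₀), by simp [hΩ, hδ'.le, hr₁]⟩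
    have hcont : ContinuousOn Ψ Ω := by
      have c1 : ContinuousOn (fun q : Plane × Plane × ℝ => w q.1 q.2.2) Ω :=
        h.cont.comp (f := fun q : Plane × Plane × ℝ => (q.1, q.2.2)) (by fun_prop)
          (fun q hq => ⟨hsub hq.1, hq.2.2.1⟩)
      have c2 : ContinuousOn (fun q : Plane × Plane × ℝ => w q.2.1 q.2.2) Ω :=
        h.cont.comp (f := fun q : Plane × Plane × ℝ => (q.2.1, q.2.2)) (by fun_prop)
          (fun q hq => ⟨hsub hq.2.1, hq.2.2.1⟩)
      have c3 : Continuous fun q : Plane × Plane × ℝ =>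
          M * √‖q.1 - q.2.1‖ := by fun_prop
      have c4 : Continuous fun q : Plane × Plane × ℝ =>
          K * (‖q.1‖ ^ 2 + ‖q.2.1‖ ^ 2) := by fun_prop
      exact ((c1.sub c2).sub c3.continuousOn).sub c4.continuousOn
    obtain ⟨⟨x, y, r⟩, ⟨hx, hy, hr⟩, hmax⟩ := hΩc.exists_isMaxOn hΩn hcont
    suffices hle : Ψ (x, y, r) ≤ 0 by
      intro r' hr' x' hx' y' hy'
      exact (hmax (show (x', y', r') ∈ Ω from ⟨hx', hy', hr'⟩)).trans hle
    by_contra hpos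
    push Not at hpos
    simp only at hx hy hr
    have hxδ := hsub hx
    have hyδ := hsub hy
    have hwx := abs_le.1 (h.w_le x hxδ r hr.1)
    have hwy := abs_le.1 (h.w_le y hyδ r hr.1)
    have hKδ : K * δ' ^ 2 = 2 * C + 1 := by rw [hK]; field_simp
    have hMs : 0 ≤ M * √‖x - y‖ := by positivity
    have hpos' : 0 < w x r - w y r - M * √‖x - y‖ - K * (‖x‖ ^ 2 + ‖y‖ ^ 2) := hpos
    have hxi : ‖x‖ < δ' := by
      by_contra hc
      push Not at hc
      have : K * δ' ^ 2 ≤ K * (‖x‖ ^ 2 + ‖y‖ ^ 2) := by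
        apply mul_le_mul_of_nonneg_left _ hK0
        nlinarith [sq_nonneg ‖y‖]
      linarith
    have hyi : ‖y‖ < δ' := by
      by_contra hc
      push Not at hc
      have : K * δ' ^ 2 ≤ K * (‖x‖ ^ 2 + ‖y‖ ^ 2) := by
        apply mul_le_mul_of_nonneg_left _ hK0
        nlinarith [sq_nonneg ‖x‖]
      linarith
    have hxy : x ≠ y := by
      rintro rfl
      have : 0 ≤ K * (‖x‖ ^ 2 + ‖x‖ ^ 2) := by positivity
      linarith
    have hrr : r₀ < r := by
      rcases hr.1.eq_or_lt with he | hlt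
      · subst he
        have h1 := hinit x hx y hy
        have h2 : M₀ * √‖x - y‖ ≤ M * √‖x - y‖ := by
          gcongr
          rw [hM]
          have : 0 ≤ 8 * (D * √D) * (R + 1) / lam := by positivity
          linarith
        have : 0 ≤ K * (‖x‖ ^ 2 + ‖y‖ ^ 2) := by positivity
        linarith
      · exact hlt
    set f : Plane → ℝ := fun z => w z r with hf
    have hnb : ∀ᶠ p in 𝓝 (x, y),
        f p.1 - f p.2 - M * √‖p.1 - p.2‖ - K * (‖p.1‖ ^ 2 + ‖p.2‖ ^ 2) ≤
          f x - f y - M * √‖x - y‖ - K * (‖x‖ ^ 2 + ‖y‖ ^ 2) := by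
      have hn1 : ∀ᶠ p in 𝓝 (x, y), p ∈ Metric.ball (0 : Plane) δ' ×ˢ Metric.ball (0 : Plane) δ' :=
        (Metric.isOpen_ball.prod Metric.isOpen_ball).mem_nhds (by simp [hxi, hyi])
      filter_upwards [hn1] with p hp
      exact hmax (show (p.1, p.2, r) ∈ Ω from
        ⟨Metric.ball_subset_closedBall hp.1, Metric.ball_subset_closedBall hp.2, hr⟩)
    obtain ⟨β, hβ, hgx, hgy, hHx, hHy, hL⟩ :=
      doubled_max_conditions hM0 (h.smooth r hr.1) hxδ hyδ hxy hnb
    have hd : 0 < ‖x - y‖ := norm_pos_iff.2 (sub_ne_zero.2 hxy)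
    have hdD : ‖x - y‖ ≤ D := by
      have := norm_sub_le x y
      rw [hD]; linarith
    have hβ0 : 0 ≤ β := by rw [hβ]; positivity
    -- the time derivative at the maximum
    have htime := deriv_nonneg_of_le_left hrr
      ((h.eqn x hxδ r hr.1).sub (h.eqn y hyδ r hr.1)) (by
        intro r' hr'
        have := hmax (show (x, y, r') ∈ Ω from ⟨hx, hy, hr'.1, hr'.2.trans hr.2⟩)
        simp only [hΨ, mem_ofPred_eq] at this
        simp only [Pi.sub_apply]
        linarith)
    rw [← mul_sub] at htime
    have htime' := nonneg_of_mul_nonneg_right htime (Real.exp_pos _)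
    have s1 := h.second_order_le hxδ hr.1 (by positivity : 0 ≤ β + 2 * K) (f := f) (ε := 1)
      (by simpa using hHx)
    have s2 := h.second_order_le hyδ hr.1 (by positivity : 0 ≤ β + 2 * K) (f := f) (ε := -1)
      (by simpa using hHy)
    have f1 := abs_le.1 <| h.first_order_le hxδ hr.1 (f := f) (G := β * D + 2 * K * δ') (by
      intro i
      rw [hgx i]
      refine (abs_add_le _ _).trans ?_
      rw [abs_mul, abs_mul, abs_of_nonneg hβ0, abs_of_nonneg (by positivity : 0 ≤ 2 * K)]
      gcongr
      · exact (plane_abs_le _ i).trans hdD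
      · exact (plane_abs_le _ i).trans hxi.le)
    have f2 := abs_le.1 <| h.first_order_le hyδ hr.1 (f := f) (G := β * D + 2 * K * δ') (by
      intro i
      rw [hgy i]
      refine (abs_sub _ _).trans ?_
      rw [abs_mul, abs_mul, abs_of_nonneg hβ0, abs_of_nonneg (by positivity : 0 ≤ 2 * K)]
      gcongr
      · exact (plane_abs_le _ i).trans hdD
      · exact (plane_abs_le _ i).trans hyi.le)
    have c1 := abs_le.1 (h.c_le x hxδ r hr.1)
    have c2 := abs_le.1 (h.c_le y hyδ r hr.1)
    have hL' := mul_le_mul_of_nonneg_left hL hlam.le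
    have hCD : β * (4 * C * D) ≤ β * (lam / 4) := mul_le_mul_of_nonneg_left hδ'2 hβ0
    -- `M` is so large that the good term wins
    have hbig : R + 1 ≤ lam / 4 * β := by
      have h1 : ‖x - y‖ * √‖x - y‖ ≤ D * √D := by gcongr
      have h2 : 8 * (D * √D) * (R + 1) / lam ≤ M := by rw [hM]; linarith
      rw [div_le_iff₀ hlam] at h2
      rw [hβ, ← mul_div_assoc, le_div_iff₀ (by positivity)]
      have h3 : (R + 1) * (‖x - y‖ * √‖x - y‖) ≤ (R + 1) * (D * √D) := by gcongr
      linarith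
    linarith
  intro r hr x hx
  have := key r hr r ⟨hr, le_rfl⟩ x hx 0 (by simp [hδ'.le])
  simp at this
  linarith

/-- Comparison with the parabolic barrier `ε + N |x|² + C' (e^{-2κr₁} - e^{-2κr})`: the solution at
the origin does not increase much at late times. -/
theorem exists_upper_control (h : IsParabolicSolution κ C lam δ r₀ w A B c) (hδ : 0 < δ)
    (hlam : 0 < lam) (hκ : 0 < κ) {ε : ℝ} (hε : 0 < ε) :
    ∃ r₁, r₀ ≤ r₁ ∧ ∀ r r', r₁ ≤ r → r ≤ r' → w 0 r' ≤ w 0 r + ε := by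
  obtain ⟨δ', M, K, hδ', hδ'1, hM, hK, hmod⟩ := h.exists_modulus hδ hlam
  have h0δ : (0 : Plane) ∈ Metric.ball 0 δ := Metric.mem_ball_self hδ
  have hC : 0 ≤ C := (abs_nonneg _).trans (h.c_le 0 h0δ r₀ le_rfl)
  obtain ⟨N, hN0, hN1, hN2⟩ : ∃ N : ℝ, 0 ≤ N ∧ 2 * C + 1 ≤ N * δ' ^ 2 ∧
      ∀ x : ℝ, 0 ≤ x → M * √x + K * x ^ 2 ≤ ε / 2 + N * x ^ 2 := by
    -- where `M √x` exceeds `ε / 2`, `x` is at least a fixed number `b`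
    set b : ℝ := (ε / (2 * (M + 1))) ^ 2 with hb
    have hb0 : 0 < b := by positivity
    refine ⟨(2 * C + 1) / δ' ^ 2 + K + (M + 1) / (b * √b), by positivity, ?_, fun x hx => ?_⟩
    · rw [add_mul, add_mul, div_mul_cancel₀ _ (by positivity)]
      have : 0 ≤ K * δ' ^ 2 + (M + 1) / (b * √b) * δ' ^ 2 := by positivity
      linarith
    · have h1 : 0 ≤ (2 * C + 1) / δ' ^ 2 * x ^ 2 := by positivity
      suffices M * √x ≤ ε / 2 + (M + 1) / (b * √b) * x ^ 2 by nlinarith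
      rcases le_total x b with hxb | hxb
      · have h2 : √x ≤ ε / (2 * (M + 1)) := by
          rw [← Real.sqrt_sq (by positivity : 0 ≤ ε / (2 * (M + 1)))]
          exact Real.sqrt_le_sqrt hxb
        have h3 : 0 ≤ (M + 1) / (b * √b) * x ^ 2 := by positivity
        rw [le_div_iff₀ (by positivity)] at h2
        nlinarith [Real.sqrt_nonneg x]
      · have hx0 : 0 < x := hb0.trans_le hxb
        have h2 : b * √b ≤ x * √x := by gcongr
        have h3 : (M + 1) * √x ≤ (M + 1) / (b * √b) * x ^ 2 := by
          rw [div_mul_eq_mul_div, le_div_iff₀ (by positivity)]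
          have : x ^ 2 = √x * (x * √x) := by
            nlinarith [Real.mul_self_sqrt hx]
          rw [this]
          have : (M + 1) * √x * (b * √b) ≤ (M + 1) * √x * (x * √x) := by gcongr
          linarith
        nlinarith [Real.sqrt_nonneg x]
  set T : ℝ := 2 * N * (9 / 4 * lam) + 2 * (C * (2 * N * δ')) + C + 1 with hT
  have hT0 : 0 < T := by positivity
  obtain ⟨r₁, hr₁, hr₁'⟩ : ∃ r₁, r₀ ≤ r₁ ∧ T / (2 * κ) * Real.exp (-(2 * κ * r₁)) ≤ ε / 2 := by
    have : Tendsto (fun r : ℝ => T / (2 * κ) * Real.exp (-(2 * κ * r))) atTop (𝓝 0) := by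
      rw [← mul_zero (T / (2 * κ))]
      exact (Real.tendsto_exp_neg_atTop_nhds_zero.comp
        (tendsto_id.const_mul_atTop (by positivity : 0 < 2 * κ))).const_mul _
    obtain ⟨r₁, h1, h2⟩ := ((eventually_ge_atTop r₀).and
      (this.eventually (ge_mem_nhds (half_pos hε)))).exists
    exact ⟨r₁, h1, h2⟩
  refine ⟨r₁, hr₁, fun ra rb hra hrb => ?_⟩
  have hra0 := hr₁.trans hra
  set e : ℝ → ℝ := fun r => Real.exp (-(2 * κ * r)) with he
  set Ψ : Plane × ℝ → ℝ := fun q =>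
    w q.1 q.2 - N * ‖q.1‖ ^ 2 + T / (2 * κ) * e q.2 with hΨ
  set Ω : Set (Plane × ℝ) := Metric.closedBall 0 δ' ×ˢ Icc ra rb with hΩ
  have hsub : Metric.closedBall (0 : Plane) δ' ⊆ Metric.ball 0 δ :=
    Metric.closedBall_subset_ball hδ'1
  have hΩc : IsCompact Ω := (isCompact_closedBall _ _).prod isCompact_Icc
  have hΩn : Ω.Nonempty := ⟨(0, ra), by simp [hΩ, hδ'.le, hrb]⟩
  have hcont : ContinuousOn Ψ Ω := by
    refine ((h.cont.mono ?_).sub (by fun_prop)).add (by fun_prop)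
    exact fun q hq => ⟨hsub hq.1, hra0.trans hq.2.1⟩
  obtain ⟨⟨x, r⟩, ⟨hx, hr⟩, hmax⟩ := hΩc.exists_isMaxOn hΩn hcont
  simp only at hx hr
  have e0 : e ra ≤ e r₁ := by
    simp only [he]; gcongr
  have hTe : T / (2 * κ) * e ra ≤ ε / 2 :=
    (mul_le_mul_of_nonneg_left e0 (by positivity)).trans hr₁'
  suffices hle : Ψ (x, r) ≤ w 0 ra + ε / 2 + T / (2 * κ) * e ra by
    have h1 := (hmax (show ((0 : Plane), rb) ∈ Ω by simp [hΩ, hδ'.le, hrb])).trans hle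
    simp only [hΨ] at h1
    have : 0 ≤ T / (2 * κ) * e rb := by positivity
    simp at h1
    linarith
  by_contra hpos
  push Not at hpos
  have hpos' : w 0 ra + ε / 2 + T / (2 * κ) * e ra <
    w x r - N * ‖x‖ ^ 2 + T / (2 * κ) * e r := hpos
  have hr0 : r₀ ≤ r := hra0.trans hr.1
  have her : T / (2 * κ) * e r ≤ T / (2 * κ) * e ra := by
    have := hr.1
    simp only [he]; gcongr
  have hxδ := hsub hx
  have hxi : ‖x‖ < δ' := by
    by_contra hc
    push Not at hc
    have h1 : N * δ' ^ 2 ≤ N * ‖x‖ ^ 2 := by gcongr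
    have h2 := abs_le.1 (h.w_le x hxδ r hr0)
    have h3 := abs_le.1 (h.w_le 0 h0δ ra hra0)
    linarith
  have hrr : ra < r := by
    rcases hr.1.eq_or_lt with heq | hlt
    · subst heq
      have h1 := hmod ra hra0 x hx
      have h2 := hN2 ‖x‖ (norm_nonneg _)
      linarith
    · exact hlt
  have hwf := h.smooth r hr0
  set f : Plane → ℝ := fun z => w z r with hf
  have hzero : ContDiffOn ℝ 2 (fun _ : Plane => (0 : ℝ)) (Metric.ball 0 δ) := contDiffOn_const
  have gen : ∀ v : Plane, v 0 * pd 0 f x + v 1 * pd 1 f x = 2 * N * (x 0 * v 0 + x 1 * v 1) ∧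
      hess f x v ≤ 2 * N * ‖v‖ ^ 2 := by
    intro v
    have := touching_pair (g := fun _ => 0) (v := v) (v' := 0)
      (β := 2 * N * (x 0 * v 0 + x 1 * v 1))
      (γ := 2 * N * ‖v‖ ^ 2) Metric.isOpen_ball hwf hzero hxδ hxδ (by
        have hc : Continuous fun t : ℝ => x + t • v := by fun_prop
        have hn : ∀ᶠ t in 𝓝 (0 : ℝ), x + t • v ∈ Metric.ball (0 : Plane) δ' :=
          hc.continuousAt.eventually (Metric.isOpen_ball.mem_nhds (by simpa using hxi))
        filter_upwards [hn] with t ht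
        have h1 := hmax (show (x + t • v, r) ∈ Ω from ⟨Metric.ball_subset_closedBall ht, hr⟩)
        simp only [hΨ, mem_ofPred_eq, plane_norm_sq, PiLp.add_apply, PiLp.smul_apply,
          smul_eq_mul] at h1 ⊢
        simp only [f]
        linarith)
    have h0 : hess (fun _ => (0 : ℝ)) x 0 = 0 := by simp [hess]
    rw [h0] at this
    simpa using this
  have hg : ∀ i, |pd i f x| ≤ 2 * N * δ' := by
    intro i
    have h1 := (gen (EuclideanSpace.single i 1)).1
    have h2 : pd i f x = 2 * N * x i := by
      fin_cases i <;> simpa using h1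
    rw [h2, abs_mul, abs_of_nonneg (by positivity)]
    gcongr
    exact (plane_abs_le _ i).trans hxi.le
  have s1 := h.second_order_le hxδ hr0 (by positivity : 0 ≤ 2 * N) (f := f) (ε := 1)
    (by simpa using fun v => (gen v).2)
  have hlap : pd 0 (pd 0 f) x + pd 1 (pd 1 f) x ≤ 4 * N := by
    have h1 := (gen (EuclideanSpace.single 0 1)).2
    have h2 := (gen (EuclideanSpace.single 1 1)).2
    simp [hess] at h1 h2
    linarith
  have hlap' := mul_le_mul_of_nonneg_left hlap hlam.le
  have f1 := abs_le.1 <| h.first_order_le hxδ hr0 hg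
  have c1 := abs_le.1 (h.c_le x hxδ r hr0)
  have hde : HasDerivAt (fun s => T / (2 * κ) * e s) (-(T * e r)) r := by
    have h1 : HasDerivAt (fun s : ℝ => -(2 * κ * s)) (-(2 * κ)) r := by
      exact ((hasDerivAt_id r).const_mul (2 * κ)).neg.congr_deriv (by ring)
    refine (h1.exp.const_mul (T / (2 * κ))).congr_deriv ?_
    simp only [he]; field_simp
  have htime := deriv_nonneg_of_le_left hrr ((h.eqn x hxδ r hr0).add hde) (by
    intro r' hr'
    have := hmax (show (x, r') ∈ Ω from ⟨hx, hr'.1, hr'.2.trans hr.2⟩)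
    simp only [hΨ, mem_ofPred_eq] at this
    simp only [Pi.add_apply]
    linarith)
  have htime2 : 0 ≤ e r * ((∑ i, ∑ j, A x r i j * pd i (pd j fun z => w z r) x
        + ∑ i, B x r i * pd i (fun z => w z r) x + c x r) - T) := by
    simp only [he] at htime ⊢
    linarith
  have htime' := nonneg_of_mul_nonneg_right htime2 (Real.exp_pos _)
  linarith

/-- A bounded solution converges at the origin as the time tends to its final value. -/
theorem exists_tendsto (h : IsParabolicSolution κ C lam δ r₀ w A B c) (hδ : 0 < δ)
    (hlam : 0 < lam) (hκ : 0 < κ) : ∃ l, Tendsto (w 0) atTop (𝓝 l) := by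
  apply cauchySeq_tendsto_of_complete
  rw [Metric.cauchySeq_iff']
  intro ε hε
  obtain ⟨r₁, -, h1⟩ := h.exists_upper_control hδ hlam hκ (half_pos hε)
  obtain ⟨r₂, -, h2⟩ := h.neg.exists_upper_control hδ hlam hκ (half_pos hε)
  refine ⟨max r₁ r₂, fun r hr => ?_⟩
  have a1 := h1 _ r (le_max_left r₁ r₂) hr
  have a2 := h2 _ r (le_max_right r₁ r₂) hr
  rw [Real.dist_eq, abs_lt]
  constructor <;> linarith

end IsParabolicSolution

/-! ### Calculus of Minkowski-valued maps of two variables -/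

section PartialDerivatives

variable {E : Type*} [NormedAddCommGroup E] [NormedSpace ℝ E]

theorem pd_eq_pdv (i : Fin 2) (f : Plane → ℝ) : pd i f = pdv i f := rfl

theorem pdv_congr {f g : Plane → E} {y : Plane} (h : f =ᶠ[𝓝 y] g) (i : Fin 2) :
    pdv i f y = pdv i g y := by
  rw [pdv, pdv, h.fderiv_eq]

theorem pd_congr {f g : Plane → ℝ} {y : Plane} (h : f =ᶠ[𝓝 y] g) (i : Fin 2) :
    pd i f y = pd i g y := pdv_congr h i

theorem pdv_eventuallyEq {f g : Plane → E} {y : Plane} (h : f =ᶠ[𝓝 y] g) (i : Fin 2) :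
    pdv i f =ᶠ[𝓝 y] pdv i g := by
  filter_upwards [h.eventuallyEq_nhds] with z hz using pdv_congr hz i

theorem pdv_comm {f : Plane → E} {U : Set Plane} (hU : IsOpen U) (hf : ContDiffOn ℝ 2 f U)
    {y : Plane} (hy : y ∈ U) (i j : Fin 2) : pdv i (pdv j f) y = pdv j (pdv i f) y := by
  have hfy := hf.contDiffAt (hU.mem_nhds hy)
  have hsym : IsSymmSndFDerivAt ℝ f y := hfy.isSymmSndFDerivAt (by simp)
  have hd : DifferentiableAt ℝ (fderiv ℝ f) y :=
    (hfy.fderiv_right (m := 1) (by norm_num [one_add_one_eq_two])).differentiableAt (by simp)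
  have e : ∀ i j : Fin 2, pdv i (pdv j f) y =
      fderiv ℝ (fderiv ℝ f) y (EuclideanSpace.single i 1) (EuclideanSpace.single j 1) := by
    intro i j
    have h1 : HasFDerivAt (fun z => fderiv ℝ f z (EuclideanSpace.single j (1 : ℝ)))
        ((fderiv ℝ (fderiv ℝ f) y).flip (EuclideanSpace.single j 1)) y :=
      hd.hasFDerivAt.clm_apply (hasFDerivAt_const _ _) |>.congr_fderiv (by ext; simp)
    change fderiv ℝ (fun z => fderiv ℝ f z (EuclideanSpace.single j (1 : ℝ))) y _ = _
    rw [h1.fderiv]; rfl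
  rw [e, e, hsym]

theorem pd_mul {f g : Plane → ℝ} {y : Plane} (hf : DifferentiableAt ℝ f y)
    (hg : DifferentiableAt ℝ g y) (i : Fin 2) :
    pd i (fun z => f z * g z) y = pd i f y * g y + f y * pd i g y := by
  simp only [pd]
  rw [fderiv_fun_mul hf hg]
  simp; ring

theorem pd_add {f g : Plane → ℝ} {y : Plane} (hf : DifferentiableAt ℝ f y)
    (hg : DifferentiableAt ℝ g y) (i : Fin 2) :
    pd i (fun z => f z + g z) y = pd i f y + pd i g y := by
  simp only [pd]
  rw [fderiv_fun_add hf hg]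
  simp

theorem pd_sub {f g : Plane → ℝ} {y : Plane} (hf : DifferentiableAt ℝ f y)
    (hg : DifferentiableAt ℝ g y) (i : Fin 2) :
    pd i (fun z => f z - g z) y = pd i f y - pd i g y := by
  simp only [pd]
  rw [fderiv_fun_sub hf hg]
  simp

theorem pd_neg (f : Plane → ℝ) (y : Plane) (i : Fin 2) :
    pd i (fun z => -f z) y = -pd i f y := by
  simp only [pd]
  rw [fderiv_fun_neg]; simp

theorem pd_comp_real {f : Plane → ℝ} {y : Plane} {g : ℝ → ℝ} {g' : ℝ}
    (hf : DifferentiableAt ℝ f y) (hg : HasDerivAt g g' (f y)) (i : Fin 2) :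
    pd i (fun z => g (f z)) y = g' * pd i f y := by
  simp only [pd]
  have := (hg.comp_hasFDerivAt y hf.hasFDerivAt).fderiv
  rw [show (fun z => g (f z)) = g ∘ f from rfl, this]
  simp

theorem pdv_comp {f : Plane → E} {τ : Plane → Plane} {q : Plane}
    (hf : DifferentiableAt ℝ f (τ q)) (hτ : DifferentiableAt ℝ τ q) (i : Fin 2) :
    pdv i (f ∘ τ) q = pdv i τ q 0 • pdv 0 f (τ q) + pdv i τ q 1 • pdv 1 f (τ q) := by
  rw [pdv, fderiv_comp q hf hτ, ContinuousLinearMap.comp_apply, fderiv_eq_sum_pdv]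
  rfl

/-- The Lorentz inner product as a continuous bilinear map. -/
def minkL : Mink →L[ℝ] Mink →L[ℝ] ℝ :=
  (LinearMap.mk₂ ℝ mink mink_add_left mink_smul_left
    mink_add_right mink_smul_right).toContinuousBilinearMap

theorem minkL_apply (x y : Mink) : minkL x y = mink x y := rfl

theorem contDiff_mink {n : WithTop ℕ∞} : ContDiff ℝ n fun p : Mink × Mink => mink p.1 p.2 :=
  minkL.isBoundedBilinearMap.contDiff

theorem mink_sub_left (x y z : Mink) : mink (x - y) z = mink x z - mink y z := by
  simp only [mink, Pi.sub_apply]; ring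

theorem mink_zero_left (x : Mink) : mink 0 x = 0 := by simp [mink]

theorem contDiffOn_mink {U : Set Plane} {n : WithTop ℕ∞} {X Y : Plane → Mink}
    (hX : ContDiffOn ℝ n X U) (hY : ContDiffOn ℝ n Y U) :
    ContDiffOn ℝ n (fun z => mink (X z) (Y z)) U :=
  contDiff_mink.comp_contDiffOn (hX.prodMk hY)

theorem pd_mink {X Y : Plane → Mink} {y : Plane} (hX : DifferentiableAt ℝ X y)
    (hY : DifferentiableAt ℝ Y y) (i : Fin 2) :
    pd i (fun z => mink (X z) (Y z)) y = mink (pdv i X y) (Y y) + mink (X y) (pdv i Y y) := by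
  have h := (minkL.hasFDerivAt_of_bilinear hX.hasFDerivAt hY.hasFDerivAt).fderiv
  simp only [pd, pdv]
  change fderiv ℝ (fun z => minkL (X z) (Y z)) y _ = _
  rw [h]
  simp [minkL_apply, add_comm]

end PartialDerivatives

/-! ### Gram matrices of local parametrizations -/

/-- The matrix `⟨∂_i Y, ∂_j Z⟩` of two maps from the coordinate plane to Minkowski space. -/
def gram (Y Z : Plane → Mink) (y : Plane) : Matrix (Fin 2) (Fin 2) ℝ :=
  Matrix.of fun i j => mink (pdv i Y y) (pdv j Z y)

theorem gram_apply (Y Z : Plane → Mink) (y : Plane) (i j : Fin 2) :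
    gram Y Z y i j = mink (pdv i Y y) (pdv j Z y) := rfl

theorem gram_symm (X : Plane → Mink) (y : Plane) (i j : Fin 2) :
    gram X X y i j = gram X X y j i := mink_comm _ _

/-- The Jacobian matrix `J_{ai} = ∂_i τ^a`. -/
def jac (τ : Plane → Plane) (q : Plane) : Matrix (Fin 2) (Fin 2) ℝ :=
  Matrix.of fun a i => pdv i τ q a

/-- The Gram matrices transform as covariant 2-tensors. -/
theorem gram_comp {Y Z : Plane → Mink} {τ : Plane → Plane} {q : Plane}
    (hY : DifferentiableAt ℝ Y (τ q)) (hZ : DifferentiableAt ℝ Z (τ q))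
    (hτ : DifferentiableAt ℝ τ q) :
    gram (Y ∘ τ) (Z ∘ τ) q = (jac τ q).transpose * gram Y Z (τ q) * jac τ q := by
  ext i j
  simp only [gram_apply, pdv_comp hY hτ, pdv_comp hZ hτ, Matrix.mul_apply, Fin.sum_univ_two,
    mink_add_left, mink_add_right, mink_smul_left, mink_smul_right, Matrix.transpose_apply, jac,
    Matrix.of_apply]
  ring

theorem inv_two (M : Matrix (Fin 2) (Fin 2) ℝ) :
    M⁻¹ = M.det⁻¹ • !![M 1 1, -M 0 1; -M 1 0, M 0 0] := by
  rw [Matrix.inv_def, Ring.inverse_eq_inv', Matrix.adjugate_fin_two]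

/-! ### The Laplace-Beltrami operator -/

/-- The Laplace-Beltrami operator of a metric in coordinates, in divergence form. -/
def lapDiv (G : Plane → Matrix (Fin 2) (Fin 2) ℝ) (f : Plane → ℝ) (x : Plane) : ℝ :=
  (√(G x).det)⁻¹ * ∑ i : Fin 2, ∑ j : Fin 2,
    pd i (fun y => √(G y).det * (G y)⁻¹ i j * pd j f y) x

/-- The gradient of `f` as a tangent vector in Minkowski space: the combination `V` of the `∂_i X`
with `⟨V, ∂_i X⟩ = ∂_i f`. -/
def gradVec (X : Plane → Mink) (f : Plane → ℝ) (y : Plane) : Mink :=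
  ∑ k : Fin 2, ∑ l : Fin 2, ((gram X X y)⁻¹ k l * pd k f y) • pdv l X y

/-- The Laplace-Beltrami operator of the metric induced by `X`, in the form
`g^{ij} (∂_i ∂_j f - ⟨V, ∂_i ∂_j X⟩)` with `V` the gradient of `f`: the trace of the Hessian of the
function `f - ⟨V, X⟩`, for which the point is critical. -/
def lapEmb (X : Plane → Mink) (f : Plane → ℝ) (y : Plane) : ℝ :=
  ∑ i : Fin 2, ∑ j : Fin 2, (gram X X y)⁻¹ i j *
    (pd i (pd j f) y - mink (gradVec X f y) (pdv i (pdv j X) y))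

theorem differentiableAt_of_smooth {E : Type*} [NormedAddCommGroup E] [NormedSpace ℝ E]
    {U : Set Plane} (hU : IsOpen U) {f : Plane → E} (hf : ContDiffOn ℝ 1 f U) {y : Plane}
    (hy : y ∈ U) : DifferentiableAt ℝ f y :=
  (hf.contDiffAt (hU.mem_nhds hy)).differentiableAt (by simp)

theorem contDiffOn_gram {U : Set Plane} (hU : IsOpen U) {Y Z : Plane → Mink}
    (hY : ContDiffOn ℝ ∞ Y U) (hZ : ContDiffOn ℝ ∞ Z U) (i j : Fin 2) :
    ContDiffOn ℝ ∞ (fun z => gram Y Z z i j) U :=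
  contDiffOn_mink (contDiffOn_pdv hU hY (by norm_num) i) (contDiffOn_pdv hU hZ (by norm_num) j)

theorem pd_gram {U : Set Plane} (hU : IsOpen U) {Y Z : Plane → Mink}
    (hY : ContDiffOn ℝ ∞ Y U) (hZ : ContDiffOn ℝ ∞ Z U) {y : Plane} (hy : y ∈ U) (k i j : Fin 2) :
    pd k (fun z => gram Y Z z i j) y =
      mink (pdv k (pdv i Y) y) (pdv j Z y) + mink (pdv i Y y) (pdv k (pdv j Z) y) :=
  pd_mink (differentiableAt_of_smooth hU (contDiffOn_pdv hU hY (by norm_cast) i) hy)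
    (differentiableAt_of_smooth hU (contDiffOn_pdv hU hZ (by norm_cast) j) hy) k

/-- In the coordinates of a surface in Minkowski space, the divergence form of the Laplace-Beltrami
operator equals the form which uses the second derivatives of the embedding. -/
theorem lapDiv_gram {U : Set Plane} (hU : IsOpen U) {X : Plane → Mink}
    (hX : ContDiffOn ℝ ∞ X U) {f : Plane → ℝ} (hf : ContDiffOn ℝ 2 f U) {y : Plane} (hy : y ∈ U)
    (hdet : 0 < (gram X X y).det) : lapDiv (gram X X) f y = lapEmb X f y := by
  set e : Plane → ℝ := fun z => gram X X z 0 0 with he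
  set m : Plane → ℝ := fun z => gram X X z 0 1 with hm
  set g : Plane → ℝ := fun z => gram X X z 1 1 with hg
  have hd : ∀ i j, DifferentiableAt ℝ (fun z => gram X X z i j) y := fun i j =>
    differentiableAt_of_smooth hU ((contDiffOn_gram hU hX hX i j).of_le (by norm_num)) hy
  have hed : DifferentiableAt ℝ e y := hd 0 0
  have hmd : DifferentiableAt ℝ m y := hd 0 1
  have hgd : DifferentiableAt ℝ g y := hd 1 1
  set d : Plane → ℝ := fun z => e z * g z - m z * m z with hdd
  have hdetd : ∀ z, (gram X X z).det = d z := by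
    intro z
    rw [Matrix.det_fin_two, gram_symm X z 1 0]
  have hdd1 : DifferentiableAt ℝ d y := (hed.mul hgd).sub (hmd.mul hmd)
  have hdpos : 0 < d y := by rw [← hdetd]; exact hdet
  have hfd : ∀ j, DifferentiableAt ℝ (pd j f) y := fun j =>
    differentiableAt_of_smooth hU (contDiffOn_pd hU hf (by norm_num [one_add_one_eq_two]) j) hy
  have hpdd : ∀ i, pd i d y = pd i e y * g y + e y * pd i g y - 2 * (m y * pd i m y) := by
    intro i
    have h1 : DifferentiableAt ℝ (fun z => e z * g z) y := hed.mul hgd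
    have h2 : DifferentiableAt ℝ (fun z => m z * m z) y := hmd.mul hmd
    rw [hdd, pd_sub h1 h2, pd_mul hed hgd, pd_mul hmd hmd]; ring
  have hsd : HasDerivAt (fun x : ℝ => (√x)⁻¹) (-(1 / (2 * √(d y))) / √(d y) ^ 2) (d y) :=
    (Real.hasDerivAt_sqrt hdpos.ne').inv (Real.sqrt_pos.2 hdpos).ne'
  have hsdd : DifferentiableAt ℝ (fun z => (√(d z))⁻¹) y := hsd.differentiableAt.comp y hdd1
  -- each coefficient is `(√det)⁻¹` times an entry of the adjugate matrix
  have term : ∀ (i j : Fin 2) (ad : Plane → ℝ), DifferentiableAt ℝ ad y →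
      (∀ z, (gram X X z)⁻¹ i j = (d z)⁻¹ * ad z) →
      pd i (fun z => √(gram X X z).det * (gram X X z)⁻¹ i j * pd j f z) y =
        (√(d y))⁻¹ * (pd i ad y * pd j f y + ad y * pd i (pd j f) y
          - pd i d y / (2 * d y) * ad y * pd j f y) := by
    intro i j ad had hinv
    have hev : (fun z => √(gram X X z).det * (gram X X z)⁻¹ i j * pd j f z) =ᶠ[𝓝 y]
        fun z => (√(d z))⁻¹ * (ad z * pd j f z) := by
      filter_upwards [hdd1.continuousAt.eventually (lt_mem_nhds hdpos)] with z hz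
      rw [hinv, hdetd]
      have h1 := Real.sqrt_pos.2 hz
      have h2 := Real.sq_sqrt hz.le
      field_simp
      rw [h2]
    have hadf : DifferentiableAt ℝ (fun z => ad z * pd j f z) y := had.mul (hfd j)
    rw [pd_congr hev, pd_mul hsdd hadf, pd_mul had (hfd j), pd_comp_real hdd1 hsd]
    have h1 := Real.sqrt_pos.2 hdpos
    have h2 := Real.sq_sqrt hdpos.le
    rw [h2]
    field_simp
    ring
  have i00 : ∀ z, (gram X X z)⁻¹ 0 0 = (d z)⁻¹ * g z := by
    intro z; rw [inv_two, hdetd]; simp [hg]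
  have i01 : ∀ z, (gram X X z)⁻¹ 0 1 = (d z)⁻¹ * -m z := by
    intro z; rw [inv_two, hdetd]; simp [hm]
  have i10 : ∀ z, (gram X X z)⁻¹ 1 0 = (d z)⁻¹ * -m z := by
    intro z; rw [inv_two, hdetd]; simp [hm, gram_symm X z 1 0]
  have i11 : ∀ z, (gram X X z)⁻¹ 1 1 = (d z)⁻¹ * e z := by
    intro z; rw [inv_two, hdetd]; simp [he]
  have pdg : ∀ k i j, pd k (fun z => gram X X z i j) y = _ := fun k i j =>
    pd_gram hU hX hX hy k i j
  have hsq : (√(d y))⁻¹ * (√(d y))⁻¹ = (d y)⁻¹ := by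
    rw [← mul_inv, Real.mul_self_sqrt hdpos.le]
  have hcomm := pdv_comm hU (hX.of_le (by norm_cast)) hy 1 0
  simp only [lapDiv, lapEmb, gradVec, Fin.sum_univ_two]
  rw [term 0 0 g hgd i00, term 0 1 (fun z => -m z) hmd.neg i01,
    term 1 0 (fun z => -m z) hmd.neg i10, term 1 1 e hed i11, i00, i01, i10, i11, hdetd]
  simp only [pd_neg, mink_add_left, mink_smul_left, hpdd]
  have e0 := pdg 0 0 0
  have e1 := pdg 1 0 0
  have m0 := pdg 0 0 1
  have m1 := pdg 1 0 1
  have g0 := pdg 0 1 1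
  have g1 := pdg 1 1 1
  rw [← he] at e0 e1
  rw [← hm] at m0 m1
  rw [← hg] at g0 g1
  rw [e0, e1, m0, m1, g0, g1]
  simp only [hcomm, mink_comm (pdv _ (pdv _ X) y)]
  rw [← mul_add, ← mul_add, ← mul_add, ← mul_assoc, hsq]
  have hd2 : d y = e y * g y - m y * m y := rfl
  field_simp
  rw [hd2]
  ring

/-- Chain rule for second derivatives at a critical point. -/
theorem pd_pd_comp_of_critical {U W : Set Plane} (hU : IsOpen U) (hW : IsOpen W) {h : Plane → ℝ}
    (hh : ContDiffOn ℝ 2 h U) {τ : Plane → Plane} (hτ : ContDiffOn ℝ 2 τ W) (hm : MapsTo τ W U)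
    {q : Plane} (hq : q ∈ W) (hcrit : ∀ a, pd a h (τ q) = 0) (i j : Fin 2) :
    pd i (pd j (h ∘ τ)) q = ∑ a, ∑ b, jac τ q a i * jac τ q b j * pd a (pd b h) (τ q) := by
  have hτd : ∀ z ∈ W, DifferentiableAt ℝ τ z := fun z hz =>
    differentiableAt_of_smooth hW (hτ.of_le (by norm_num)) hz
  have hhd : ∀ z ∈ U, DifferentiableAt ℝ h z := fun z hz =>
    differentiableAt_of_smooth hU (hh.of_le (by norm_num)) hz
  have hpd : ∀ a, DifferentiableAt ℝ (pd a h) (τ q) := fun a =>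
    differentiableAt_of_smooth hU (contDiffOn_pd hU hh (by norm_num [one_add_one_eq_two]) a)
      (hm hq)
  have hpτ : ∀ a, DifferentiableAt ℝ (fun z => pdv j τ z a) q := fun a =>
    differentiableAt_of_smooth hW (by
      exact (EuclideanSpace.proj a : Plane →L[ℝ] ℝ).contDiff.comp_contDiffOn
        (contDiffOn_pdv hW hτ (by norm_num [one_add_one_eq_two]) j)) hq
  have hcomp : ∀ a, DifferentiableAt ℝ (fun z => pd a h (τ z)) q := fun a =>
    (hpd a).comp q (hτd q hq)
  have hev : pd j (h ∘ τ) =ᶠ[𝓝 q] fun z =>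
      pdv j τ z 0 * pd 0 h (τ z) + pdv j τ z 1 * pd 1 h (τ z) := by
    filter_upwards [hW.mem_nhds hq] with z hz
    exact pdv_comp (hhd _ (hm hz)) (hτd z hz) j
  have hc : ∀ a, pd i (fun z => pd a h (τ z)) q =
      pdv i τ q 0 * pd 0 (pd a h) (τ q) + pdv i τ q 1 * pd 1 (pd a h) (τ q) := fun a =>
    pdv_comp (hpd a) (hτd q hq) i
  have hmul : ∀ a, DifferentiableAt ℝ (fun z => pdv j τ z a * pd a h (τ z)) q := fun a =>
    (hpτ a).mul (hcomp a)
  rw [pd_congr hev, pd_add (hmul 0) (hmul 1), pd_mul (hpτ 0) (hcomp 0), pd_mul (hpτ 1) (hcomp 1),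
    hc, hc, hcrit, hcrit]
  simp only [Fin.sum_univ_two, jac, Matrix.of_apply]
  ring

/-- The inverse metric transforms contravariantly. -/
theorem jac_mul_inv_gram_mul {J G : Matrix (Fin 2) (Fin 2) ℝ} (hJ : J.det ≠ 0) :
    J * (J.transpose * G * J)⁻¹ * J.transpose = G⁻¹ := by
  have h1 : IsUnit J.det := hJ.isUnit
  have h2 : IsUnit J.transpose.det := by rwa [Matrix.det_transpose]
  rw [Matrix.mul_inv_rev, Matrix.mul_inv_rev, ← Matrix.mul_assoc, Matrix.mul_nonsing_inv _ h1,
    Matrix.one_mul, Matrix.mul_assoc, Matrix.nonsing_inv_mul _ h2, Matrix.mul_one]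

/-- The defining property of the gradient. -/
theorem mink_gradVec (X : Plane → Mink) (f : Plane → ℝ) {y : Plane}
    (hdet : (gram X X y).det ≠ 0) (j : Fin 2) :
    mink (gradVec X f y) (pdv j X y) = pd j f y := by
  have h1 := Matrix.nonsing_inv_mul (gram X X y) hdet.isUnit
  have h := fun k => congrFun (congrFun h1 k) j
  have h0 := h 0
  have h1 := h 1
  simp only [Matrix.mul_apply, Fin.sum_univ_two, gram_apply] at h0 h1
  simp only [gradVec, Fin.sum_univ_two, mink_add_left, mink_smul_left]
  calc _ = pd 0 f y * (1 : Matrix (Fin 2) (Fin 2) ℝ) 0 j +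
        pd 1 f y * (1 : Matrix (Fin 2) (Fin 2) ℝ) 1 j := by rw [← h0, ← h1]; ring
    _ = _ := by obtain rfl | rfl : j = 0 ∨ j = 1 := by omega
                all_goals simp

/-- The Laplace-Beltrami operator is invariant under changes of coordinates. -/
theorem lapEmb_comp {U W : Set Plane} (hU : IsOpen U) (hW : IsOpen W) {X : Plane → Mink}
    (hX : ContDiffOn ℝ ∞ X U) {f : Plane → ℝ} (hf : ContDiffOn ℝ 2 f U) {τ : Plane → Plane}
    (hτ : ContDiffOn ℝ 2 τ W) (hm : MapsTo τ W U) {q : Plane} (hq : q ∈ W)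
    (hJ : (jac τ q).det ≠ 0) (hG : (gram X X (τ q)).det ≠ 0) :
    lapEmb (X ∘ τ) (f ∘ τ) q = lapEmb X f (τ q) := by
  have hX2 : ContDiffOn ℝ 2 X U := hX.of_le (by norm_cast)
  have hτd : DifferentiableAt ℝ τ q := differentiableAt_of_smooth hW (hτ.of_le (by norm_num)) hq
  have hXd : DifferentiableAt ℝ X (τ q) :=
    differentiableAt_of_smooth hU (hX.of_le (by norm_num)) (hm hq)
  have hfd : DifferentiableAt ℝ f (τ q) :=
    differentiableAt_of_smooth hU (hf.of_le (by norm_num)) (hm hq)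
  have hgram := gram_comp hXd hXd hτd
  have hinv := jac_mul_inv_gram_mul (G := gram X X (τ q)) hJ
  rw [← hgram] at hinv
  have hent := fun a b => congrFun (congrFun hinv a) b
  simp only [Matrix.mul_apply, Fin.sum_univ_two, Matrix.transpose_apply] at hent
  -- the gradient does not depend on the coordinates
  have hV : gradVec (X ∘ τ) (f ∘ τ) q = gradVec X f (τ q) := by
    simp only [gradVec, Fin.sum_univ_two, pdv_comp hXd hτd, pd_eq_pdv, pdv_comp hfd hτd,
      ← hent]
    simp only [jac, Matrix.of_apply, smul_eq_mul, smul_add, smul_smul]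
    module
  set V := gradVec X f (τ q) with hVdef
  have second : ∀ (Y : Plane → Mink) (k : Plane → ℝ) (O : Set Plane) (y : Plane), IsOpen O →
      y ∈ O → ContDiffOn ℝ 2 Y O → ContDiffOn ℝ 2 k O → ∀ i j,
      pd i (pd j fun z => k z - mink V (Y z)) y =
        pd i (pd j k) y - mink V (pdv i (pdv j Y) y) := by
    intro Y k O y hO hy hY hk i j
    have h1 : ∀ (Z : Plane → Mink) (l : Plane → ℝ) (z : Plane), DifferentiableAt ℝ Z z →
        DifferentiableAt ℝ l z → ∀ j, pd j (fun z => l z - mink V (Z z)) z =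
          pd j l z - mink V (pdv j Z z) := by
      intro Z l z hZ hl j
      have hV : DifferentiableAt ℝ (fun _ : Plane => V) z := differentiableAt_const _
      have hVd : DifferentiableAt ℝ (fun z => mink V (Z z)) z :=
        (minkL V).differentiableAt.comp z hZ
      rw [pd_sub hl hVd, pd_mink hV hZ]
      simp [pdv, mink_zero_left]
    have hev : (pd j fun z => k z - mink V (Y z)) =ᶠ[𝓝 y]
        fun z => pd j k z - mink V (pdv j Y z) := by
      filter_upwards [hO.mem_nhds hy] with z hz
      exact h1 Y k z (differentiableAt_of_smooth hO (hY.of_le (by norm_num)) hz)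
        (differentiableAt_of_smooth hO (hk.of_le (by norm_num)) hz) j
    rw [pd_congr hev]
    exact h1 (pdv j Y) (pd j k) y
      (differentiableAt_of_smooth hO (contDiffOn_pdv hO hY (by norm_num [one_add_one_eq_two]) j) hy)
      (differentiableAt_of_smooth hO (contDiffOn_pd hO hk
        (by norm_num [one_add_one_eq_two]) j) hy) i
  set h : Plane → ℝ := fun z => f z - mink V (X z) with hh
  have hVX : ContDiffOn ℝ 2 (fun z => mink V (X z)) U := (minkL V).contDiff.comp_contDiffOn hX2
  have hcrit : ∀ a, pd a h (τ q) = 0 := by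
    intro a
    have hV' : DifferentiableAt ℝ (fun _ : Plane => V) (τ q) := differentiableAt_const _
    have hVd : DifferentiableAt ℝ (fun z => mink V (X z)) (τ q) :=
      (minkL V).differentiableAt.comp _ hXd
    rw [hh, pd_sub hfd hVd, pd_mink hV' hXd, hVdef, mink_gradVec X f hG]
    simp [pdv, mink_zero_left]
  have hchain : ∀ i j, pd i (pd j (h ∘ τ)) q =
      ∑ a, ∑ b, jac τ q a i * jac τ q b j * pd a (pd b h) (τ q) :=
    pd_pd_comp_of_critical hU hW (hf.sub hVX) hτ hm hq hcrit
  have s1 := second X f U (τ q) hU (hm hq) hX2 hf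
  have s2 := second (X ∘ τ) (f ∘ τ) W q hW hq (hX2.comp hτ hm) (hf.comp hτ hm)
  simp only [lapEmb, hV, ← hVdef]
  simp only [← s1, ← s2]
  change ∑ i, ∑ j, (gram (X ∘ τ) (X ∘ τ) q)⁻¹ i j * pd i (pd j (h ∘ τ)) q =
    ∑ i, ∑ j, (gram X X (τ q))⁻¹ i j * pd i (pd j h) (τ q)
  simp only [hchain, Fin.sum_univ_two, ← hent]
  ring

/-! ### The Gauss equation -/

/-- Expansion of the Lorentz inner product with respect to a point `x` of the hyperboloid, a unit
normal `n` and a basis `a`, `b` of the tangent plane of a surface. -/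
theorem mink_expand {κ : ℝ} (hκ : 0 < κ) {x n a b : Mink} (hx : mink x x = -(1 / κ ^ 2))
    (hn : mink n n = 1) (hxn : mink x n = 0) (hxa : mink x a = 0) (hxb : mink x b = 0)
    (hna : mink n a = 0) (hnb : mink n b = 0) {d : ℝ}
    (hd : d = mink a a * mink b b - mink a b ^ 2) (hd0 : d ≠ 0) (Y Z : Mink) :
    mink Y Z = -κ ^ 2 * (mink Y x * mink Z x) + mink Y n * mink Z n
      + d⁻¹ * (mink b b * (mink Y a * mink Z a) - mink a b * (mink Y a * mink Z b)
        - mink a b * (mink Y b * mink Z a) + mink a a * (mink Y b * mink Z b)) := by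
  set M : Matrix (Fin 4) (Fin 4) ℝ := Matrix.of ![x, n, a, b] with hM
  set η : Matrix (Fin 4) (Fin 4) ℝ := Matrix.diagonal ![1, 1, 1, -1] with hη
  have m0 : M 0 = x := rfl
  have m1 : M 1 = n := rfl
  have m2 : M 2 = a := rfl
  have m3 : M 3 = b := rfl
  have hprod : ∀ (v : Mink) (i : Fin 4), ((M * η).mulVec v) i = mink (M i) v := by
    intro v i
    rw [← Matrix.mulVec_mulVec, Matrix.mulVec, dotProduct, Fin.sum_univ_four]
    simp [hη, Matrix.mulVec_diagonal, mink]
    ring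
  have hgram : M * η * M.transpose =
      !![-(1 / κ ^ 2), 0, 0, 0; 0, 1, 0, 0; 0, 0, mink a a, mink a b;
        0, 0, mink a b, mink b b] := by
    ext i j
    have h1 : (M * η * M.transpose) i j = mink (M i) (M j) := by
      rw [← hprod]; rfl
    rw [h1]
    fin_cases i <;> fin_cases j <;>
      simp [m0, m1, m2, m3, hx, hn, hxn, hxa, hxb, hna, hnb, mink_comm n x,
        mink_comm a x, mink_comm b x,
        mink_comm a n, mink_comm b n, mink_comm b a]
  have hdet : (M * η).det ≠ 0 := by
    intro h0
    have h1 := congrArg Matrix.det hgram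
    rw [Matrix.det_mul, h0, zero_mul] at h1
    simp [Matrix.det_succ_row_zero, Fin.sum_univ_succ, Fin.succAbove] at h1
    rcases h1 with h1 | h1
    · exact hκ.ne' h1
    · exact hd0 (by rw [hd]; linarith)
  set D : Mink := Y - ((-κ ^ 2 * mink Y x) • x + mink Y n • n
    + (d⁻¹ * (mink b b * mink Y a - mink a b * mink Y b)) • a
    + (d⁻¹ * (mink a a * mink Y b - mink a b * mink Y a)) • b) with hD
  have hd1 : d⁻¹ * d = 1 := inv_mul_cancel₀ hd0
  have hD0 : D = 0 := by
    refine Matrix.eq_zero_of_mulVec_eq_zero hdet ?_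
    ext i
    rw [hprod, mink_comm]
    fin_cases i <;>
      simp only [m0, m1, m2, m3, hD, Fin.zero_eta, Fin.mk_one, Fin.reduceFinMk, mink_sub_left,
        mink_add_left, mink_smul_left, hx, hn, hxn, hxa, hxb, hna, hnb, mink_comm n x,
        mink_comm a x, mink_comm b x, mink_comm a n, mink_comm b n, mink_comm b a,
        Pi.zero_apply]
    · field_simp; ring
    · ring
    · linear_combination (-mink Y a) * hd1 + d⁻¹ * mink Y a * hd
    · linear_combination (-mink Y b) * hd1 + d⁻¹ * mink Y b * hd
  have h := mink_zero_left Z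
  rw [← hD0, hD] at h
  simp only [mink_sub_left, mink_add_left, mink_smul_left, mink_comm x Z, mink_comm n Z,
    mink_comm a Z, mink_comm b Z] at h
  linear_combination h

/-- The scalar curvature of a metric in coordinates. -/
def scalCoord (G : Plane → Matrix (Fin 2) (Fin 2) ℝ) (y : Plane) : ℝ :=
  ∑ i : Fin 2, ∑ k : Fin 2, ∑ l : Fin 2, ∑ m : Fin 2,
    (G y)⁻¹ i l * (G y)⁻¹ k m * riemann G i k l m y

theorem christoffel_gram {U : Set Plane} (hU : IsOpen U) {X : Plane → Mink}
    (hX : ContDiffOn ℝ ∞ X U) {y : Plane} (hy : y ∈ U) (k i j : Fin 2) :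
    christoffel (gram X X) k i j y = mink (pdv k X y) (pdv i (pdv j X) y) := by
  have hc := pdv_comm hU (hX.of_le (by norm_cast : (2 : WithTop ℕ∞) ≤ ∞)) hy
  rw [christoffel, pd_gram hU hX hX hy, pd_gram hU hX hX hy, pd_gram hU hX hX hy,
    hc k i, hc k j, hc j i, mink_comm (pdv i (pdv j X) y) (pdv k X y),
    mink_comm (pdv i (pdv k X) y) (pdv j X y)]
  ring

theorem pd_pd_gram {U : Set Plane} (hU : IsOpen U) {X : Plane → Mink}
    (hX : ContDiffOn ℝ ∞ X U) {y : Plane} (hy : y ∈ U) (k l i j : Fin 2) :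
    pd k (pd l fun z => gram X X z i j) y =
      mink (pdv k (pdv l (pdv i X)) y) (pdv j X y) + mink (pdv l (pdv i X) y) (pdv k (pdv j X) y)
      + (mink (pdv k (pdv i X) y) (pdv l (pdv j X) y)
        + mink (pdv i X y) (pdv k (pdv l (pdv j X)) y)) := by
  have h1 : ∀ i, ContDiffOn ℝ ∞ (pdv i X) U := fun i => contDiffOn_pdv hU hX (by norm_num) i
  have h2 : ∀ i j, ContDiffOn ℝ ∞ (pdv i (pdv j X)) U := fun i j =>
    contDiffOn_pdv hU (h1 j) (by norm_num) i
  have d1 : ∀ i, DifferentiableAt ℝ (pdv i X) y := fun i =>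
    differentiableAt_of_smooth hU ((h1 i).of_le (by norm_cast)) hy
  have d2 : ∀ i j, DifferentiableAt ℝ (pdv i (pdv j X)) y := fun i j =>
    differentiableAt_of_smooth hU ((h2 i j).of_le (by norm_cast)) hy
  have hm : ∀ {P Q : Plane → Mink}, DifferentiableAt ℝ P y → DifferentiableAt ℝ Q y →
      DifferentiableAt ℝ (fun z => mink (P z) (Q z)) y := fun hP hQ =>
    (contDiff_mink.differentiable one_ne_zero _).comp y (hP.prodMk hQ)
  have hev : (pd l fun z => gram X X z i j) =ᶠ[𝓝 y] fun z =>
      mink (pdv l (pdv i X) z) (pdv j X z) + mink (pdv i X z) (pdv l (pdv j X) z) := by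
    filter_upwards [hU.mem_nhds hy] with z hz using pd_gram hU hX hX hz l i j
  rw [pd_congr hev, pd_add (hm (d2 l i) (d1 j)) (hm (d1 i) (d2 l j)), pd_mink (d2 l i) (d1 j),
    pd_mink (d1 i) (d2 l j)]

theorem riemann_gram {U : Set Plane} (hU : IsOpen U) {X : Plane → Mink}
    (hX : ContDiffOn ℝ ∞ X U) {y : Plane} (hy : y ∈ U) (i k l m : Fin 2) :
    riemann (gram X X) i k l m y =
      mink (pdv i (pdv l X) y) (pdv k (pdv m X) y) - mink (pdv i (pdv m X) y) (pdv k (pdv l X) y)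
      + ∑ a : Fin 2, ∑ b : Fin 2, (gram X X y)⁻¹ a b *
        (mink (pdv a X y) (pdv k (pdv l X) y) * mink (pdv b X y) (pdv i (pdv m X) y)
          - mink (pdv a X y) (pdv k (pdv m X) y) * mink (pdv b X y) (pdv i (pdv l X) y)) := by
  have le2 : (2 : WithTop ℕ∞) ≤ ∞ := by norm_cast
  have hc := pdv_comm hU (hX.of_le le2) hy
  have h1 : ∀ i, ContDiffOn ℝ ∞ (pdv i X) U := fun i => contDiffOn_pdv hU hX (by norm_num) i
  have hc3 : ∀ a b c, pdv a (pdv b (pdv c X)) y = pdv b (pdv a (pdv c X)) y := fun a b c =>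
    pdv_comm hU ((h1 c).of_le le2) hy a b
  have hc3' : ∀ a b c, pdv a (pdv b (pdv c X)) y = pdv a (pdv c (pdv b X)) y := by
    intro a b c
    refine pdv_congr ?_ a
    filter_upwards [hU.mem_nhds hy] with z hz using pdv_comm hU (hX.of_le le2) hz b c
  simp only [riemann, christoffel_gram hU hX hy, pd_pd_gram hU hX hy]
  congr 1
  rw [hc l i, hc m k, hc m i, hc l k, hc k i, hc m l,
    mink_comm (pdv k (pdv m X) y), mink_comm (pdv k (pdv l X) y),
    hc3' k l i, hc3 k i l, hc3' k m i, hc3 k i m, hc3' k m l, hc3' i m l, hc3' i m k,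
    hc3' i l k]
  ring

/-- Differentiating a constant inner product. -/
theorem mink_fderiv_add_eq_zero {U : Set Plane} (hU : IsOpen U) {P Q : Plane → Mink} {c : ℝ}
    {z : Plane} (hz : z ∈ U) (hP : DifferentiableAt ℝ P z) (hQ : DifferentiableAt ℝ Q z)
    (h : ∀ z ∈ U, mink (P z) (Q z) = c) (v : Plane) :
    mink (fderiv ℝ P z v) (Q z) + mink (P z) (fderiv ℝ Q z v) = 0 := by
  have h1 := (minkL.hasFDerivAt_of_bilinear hP.hasFDerivAt hQ.hasFDerivAt)
  have h2 : (fun z => minkL (P z) (Q z)) =ᶠ[𝓝 z] fun _ => c := by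
    filter_upwards [hU.mem_nhds hz] with w hw using h w hw
  have h3 := congrArg (fun L : Plane →L[ℝ] ℝ => L v)
    (h1.unique ((hasFDerivAt_const c z).congr_of_eventuallyEq h2))
  simpa [minkL_apply, add_comm] using h3

/-- The Gauss equation for a surface in hyperbolic space of curvature `-κ²`. -/
theorem scalCoord_gram {κ : ℝ} (hκ : 0 < κ) {U : Set Plane} (hU : IsOpen U) {X N : Plane → Mink}
    (hX : ContDiffOn ℝ ∞ X U) (hN : ContDiffOn ℝ ∞ N U)
    (hXX : ∀ z ∈ U, mink (X z) (X z) = -(1 / κ ^ 2)) (hNN : ∀ z ∈ U, mink (N z) (N z) = 1)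
    (hXN : ∀ z ∈ U, mink (X z) (N z) = 0) (hdXN : ∀ z ∈ U, ∀ i, mink (pdv i X z) (N z) = 0)
    {y : Plane} (hy : y ∈ U) (hdet : (gram X X y).det ≠ 0) :
    scalCoord (gram X X) y = 2 * ((gram N X y).det / (gram X X y).det - κ ^ 2) := by
  have le2 : (2 : WithTop ℕ∞) ≤ ∞ := by norm_cast
  have hc := pdv_comm hU (hX.of_le le2) hy
  have dX : ∀ z ∈ U, DifferentiableAt ℝ X z := fun z hz =>
    differentiableAt_of_smooth hU (hX.of_le (by norm_cast)) hz
  have dN : ∀ z ∈ U, DifferentiableAt ℝ N z := fun z hz =>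
    differentiableAt_of_smooth hU (hN.of_le (by norm_cast)) hz
  have dX1 : ∀ i, ∀ z ∈ U, DifferentiableAt ℝ (pdv i X) z := fun i z hz =>
    differentiableAt_of_smooth hU (contDiffOn_pdv hU hX (by norm_cast) i) hz
  have const : ∀ (P Q : Plane → Mink) (c : ℝ), (∀ z ∈ U, DifferentiableAt ℝ P z) →
      (∀ z ∈ U, DifferentiableAt ℝ Q z) → (∀ z ∈ U, mink (P z) (Q z) = c) → ∀ z ∈ U, ∀ i,
      mink (pdv i P z) (Q z) + mink (P z) (pdv i Q z) = 0 := by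
    intro P Q c hP hQ h z hz i
    exact mink_fderiv_add_eq_zero hU hz (hP z hz) (hQ z hz) h _
  have hdX : ∀ z ∈ U, ∀ i, mink (pdv i X z) (X z) = 0 := by
    intro z hz i
    have := const X X _ dX dX hXX z hz i
    rw [mink_comm (X z)] at this
    linarith
  have hXij : ∀ i j, mink (pdv i (pdv j X) y) (X y) = -gram X X y i j := by
    intro i j
    have := const (pdv j X) X 0 (dX1 j) dX (fun z hz => hdX z hz j) y hy i
    rw [gram_symm, gram_apply]; linarith
  have hNij : ∀ i j, mink (pdv i (pdv j X) y) (N y) = -gram N X y i j := by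
    intro i j
    have := const (pdv j X) N 0 (dX1 j) dN (fun z hz => hdXN z hz j) y hy i
    rw [gram_apply, mink_comm (pdv i N y)]; linarith
  have hsym : gram N X y 1 0 = gram N X y 0 1 := by
    have h1 := hNij 1 0
    rw [hc 1 0, hNij 0 1] at h1
    linarith
  have hd : (gram X X y).det =
      mink (pdv 0 X y) (pdv 0 X y) * mink (pdv 1 X y) (pdv 1 X y)
        - mink (pdv 0 X y) (pdv 1 X y) ^ 2 := by
    rw [Matrix.det_fin_two, gram_symm X y 1 0]
    simp only [gram_apply]; ring
  have hexp : ∀ i j k l : Fin 2, mink (pdv i (pdv j X) y) (pdv k (pdv l X) y) = _ :=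
    fun i j k l => mink_expand hκ (hXX y hy) (hNN y hy) (hXN y hy)
      (by rw [mink_comm]; exact hdX y hy 0) (by rw [mink_comm]; exact hdX y hy 1)
      (by rw [mink_comm]; exact hdXN y hy 0) (by rw [mink_comm]; exact hdXN y hy 1) hd hdet _ _
  have hR : ∀ i k l m : Fin 2, riemann (gram X X) i k l m y =
      (gram N X y i l * gram N X y k m - gram N X y i m * gram N X y k l)
        - κ ^ 2 * (gram X X y i l * gram X X y k m - gram X X y i m * gram X X y k l) := by
    intro i k l m
    rw [riemann_gram hU hX hy, hexp, hexp, inv_two]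
    simp only [hXij, hNij, Fin.sum_univ_two, Matrix.smul_apply, Matrix.of_apply, smul_eq_mul,
      Matrix.cons_val_zero, Matrix.cons_val_one, mink_comm (pdv 0 X y) (pdv _ (pdv _ X) y),
      mink_comm (pdv 1 X y) (pdv _ (pdv _ X) y), gram_symm X y 1 0,
      Matrix.cons_val', Matrix.empty_val', Matrix.cons_val_fin_one]
    simp only [gram_apply X X]
    ring
  simp only [scalCoord, hR, Fin.sum_univ_two, inv_two, Matrix.smul_apply, Matrix.of_apply,
    smul_eq_mul, Matrix.cons_val_zero, Matrix.cons_val_one, Matrix.cons_val', Matrix.empty_val',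
    Matrix.cons_val_fin_one, hsym, gram_symm X y 1 0]
  rw [Matrix.det_fin_two (gram N X y), hsym]
  have hd2 : (gram X X y).det = gram X X y 0 0 * gram X X y 1 1 - gram X X y 0 1 ^ 2 := by
    rw [Matrix.det_fin_two, gram_symm X y 1 0]; ring
  field_simp
  rw [hd2]
  ring

/-! ### Local parametrizations of the surface -/

section Charts

variable {S : Type*} [TopologicalSpace S] [ChartedSpace Plane S]

/-- A smooth immersion `Θ` of an open subset `W` of the plane into the surface. -/
structure IsLocalParam (Θ : Plane → S) (W : Set Plane) : Prop where
  isOpen : IsOpen W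
  smooth : ContMDiffOn 𝓘(ℝ, Plane) (𝓡 2) ∞ Θ W
  injective : ∀ q ∈ W, Function.Injective (mfderiv 𝓘(ℝ, Plane) (𝓡 2) Θ q)

theorem IsLocalParam.mdifferentiableAt {Θ : Plane → S} {W : Set Plane} (h : IsLocalParam Θ W)
    {q : Plane} (hq : q ∈ W) : MDifferentiableAt 𝓘(ℝ, Plane) (𝓡 2) Θ q :=
  (h.smooth.contMDiffAt (h.isOpen.mem_nhds hq)).mdifferentiableAt (by simp)

theorem IsLocalParam.comp_smooth {Θ : Plane → S} {W : Set Plane} (h : IsLocalParam Θ W)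
    {E : Type*} [NormedAddCommGroup E] [NormedSpace ℝ E] {f : S → E}
    (hf : ContMDiff (𝓡 2) 𝓘(ℝ, E) ∞ f) : ContDiffOn ℝ ∞ (f ∘ Θ) W :=
  contMDiffOn_iff_contDiffOn.1 (hf.comp_contMDiffOn h.smooth)

theorem IsLocalParam.mfderiv_apply {Θ : Plane → S} {W : Set Plane} (h : IsLocalParam Θ W)
    {E : Type*} [NormedAddCommGroup E] [NormedSpace ℝ E] {f : S → E}
    (hf : ContMDiff (𝓡 2) 𝓘(ℝ, E) ∞ f) {q : Plane} (hq : q ∈ W) (v : Plane) :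
    mfderiv (𝓡 2) 𝓘(ℝ, E) f (Θ q) (mfderiv 𝓘(ℝ, Plane) (𝓡 2) Θ q v) =
      fderiv ℝ (f ∘ Θ) q v := by
  rw [← mfderiv_eq_fderiv, mfderiv_comp q (hf.mdifferentiableAt (by simp))
    (h.mdifferentiableAt hq)]
  rfl

theorem isOpen_chart_target (x : S) : IsOpen (extChartAt (𝓡 2) x).target :=
  isOpen_extChartAt_target x

variable [IsManifold (𝓡 2) ∞ S]

/-- The inverse of a chart is a local parametrization. -/
theorem isLocalParam_chart (x : S) :
    IsLocalParam (extChartAt (𝓡 2) x).symm (extChartAt (𝓡 2) x).target where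
  isOpen := isOpen_extChartAt_target x
  smooth := contMDiffOn_extChartAt_symm x
  injective q hq := by
    have h := mfderiv_extChartAt_comp_mfderivWithin_extChartAt_symm (I := 𝓡 2) hq
    rw [ModelWithCorners.range_eq_univ, mfderivWithin_univ] at h
    intro a b hab
    have h1 := congrArg (fun L => L a) h
    have h2 := congrArg (fun L => L b) h
    simp only [ContinuousLinearMap.comp_apply] at h1 h2
    rw [hab] at h1
    exact h1.symm.trans h2

/-- An affine change of the coordinates of a chart. -/
theorem isLocalParam_affine (x : S) (L : Plane ≃L[ℝ] Plane) (y₀ : Plane) :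
    IsLocalParam (fun y => (extChartAt (𝓡 2) x).symm (y₀ + L y))
      ((fun y => y₀ + L y) ⁻¹' (extChartAt (𝓡 2) x).target) where
  isOpen := (isOpen_extChartAt_target x).preimage (by fun_prop)
  smooth := by
    have h : ContDiff ℝ ∞ (fun y : Plane => y₀ + L y) := by fun_prop
    exact (isLocalParam_chart x).smooth.comp h.contMDiff.contMDiffOn (fun y hy => hy)
  injective q hq := by
    have h : HasFDerivAt (fun y : Plane => y₀ + L y) (L : Plane →L[ℝ] Plane) q :=
      L.hasFDerivAt.const_add y₀
    have h1 := mfderiv_comp q ((isLocalParam_chart x).mdifferentiableAt hq)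
      h.differentiableAt.mdifferentiableAt
    rw [mfderiv_eq_fderiv, h.fderiv] at h1
    change Function.Injective (mfderiv 𝓘(ℝ, Plane) (𝓡 2)
      ((extChartAt (𝓡 2) x).symm ∘ fun y => y₀ + L y) q)
    rw [h1]
    exact ((isLocalParam_chart x).injective _ hq).comp L.injective

theorem coordMatrix_pullback {Y Z : S → Mink} (hY : ContMDiff (𝓡 2) 𝓘(ℝ, Mink) ∞ Y)
    (hZ : ContMDiff (𝓡 2) 𝓘(ℝ, Mink) ∞ Z) (x : S) {y : Plane}
    (hy : y ∈ (extChartAt (𝓡 2) x).target) :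
    coordMatrix (pullback Y Z) x y =
      gram (Y ∘ (extChartAt (𝓡 2) x).symm) (Z ∘ (extChartAt (𝓡 2) x).symm) y := by
  ext i j
  simp only [coordMatrix, pullback, coordVec, Matrix.of_apply, gram, pdv]
  rw [← (isLocalParam_chart x).mfderiv_apply hY hy, ← (isLocalParam_chart x).mfderiv_apply hZ hy]

/-- The transition map from a local parametrization to the chart at one of its points. -/
theorem IsLocalParam.exists_transition {Θ : Plane → S} {W : Set Plane} (h : IsLocalParam Θ W)
    {q : Plane} (hq : q ∈ W) : ∃ (τ : Plane → Plane) (W' : Set Plane), IsOpen W' ∧ q ∈ W' ∧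
      ContDiffOn ℝ ∞ τ W' ∧ MapsTo τ W' (extChartAt (𝓡 2) (Θ q)).target ∧
      τ q = extChartAt (𝓡 2) (Θ q) (Θ q) ∧
      (∀ z ∈ W', (extChartAt (𝓡 2) (Θ q)).symm (τ z) = Θ z) ∧ W' ⊆ W := by
  set ψ := extChartAt (𝓡 2) (Θ q) with hψ
  have hopen : IsOpen (W ∩ Θ ⁻¹' ψ.source) :=
    h.smooth.continuousOn.isOpen_inter_preimage h.isOpen (isOpen_extChartAt_source _)
  refine ⟨ψ ∘ Θ, W ∩ Θ ⁻¹' ψ.source, hopen, ⟨hq, mem_extChartAt_source _⟩, ?_, ?_, rfl, ?_,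
    inter_subset_left⟩
  · rw [← contMDiffOn_iff_contDiffOn]
    refine (contMDiffOn_extChartAt (I := 𝓡 2) (x := Θ q)).comp (h.smooth.mono inter_subset_left) ?_
    intro z hz
    have := hz.2
    rwa [mem_preimage, hψ, extChartAt_source] at this
  · exact fun z hz => ψ.map_source hz.2
  · exact fun z hz => ψ.left_inv hz.2

theorem trace_inv_congr {J G T : Matrix (Fin 2) (Fin 2) ℝ} (hJ : J.det ≠ 0) :
    ((J.transpose * G * J)⁻¹ * (J.transpose * T * J)).trace = (G⁻¹ * T).trace := by
  have h := jac_mul_inv_gram_mul (G := G) hJ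
  calc ((J.transpose * G * J)⁻¹ * (J.transpose * T * J)).trace
      = (((J.transpose * G * J)⁻¹ * J.transpose * T) * J).trace := by
        simp only [Matrix.mul_assoc]
    _ = (J * (J.transpose * G * J)⁻¹ * J.transpose * T).trace := by
        rw [Matrix.trace_mul_comm]; simp only [Matrix.mul_assoc]
    _ = _ := by rw [h]

/-- The Gram matrices of a local parametrization and those of the chart at one of its points differ
by the same change of basis. -/
theorem IsLocalParam.exists_gram_eq {Θ : Plane → S} {W : Set Plane} (h : IsLocalParam Θ W)
    {q : Plane} (hq : q ∈ W) : ∃ J : Matrix (Fin 2) (Fin 2) ℝ, ∀ Y Z : S → Mink,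
      ContMDiff (𝓡 2) 𝓘(ℝ, Mink) ∞ Y → ContMDiff (𝓡 2) 𝓘(ℝ, Mink) ∞ Z →
      gram (Y ∘ Θ) (Z ∘ Θ) q = J.transpose *
        coordMatrix (pullback Y Z) (Θ q) (extChartAt (𝓡 2) (Θ q) (Θ q)) * J := by
  obtain ⟨τ, W', hW', hqW', hτ, hm, hτq, hinv, -⟩ := h.exists_transition hq
  refine ⟨jac τ q, fun Y Z hY hZ => ?_⟩
  have ht := isOpen_chart_target (Θ q)
  have e : ∀ Y : S → Mink, Y ∘ Θ =ᶠ[𝓝 q] (Y ∘ (extChartAt (𝓡 2) (Θ q)).symm) ∘ τ := by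
    intro Y
    filter_upwards [hW'.mem_nhds hqW'] with z hz
    exact (congrArg Y (hinv z hz)).symm
  have d : ∀ Y : S → Mink, ContMDiff (𝓡 2) 𝓘(ℝ, Mink) ∞ Y →
      DifferentiableAt ℝ (Y ∘ (extChartAt (𝓡 2) (Θ q)).symm) (τ q) := fun Y hY =>
    differentiableAt_of_smooth ht (((isLocalParam_chart (Θ q)).comp_smooth hY).of_le
      (by norm_cast)) (hm hqW')
  rw [coordMatrix_pullback hY hZ _ (mem_extChartAt_target _), ← hτq,
    ← gram_comp (d Y hY) (d Z hZ) (differentiableAt_of_smooth hW' (hτ.of_le (by norm_cast)) hqW')]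
  ext i j
  simp only [gram_apply, pdv_congr (e Y), pdv_congr (e Z)]

/-- Traces, defined in the chart at the point, may be computed in any local parametrization. -/
theorem IsLocalParam.traceWrt_eq {Θ : Plane → S} {W : Set Plane} (h : IsLocalParam Θ W)
    {q : Plane} (hq : q ∈ W) {X Y Z : S → Mink} (hX : ContMDiff (𝓡 2) 𝓘(ℝ, Mink) ∞ X)
    (hY : ContMDiff (𝓡 2) 𝓘(ℝ, Mink) ∞ Y) (hZ : ContMDiff (𝓡 2) 𝓘(ℝ, Mink) ∞ Z)
    (hdet : (gram (X ∘ Θ) (X ∘ Θ) q).det ≠ 0) :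
    traceWrt (pullback X X) (pullback Y Z) (Θ q) =
      ((gram (X ∘ Θ) (X ∘ Θ) q)⁻¹ * gram (Y ∘ Θ) (Z ∘ Θ) q).trace := by
  obtain ⟨J, hJ⟩ := h.exists_gram_eq hq
  rw [hJ X X hX hX] at hdet ⊢
  rw [hJ Y Z hY hZ, trace_inv_congr]
  · rfl
  · intro h0
    simp [Matrix.det_mul, h0] at hdet

theorem lapDiv_congr {G G' : Plane → Matrix (Fin 2) (Fin 2) ℝ} {y : Plane} (h : G =ᶠ[𝓝 y] G')
    (f : Plane → ℝ) : lapDiv G f y = lapDiv G' f y := by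
  simp only [lapDiv, h.self_of_nhds]
  congr 1
  refine Finset.sum_congr rfl fun i _ => Finset.sum_congr rfl fun j _ => pd_congr ?_ i
  filter_upwards [h] with z hz
  rw [hz]

theorem lapEmb_congr {X X' : Plane → Mink} {f f' : Plane → ℝ} {y : Plane} (h : X =ᶠ[𝓝 y] X')
    (hf : f =ᶠ[𝓝 y] f') : lapEmb X f y = lapEmb X' f' y := by
  have hg : gram X X y = gram X' X' y := by
    ext i j
    simp only [gram_apply, pdv_congr h]
  simp only [lapEmb, gradVec, hg, pdv_congr h, pd_congr hf,
    fun i j => pd_congr (pdv_eventuallyEq hf j) i, fun i j => pdv_congr (pdv_eventuallyEq h j) i,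
    pd_eq_pdv]

theorem scalCoord_congr {G G' : Plane → Matrix (Fin 2) (Fin 2) ℝ} {y : Plane}
    (h : G =ᶠ[𝓝 y] G') : scalCoord G y = scalCoord G' y := by
  have he : ∀ i j, (fun z => G z i j) =ᶠ[𝓝 y] fun z => G' z i j := by
    intro i j
    filter_upwards [h] with z hz
    rw [hz]
  have h1 : ∀ k i j, pd k (fun z => G z i j) y = pd k (fun z => G' z i j) y := fun k i j =>
    pd_congr (he i j) k
  have h2 : ∀ k l i j, pd k (pd l fun z => G z i j) y = pd k (pd l fun z => G' z i j) y :=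
    fun k l i j => pd_congr (pdv_eventuallyEq (he i j) l) k
  simp only [scalCoord, riemann, christoffel, h1, h2, h.self_of_nhds]

/-- The Laplace-Beltrami operator, defined in the chart at the point, may be computed in any local
parametrization. -/
theorem IsLocalParam.laplacian_eq {Θ : Plane → S} {W : Set Plane} (h : IsLocalParam Θ W)
    {q : Plane} (hq : q ∈ W) {X : S → Mink} (hX : ContMDiff (𝓡 2) 𝓘(ℝ, Mink) ∞ X) {f : S → ℝ}
    (hf : ContMDiff (𝓡 2) 𝓘(ℝ, ℝ) ∞ f) (hdet : 0 < (gram (X ∘ Θ) (X ∘ Θ) q).det) :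
    laplacian (pullback X X) f (Θ q) = lapEmb (X ∘ Θ) (f ∘ Θ) q := by
  have le2 : (2 : WithTop ℕ∞) ≤ ∞ := by norm_cast
  obtain ⟨τ, W', hW', hqW', hτ, hm, hτq, hinv, -⟩ := h.exists_transition hq
  have ht := isOpen_chart_target (Θ q)
  set σ := (extChartAt (𝓡 2) (Θ q)).symm with hσ
  have hXs : ContDiffOn ℝ ∞ (X ∘ σ) (extChartAt (𝓡 2) (Θ q)).target :=
    (isLocalParam_chart (Θ q)).comp_smooth hX
  have hfs : ContDiffOn ℝ 2 (f ∘ σ) (extChartAt (𝓡 2) (Θ q)).target :=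
    ((isLocalParam_chart (Θ q)).comp_smooth hf).of_le le2
  have hev : coordMatrix (pullback X X) (Θ q) =ᶠ[𝓝 (τ q)] gram (X ∘ σ) (X ∘ σ) := by
    filter_upwards [ht.mem_nhds (hm hqW')] with z hz using coordMatrix_pullback hX hX _ hz
  have hl : laplacian (pullback X X) f (Θ q) =
      lapDiv (coordMatrix (pullback X X) (Θ q)) (f ∘ σ) (τ q) := by
    rw [hτq]; rfl
  have eX : X ∘ Θ =ᶠ[𝓝 q] (X ∘ σ) ∘ τ := by
    filter_upwards [hW'.mem_nhds hqW'] with z hz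
    exact (congrArg X (hinv z hz)).symm
  have ef : f ∘ Θ =ᶠ[𝓝 q] (f ∘ σ) ∘ τ := by
    filter_upwards [hW'.mem_nhds hqW'] with z hz
    exact (congrArg f (hinv z hz)).symm
  have hgram : gram (X ∘ Θ) (X ∘ Θ) q =
      (jac τ q).transpose * gram (X ∘ σ) (X ∘ σ) (τ q) * jac τ q := by
    have d := differentiableAt_of_smooth ht (hXs.of_le (by norm_cast)) (hm hqW')
    rw [← gram_comp d d (differentiableAt_of_smooth hW' (hτ.of_le (by norm_cast)) hqW')]
    ext i j
    simp only [gram_apply, pdv_congr eX]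
  rw [hgram, Matrix.det_mul, Matrix.det_mul, Matrix.det_transpose] at hdet
  have hJ : (jac τ q).det ≠ 0 := by
    intro h0; simp [h0] at hdet
  have hG : 0 < (gram (X ∘ σ) (X ∘ σ) (τ q)).det := by
    by_contra hc
    push Not at hc
    nlinarith [mul_self_nonneg (jac τ q).det]
  rw [hl, lapDiv_congr hev, lapDiv_gram ht hXs hfs (hm hqW') hG, lapEmb_congr eX ef,
    lapEmb_comp ht hW' hXs hfs (hτ.of_le le2) hm hqW' hJ hG.ne']

end Charts

/-! ### The rescaled leaves -/

/-- The orthogonal complement of a timelike vector is spacelike. -/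
theorem mink_self_nonneg_of_orthogonal {x v : Mink} (hx : mink x x < 0) (hxv : mink x v = 0) :
    0 ≤ mink v v := by
  simp only [mink] at *
  have hcs : (x 0 * v 0 + x 1 * v 1 + x 2 * v 2) ^ 2 ≤
      (x 0 * x 0 + x 1 * x 1 + x 2 * x 2) * (v 0 * v 0 + v 1 * v 1 + v 2 * v 2) := by
    nlinarith [sq_nonneg (x 0 * v 1 - x 1 * v 0), sq_nonneg (x 0 * v 2 - x 2 * v 0),
      sq_nonneg (x 1 * v 2 - x 2 * v 1)]
  have e : x 0 * v 0 + x 1 * v 1 + x 2 * v 2 = x 3 * v 3 := by linarith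
  rw [e] at hcs
  have hv : 0 ≤ v 0 * v 0 + v 1 * v 1 + v 2 * v 2 := by
    nlinarith [mul_self_nonneg (v 0), mul_self_nonneg (v 1), mul_self_nonneg (v 2)]
  have h3 : 0 < x 3 * x 3 := by
    nlinarith [mul_self_nonneg (x 0), mul_self_nonneg (x 1), mul_self_nonneg (x 2)]
  have h4 : (x 3 * x 3) * (v 3 * v 3) ≤ (x 3 * x 3) * (v 0 * v 0 + v 1 * v 1 + v 2 * v 2) := by
    nlinarith
  have := le_of_mul_le_mul_left h4 h3
  linarith

theorem det_pos_of_quadratic_pos {G : Matrix (Fin 2) (Fin 2) ℝ} (hG : G 1 0 = G 0 1)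
    (h : ∀ v : Plane, v ≠ 0 →
      0 < v 0 * v 0 * G 0 0 + 2 * (v 0 * v 1) * G 0 1 + v 1 * v 1 * G 1 1) :
    0 < G 0 0 ∧ 0 < G.det := by
  have h0 : 0 < G 0 0 := by
    have := h (EuclideanSpace.single 0 1) (by simp)
    simpa using this
  refine ⟨h0, ?_⟩
  have h1 := h !₂[-G 0 1, G 0 0] (by
    intro hc
    have := congrArg (fun v : Plane => v 1) hc
    simp at this
    exact h0.ne' this)
  simp at h1
  rw [Matrix.det_fin_two, hG]
  have : 0 < G 0 0 * (G 0 0 * G 1 1 - G 0 1 * G 0 1) := by nlinarith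
  exact pos_of_mul_pos_right this h0.le

theorem gram_smul {Y Z : Plane → Mink} {q : Plane} (hY : DifferentiableAt ℝ Y q)
    (hZ : DifferentiableAt ℝ Z q) (a b : ℝ) :
    gram (fun z => a • Y z) (fun z => b • Z z) q = (a * b) • gram Y Z q := by
  ext i j
  simp only [gram_apply, pdv, fderiv_fun_const_smul hY, fderiv_fun_const_smul hZ,
    _root_.smul_apply, mink_smul_left, mink_smul_right, Matrix.smul_apply, smul_eq_mul]
  ring

theorem pdv_smul {E : Type*} [NormedAddCommGroup E] [NormedSpace ℝ E] {Y : Plane → E} {q : Plane}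
    (hY : DifferentiableAt ℝ Y q) (a : ℝ) (i : Fin 2) :
    pdv i (fun z => a • Y z) q = a • pdv i Y q := by
  simp only [pdv, fderiv_fun_const_smul hY, _root_.smul_apply]

theorem pdv_comb {E : Type*} [NormedAddCommGroup E] [NormedSpace ℝ E] {Y Z : Plane → E} {q : Plane}
    (hY : DifferentiableAt ℝ Y q) (hZ : DifferentiableAt ℝ Z q) (a b : ℝ) (i : Fin 2) :
    pdv i (fun z => a • Y z + b • Z z) q = a • pdv i Y q + b • pdv i Z q := by
  have h1 : DifferentiableAt ℝ (fun z => a • Y z) q := hY.const_smul a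
  have h2 : DifferentiableAt ℝ (fun z => b • Z z) q := hZ.const_smul b
  simp only [pdv]
  rw [fderiv_fun_add h1 h2, fderiv_fun_const_smul hY, fderiv_fun_const_smul hZ]
  rfl

theorem inv_smul_matrix {c : ℝ} (hc : c ≠ 0) (G : Matrix (Fin 2) (Fin 2) ℝ) :
    (c • G)⁻¹ = c⁻¹ • G⁻¹ := by
  rw [inv_two, inv_two, Matrix.det_smul]
  ext i j
  fin_cases i <;> fin_cases j <;> simp <;> field_simp

/-- Scaling a metric by a constant factor scales its Laplace-Beltrami operator by the inverse. -/
theorem lapEmb_smul {U : Set Plane} (hU : IsOpen U) {X : Plane → Mink} (hX : ContDiffOn ℝ ∞ X U)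
    (f : Plane → ℝ) {y : Plane} (hy : y ∈ U) {c : ℝ} (hc : c ≠ 0) :
    lapEmb (fun z => c • X z) f y = (c ^ 2)⁻¹ * lapEmb X f y := by
  have dX : ∀ z ∈ U, DifferentiableAt ℝ X z := fun z hz =>
    differentiableAt_of_smooth hU (hX.of_le (by norm_cast)) hz
  have dX1 : ∀ i, DifferentiableAt ℝ (pdv i X) y := fun i =>
    differentiableAt_of_smooth hU (contDiffOn_pdv hU hX (by norm_cast) i) hy
  have h2 : ∀ i j, pdv i (pdv j fun z => c • X z) y = c • pdv i (pdv j X) y := by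
    intro i j
    rw [← pdv_smul (dX1 j)]
    refine pdv_congr ?_ i
    filter_upwards [hU.mem_nhds hy] with z hz using pdv_smul (dX z hz) c j
  have hg : (gram (fun z => c • X z) (fun z => c • X z) y)⁻¹ = (c * c)⁻¹ • (gram X X y)⁻¹ := by
    rw [gram_smul (dX y hy) (dX y hy), inv_smul_matrix (mul_ne_zero hc hc)]
  simp only [lapEmb, gradVec, hg, h2, pdv_smul (dX y hy), Fin.sum_univ_two, Matrix.smul_apply,
    smul_eq_mul, mink_add_left, mink_smul_left, mink_smul_right]
  field_simp

namespace ConvexSurface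

variable {S : Type*} [TopologicalSpace S] [ChartedSpace Plane S] {κ : ℝ} (D : ConvexSurface S κ)

/-- A linear combination of the embedding and the normal. All the maps into Minkowski space which
occur here are of this form. -/
def comb (a b : ℝ) (p : S) : Mink := a • D.F₀ p + b • D.N p

/-- The rescaled leaf `e^{-κr} F(·, r)` as a function of `s = e^{-2κr}`; it extends smoothly to
`s = 0`, where it is `κ⁻¹ γ₀`. -/
def slice (s : ℝ) : S → Mink := D.comb ((1 + s) / 2) ((1 - s) / (2 * κ))

/-- The derivative of `slice` with respect to `s`. -/
def sliceDeriv : S → Mink := D.comb (1 / 2) (-1 / (2 * κ))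

theorem comb_smooth (a b : ℝ) : ContMDiff (𝓡 2) 𝓘(ℝ, Mink) ∞ (D.comb a b) := by
  have h : ContDiff ℝ ∞ fun x : Mink × Mink => a • x.1 + b • x.2 := by fun_prop
  exact h.contMDiff.comp (D.F₀_smooth.prodMk_space D.N_smooth)

theorem slice_smooth (s : ℝ) : ContMDiff (𝓡 2) 𝓘(ℝ, Mink) ∞ (D.slice s) := D.comb_smooth _ _

theorem sliceDeriv_smooth : ContMDiff (𝓡 2) 𝓘(ℝ, Mink) ∞ D.sliceDeriv := D.comb_smooth _ _

theorem flow_smooth (r : ℝ) : ContMDiff (𝓡 2) 𝓘(ℝ, Mink) ∞ (D.flow r) := D.comb_smooth _ _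

theorem normal_smooth (r : ℝ) : ContMDiff (𝓡 2) 𝓘(ℝ, Mink) ∞ (D.normal r) := D.comb_smooth _ _

theorem flow_eq_comb (r : ℝ) : D.flow r = D.comb (Real.cosh (κ * r)) (Real.sinh (κ * r) / κ) := rfl

theorem normal_eq_comb (r : ℝ) :
    D.normal r = D.comb (κ * Real.sinh (κ * r)) (Real.cosh (κ * r)) := rfl

theorem exp_two_mul (r : ℝ) :
    Real.exp (κ * r) * Real.exp (-(2 * κ * r)) = Real.exp (-(κ * r)) := by
  rw [← Real.exp_add]; ring_nf

/-- The leaf at distance `r` is `e^{κr}` times the rescaled leaf. -/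
theorem flow_eq_slice (r : ℝ) :
    D.flow r = fun p => Real.exp (κ * r) • D.slice (Real.exp (-(2 * κ * r))) p := by
  funext p
  have h := exp_two_mul (κ := κ) r
  simp only [flow, slice, comb, Real.cosh_eq, Real.sinh_eq, ← h]
  module

theorem normal_eq_slice (hκ : 0 < κ) (r : ℝ) :
    D.normal r = fun p => (κ * Real.exp (κ * r)) • (D.slice (Real.exp (-(2 * κ * r))) p
      + (-2 * Real.exp (-(2 * κ * r))) • D.sliceDeriv p) := by
  funext p
  have h := exp_two_mul (κ := κ) r
  simp only [normal, slice, sliceDeriv, comb, Real.cosh_eq, Real.sinh_eq, ← h]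
  match_scalars <;> field_simp <;> ring

theorem pdv_comp_comb {Θ : Plane → S} {W : Set Plane} (h : IsLocalParam Θ W) (a b : ℝ) {q : Plane}
    (hq : q ∈ W) (i : Fin 2) : pdv i (D.comb a b ∘ Θ) q =
      a • pdv i (D.F₀ ∘ Θ) q + b • pdv i (D.N ∘ Θ) q :=
  pdv_comb (differentiableAt_of_smooth h.isOpen
      ((h.comp_smooth D.F₀_smooth).of_le (by norm_cast)) hq)
    (differentiableAt_of_smooth h.isOpen ((h.comp_smooth D.N_smooth).of_le (by norm_cast)) hq) a b i

theorem pdv_pdv_comp_comb {Θ : Plane → S} {W : Set Plane} (h : IsLocalParam Θ W) (a b : ℝ)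
    {q : Plane} (hq : q ∈ W) (i j : Fin 2) : pdv i (pdv j (D.comb a b ∘ Θ)) q =
      a • pdv i (pdv j (D.F₀ ∘ Θ)) q + b • pdv i (pdv j (D.N ∘ Θ)) q := by
  rw [← pdv_comb (differentiableAt_of_smooth h.isOpen
      (contDiffOn_pdv h.isOpen (h.comp_smooth D.F₀_smooth) (by norm_cast) j) hq)
    (differentiableAt_of_smooth h.isOpen
      (contDiffOn_pdv h.isOpen (h.comp_smooth D.N_smooth) (by norm_cast) j) hq)]
  refine pdv_congr ?_ i
  filter_upwards [h.isOpen.mem_nhds hq] with z hz using D.pdv_comp_comb h a b hz j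

/-- The rescaled metrics are positive definite, by convexity, up to and including `s = 0`. -/
theorem gram_slice_pos (hκ : 0 < κ) {Θ : Plane → S} {W : Set Plane} (h : IsLocalParam Θ W)
    {q : Plane} (hq : q ∈ W) {s : ℝ} (hs : s ∈ Icc (0 : ℝ) (1 / 2)) :
    0 < gram (D.slice s ∘ Θ) (D.slice s ∘ Θ) q 0 0 ∧
      0 < (gram (D.slice s ∘ Θ) (D.slice s ∘ Θ) q).det := by
  refine det_pos_of_quadratic_pos (gram_symm _ _ _ _) fun v hv => ?_
  have dF : DifferentiableAt ℝ (D.F₀ ∘ Θ) q := differentiableAt_of_smooth h.isOpen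
      ((h.comp_smooth D.F₀_smooth).of_le (by norm_cast)) hq
  have dN : DifferentiableAt ℝ (D.N ∘ Θ) q := differentiableAt_of_smooth h.isOpen
      ((h.comp_smooth D.N_smooth).of_le (by norm_cast)) hq
  set f := fderiv ℝ (D.F₀ ∘ Θ) q v with hf
  set n := fderiv ℝ (D.N ∘ Θ) q v with hn
  have hV : mfderiv 𝓘(ℝ, Plane) (𝓡 2) Θ q v ≠ 0 := by
    intro h0
    exact hv (h.injective q hq (h0.trans (map_zero (mfderiv 𝓘(ℝ, Plane) (𝓡 2) Θ q)).symm))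
  have hnf : 0 < mink n f := by
    have := D.convex (Θ q) _ hV
    simp only [pullback] at this
    rwa [h.mfderiv_apply D.N_smooth hq, h.mfderiv_apply D.F₀_smooth hq] at this
  have hFF : mink (D.F₀ (Θ q)) (D.F₀ (Θ q)) < 0 := by
    rw [(D.F₀_mem _).1]
    have : 0 < 1 / κ ^ 2 := by positivity
    linarith
  have hFf : mink (D.F₀ (Θ q)) f = 0 := by
    have := mink_fderiv_add_eq_zero h.isOpen hq dF dF (c := -(1 / κ ^ 2))
      (fun z _ => (D.F₀_mem (Θ z)).1) v
    rw [mink_comm] at this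
    simp only [Function.comp_apply] at this
    linarith
  have hfN : mink f (D.N (Θ q)) = 0 := by
    have := D.N_normal (Θ q) (mfderiv 𝓘(ℝ, Plane) (𝓡 2) Θ q v)
    rwa [h.mfderiv_apply D.F₀_smooth hq] at this
  have hFn : mink (D.F₀ (Θ q)) n = 0 := by
    have := mink_fderiv_add_eq_zero h.isOpen hq dF dN (c := 0)
      (fun z _ => D.N_tangent (Θ z)) v
    simp only [Function.comp_apply] at this
    linarith
  have hff := mink_self_nonneg_of_orthogonal hFF hFf
  have hnn := mink_self_nonneg_of_orthogonal hFF hFn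
  have e : v 0 * v 0 * gram (D.slice s ∘ Θ) (D.slice s ∘ Θ) q 0 0
      + 2 * (v 0 * v 1) * gram (D.slice s ∘ Θ) (D.slice s ∘ Θ) q 0 1
      + v 1 * v 1 * gram (D.slice s ∘ Θ) (D.slice s ∘ Θ) q 1 1 =
      ((1 + s) / 2) ^ 2 * mink f f + 2 * (((1 + s) / 2) * ((1 - s) / (2 * κ))) * mink n f
        + ((1 - s) / (2 * κ)) ^ 2 * mink n n := by
    simp only [gram_apply, slice, D.pdv_comp_comb h _ _ hq, hf, hn, fderiv_eq_sum_pdv,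
      mink_add_left, mink_add_right, mink_smul_left, mink_smul_right,
      mink_comm (pdv 0 (D.F₀ ∘ Θ) q) (pdv _ (D.N ∘ Θ) q),
      mink_comm (pdv 1 (D.F₀ ∘ Θ) q) (pdv _ (D.N ∘ Θ) q),
      mink_comm (pdv 1 (D.F₀ ∘ Θ) q) (pdv 0 (D.F₀ ∘ Θ) q),
      mink_comm (pdv 1 (D.N ∘ Θ) q) (pdv 0 (D.N ∘ Θ) q)]
    ring
  rw [e]
  have h1 : 0 < (1 + s) / 2 := by linarith [hs.1]
  have h2 : 0 < (1 - s) / (2 * κ) := div_pos (by linarith [hs.2]) (by positivity)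
  positivity

/-- The trace of `⟨∂_s X_s, X_s⟩` with respect to the rescaled metric. -/
def traceTerm (s : ℝ) (p : S) : ℝ :=
  traceWrt (pullback (D.slice s) (D.slice s)) (pullback D.sliceDeriv (D.slice s)) p

/-- The determinant of `⟨∂_s X_s, X_s⟩` relative to the rescaled metric. -/
def detTerm (s : ℝ) (p : S) : ℝ :=
  (coordMatrix (pullback D.sliceDeriv (D.slice s)) p (extChartAt (𝓡 2) p p)).det /
    (coordMatrix (pullback (D.slice s) (D.slice s)) p (extChartAt (𝓡 2) p p)).det

/-- The metric of a leaf is `s⁻¹` times the rescaled metric. -/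
theorem gram_flow {Θ : Plane → S} {W : Set Plane} (h : IsLocalParam Θ W)
    {q : Plane} (hq : q ∈ W) (r : ℝ) :
    gram (D.flow r ∘ Θ) (D.flow r ∘ Θ) q = (Real.exp (-(2 * κ * r)))⁻¹ •
      gram (D.slice (Real.exp (-(2 * κ * r))) ∘ Θ) (D.slice (Real.exp (-(2 * κ * r))) ∘ Θ) q := by
  have d : DifferentiableAt ℝ (D.slice (Real.exp (-(2 * κ * r))) ∘ Θ) q :=
    differentiableAt_of_smooth h.isOpen ((h.comp_smooth (D.slice_smooth _)).of_le (by norm_cast)) hq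
  have e : D.flow r ∘ Θ =
      fun z => Real.exp (κ * r) • (D.slice (Real.exp (-(2 * κ * r))) ∘ Θ) z := by
    rw [flow_eq_slice]; rfl
  rw [e, gram_smul d d, ← Real.exp_neg, ← Real.exp_add]
  ring_nf

/-- The second fundamental form of a leaf in terms of the rescaled leaf and its derivative in `s`.
-/
theorem gram_normal_flow (hκ : 0 < κ) {Θ : Plane → S} {W : Set Plane} (h : IsLocalParam Θ W)
    {q : Plane} (hq : q ∈ W) (r : ℝ) :
    gram (D.normal r ∘ Θ) (D.flow r ∘ Θ) q = (κ * (Real.exp (-(2 * κ * r)))⁻¹) •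
      (gram (D.slice (Real.exp (-(2 * κ * r))) ∘ Θ) (D.slice (Real.exp (-(2 * κ * r))) ∘ Θ) q
        + (-2 * Real.exp (-(2 * κ * r))) •
          gram (D.sliceDeriv ∘ Θ) (D.slice (Real.exp (-(2 * κ * r))) ∘ Θ) q) := by
  set s := Real.exp (-(2 * κ * r)) with hs
  have d : DifferentiableAt ℝ (D.slice s ∘ Θ) q :=
    differentiableAt_of_smooth h.isOpen ((h.comp_smooth (D.slice_smooth _)).of_le (by norm_cast)) hq
  have d' : DifferentiableAt ℝ (D.sliceDeriv ∘ Θ) q :=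
    differentiableAt_of_smooth h.isOpen
      ((h.comp_smooth D.sliceDeriv_smooth).of_le (by norm_cast)) hq
  have e : D.flow r ∘ Θ = fun z => Real.exp (κ * r) • (D.slice s ∘ Θ) z := by
    rw [flow_eq_slice]; rfl
  have e' : D.normal r ∘ Θ = fun z => (κ * Real.exp (κ * r)) •
      ((1 : ℝ) • (D.slice s ∘ Θ) z + (-2 * s) • (D.sliceDeriv ∘ Θ) z) := by
    rw [normal_eq_slice D hκ]
    simp only [one_smul]; rfl
  have hexp : s⁻¹ = Real.exp (κ * r) * Real.exp (κ * r) := by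
    rw [hs, ← Real.exp_neg, ← Real.exp_add]; ring_nf
  have dd : DifferentiableAt ℝ
      (fun z => (1 : ℝ) • (D.slice s ∘ Θ) z + (-2 * s) • (D.sliceDeriv ∘ Θ) z) q :=
    DifferentiableAt.fun_add (d.const_smul (1 : ℝ)) (d'.const_smul (-2 * s))
  rw [e, e', gram_smul dd d, hexp, mul_assoc]
  congr 1
  ext i j
  simp only [gram_apply, pdv_comb d d', mink_add_left, mink_smul_left, Matrix.add_apply,
    Matrix.smul_apply, smul_eq_mul, one_mul]

variable [IsManifold (𝓡 2) ∞ S]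

theorem traceTerm_eq (hκ : 0 < κ) {Θ : Plane → S} {W : Set Plane} (h : IsLocalParam Θ W)
    {q : Plane} (hq : q ∈ W) {s : ℝ} (hs : s ∈ Icc (0 : ℝ) (1 / 2)) :
    D.traceTerm s (Θ q) = ((gram (D.slice s ∘ Θ) (D.slice s ∘ Θ) q)⁻¹ *
      gram (D.sliceDeriv ∘ Θ) (D.slice s ∘ Θ) q).trace :=
  h.traceWrt_eq hq (D.slice_smooth _) (D.sliceDeriv_smooth) (D.slice_smooth _)
    (D.gram_slice_pos hκ h hq hs).2.ne'

theorem detTerm_eq (hκ : 0 < κ) {Θ : Plane → S} {W : Set Plane} (h : IsLocalParam Θ W)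
    {q : Plane} (hq : q ∈ W) {s : ℝ} (hs : s ∈ Icc (0 : ℝ) (1 / 2)) :
    D.detTerm s (Θ q) = (gram (D.sliceDeriv ∘ Θ) (D.slice s ∘ Θ) q).det /
      (gram (D.slice s ∘ Θ) (D.slice s ∘ Θ) q).det := by
  obtain ⟨J, hJ⟩ := h.exists_gram_eq hq
  have hpos := (D.gram_slice_pos hκ h hq hs).2.ne'
  rw [hJ _ _ (D.slice_smooth s) (D.slice_smooth s)] at hpos
  have hJd : J.det ≠ 0 := by
    intro h0
    simp [Matrix.det_mul, h0] at hpos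
  rw [detTerm, hJ _ _ D.sliceDeriv_smooth (D.slice_smooth s),
    hJ _ _ (D.slice_smooth s) (D.slice_smooth s)]
  simp only [Matrix.det_mul, Matrix.det_transpose] at hpos ⊢
  have h2 : (coordMatrix (pullback (D.slice s) (D.slice s)) (Θ q)
      (extChartAt (𝓡 2) (Θ q) (Θ q))).det ≠ 0 := by
    intro h0
    exact hpos (by rw [h0]; ring)
  field_simp

/-- The mean curvature of a leaf is that of a horosphere up to a term of order `s = e^{-2κr}`. -/
theorem meanCurv_eq (hκ : 0 < κ) {r : ℝ} (hr : Real.exp (-(2 * κ * r)) ≤ 1 / 2) (p : S) :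
    D.meanCurv r p = 2 * κ - 2 * κ * Real.exp (-(2 * κ * r)) *
      D.traceTerm (Real.exp (-(2 * κ * r))) p := by
  set s := Real.exp (-(2 * κ * r)) with hs
  have hs0 : 0 < s := Real.exp_pos _
  have hsI : s ∈ Icc (0 : ℝ) (1 / 2) := ⟨hs0.le, hr⟩
  have hl := isLocalParam_chart p
  set Θ := (extChartAt (𝓡 2) p).symm with hΘ
  set q := extChartAt (𝓡 2) p p with hq
  have hqW : q ∈ (extChartAt (𝓡 2) p).target := mem_extChartAt_target p
  have hp : Θ q = p := extChartAt_to_inv p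
  have hpos := (D.gram_slice_pos hκ hl hqW hsI).2
  have hG := D.gram_flow hl hqW r
  have hdet : (gram (D.flow r ∘ Θ) (D.flow r ∘ Θ) q).det ≠ 0 := by
    rw [hG, Matrix.det_smul]
    positivity
  have h1 : D.meanCurv r (Θ q) = _ := hl.traceWrt_eq hqW (D.flow_smooth r)
    (D.normal_smooth r) (D.flow_smooth r) hdet
  have h2 := D.traceTerm_eq hκ hl hqW hsI
  rw [hp] at h1 h2
  rw [h1, h2]
  change ((gram (D.flow r ∘ Θ) (D.flow r ∘ Θ) q)⁻¹ *
    gram (D.normal r ∘ Θ) (D.flow r ∘ Θ) q).trace = _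
  rw [hG, D.gram_normal_flow hκ hl hqW r, ← hs, inv_smul_matrix (inv_ne_zero hs0.ne')]
  set G := gram (D.slice s ∘ Θ) (D.slice s ∘ Θ) q with hGd
  have hinv : G⁻¹ * G = 1 := Matrix.nonsing_inv_mul _ hpos.ne'.isUnit
  rw [Matrix.smul_mul, Matrix.mul_smul, Matrix.mul_add, hinv, Matrix.mul_smul]
  simp only [Matrix.trace_smul, Matrix.trace_add, Matrix.trace_one, smul_eq_mul, Fintype.card_fin]
  push_cast
  field_simp
  ring

/-- The scalar curvature of a leaf, by the Gauss equation: the terms of order one cancel, which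
leaves a quantity of order `s = e^{-2κr}`. -/
theorem scalarCurvature_eq (hκ : 0 < κ) {r : ℝ} (hr : Real.exp (-(2 * κ * r)) ≤ 1 / 2) (p : S) :
    scalarCurvature (D.metric r) p = Real.exp (-(2 * κ * r)) * (κ ^ 2 *
      (-4 * D.traceTerm (Real.exp (-(2 * κ * r))) p
        + 8 * Real.exp (-(2 * κ * r)) * D.detTerm (Real.exp (-(2 * κ * r))) p)) := by
  set s := Real.exp (-(2 * κ * r)) with hs
  have hs0 : 0 < s := Real.exp_pos _
  have hsI : s ∈ Icc (0 : ℝ) (1 / 2) := ⟨hs0.le, hr⟩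
  have hl := isLocalParam_chart p
  set Θ := (extChartAt (𝓡 2) p).symm with hΘ
  set q := extChartAt (𝓡 2) p p with hq
  have hqW : q ∈ (extChartAt (𝓡 2) p).target := mem_extChartAt_target p
  have hp : Θ q = p := extChartAt_to_inv p
  have hpos := (D.gram_slice_pos hκ hl hqW hsI).2
  have hG := D.gram_flow hl hqW r
  have hdet : (gram (D.flow r ∘ Θ) (D.flow r ∘ Θ) q).det ≠ 0 := by
    rw [hG, Matrix.det_smul]
    positivity
  have hev : coordMatrix (D.metric r) p =ᶠ[𝓝 q] gram (D.flow r ∘ Θ) (D.flow r ∘ Θ) := by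
    filter_upwards [hl.isOpen.mem_nhds hqW] with z hz
    exact coordMatrix_pullback (D.flow_smooth r) (D.flow_smooth r) _ hz
  have h0 : scalarCurvature (D.metric r) p = scalCoord (coordMatrix (D.metric r) p) q := rfl
  have hdXN : ∀ z ∈ (extChartAt (𝓡 2) p).target, ∀ i,
      mink (pdv i (D.flow r ∘ Θ) z) ((D.normal r ∘ Θ) z) = 0 := by
    intro z hz i
    have dF : DifferentiableAt ℝ (D.F₀ ∘ Θ) z := differentiableAt_of_smooth hl.isOpen
      ((hl.comp_smooth D.F₀_smooth).of_le (by norm_cast)) hz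
    have dN : DifferentiableAt ℝ (D.N ∘ Θ) z := differentiableAt_of_smooth hl.isOpen
      ((hl.comp_smooth D.N_smooth).of_le (by norm_cast)) hz
    have e1 := mink_fderiv_add_eq_zero hl.isOpen hz dF dF (c := -(1 / κ ^ 2))
      (fun z _ => (D.F₀_mem (Θ z)).1) (EuclideanSpace.single i 1)
    have e2 := mink_fderiv_add_eq_zero hl.isOpen hz dF dN (c := 0)
      (fun z _ => D.N_tangent (Θ z)) (EuclideanSpace.single i 1)
    have e3 := mink_fderiv_add_eq_zero hl.isOpen hz dN dN (c := 1)
      (fun z _ => D.N_unit (Θ z)) (EuclideanSpace.single i 1)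
    have e4 := D.N_normal (Θ z) (mfderiv 𝓘(ℝ, Plane) (𝓡 2) Θ z (EuclideanSpace.single i (1 : ℝ)))
    rw [hl.mfderiv_apply D.F₀_smooth hz] at e4
    rw [flow_eq_comb, D.pdv_comp_comb hl _ _ hz]
    simp only [Function.comp_apply, normal, mink_add_left, mink_add_right, mink_smul_left,
      mink_smul_right, pdv] at *
    rw [mink_comm (D.F₀ (Θ z))] at e1
    rw [mink_comm (D.N (Θ z))] at e3
    have e5 : mink (fderiv ℝ (D.N ∘ Θ) z (EuclideanSpace.single i 1)) (D.F₀ (Θ z)) = 0 := by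
      rw [mink_comm]; linarith
    have e6 : mink (fderiv ℝ (D.F₀ ∘ Θ) z (EuclideanSpace.single i 1)) (D.F₀ (Θ z)) = 0 := by
      linarith
    have e7 : mink (fderiv ℝ (D.N ∘ Θ) z (EuclideanSpace.single i 1)) (D.N (Θ z)) = 0 := by
      linarith
    rw [e4, e5, e6, e7]; ring
  rw [h0, scalCoord_congr hev, scalCoord_gram hκ hl.isOpen
    (hl.comp_smooth (D.flow_smooth r)) (hl.comp_smooth (D.normal_smooth r))
    (fun z _ => D.mink_flow_flow hκ r _)
    (fun z _ => D.mink_normal_normal hκ r _) (fun z _ => D.mink_flow_normal hκ r _) hdXN hqW hdet]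
  have h2 := D.traceTerm_eq hκ hl hqW hsI
  have h3 := D.detTerm_eq hκ hl hqW hsI
  rw [hp] at h2 h3
  rw [h2, h3]
  change 2 * ((gram (D.normal r ∘ Θ) (D.flow r ∘ Θ) q).det /
    (gram (D.flow r ∘ Θ) (D.flow r ∘ Θ) q).det - κ ^ 2) = _
  rw [D.gram_normal_flow hκ hl hqW r, hG, ← hs]
  set G := gram (D.slice s ∘ Θ) (D.slice s ∘ Θ) q with hGd
  set Z := gram (D.sliceDeriv ∘ Θ) (D.slice s ∘ Θ) q with hZd
  have hd : G.det = G 0 0 * G 1 1 - G 0 1 * G 1 0 := Matrix.det_fin_two G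
  have htr : (G⁻¹ * Z).trace = G.det⁻¹ *
      (G 1 1 * Z 0 0 - G 0 1 * Z 1 0 - G 1 0 * Z 0 1 + G 0 0 * Z 1 1) := by
    rw [inv_two]
    rw [Matrix.trace_fin_two, Matrix.mul_apply, Matrix.mul_apply]
    simp [Fin.sum_univ_two, -Matrix.smul_of]
    ring
  rw [htr, Matrix.det_smul, Matrix.det_smul, Matrix.det_fin_two (G + _), Matrix.det_fin_two Z]
  simp only [Matrix.add_apply, Matrix.smul_apply, smul_eq_mul, Fintype.card_fin]
  have hd0 := hpos.ne'
  field_simp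
  rw [hd]
  ring

/-- The Laplacian of a leaf is `s = e^{-2κr}` times that of the rescaled leaf. -/
theorem laplacian_metric_eq (hκ : 0 < κ) {Θ : Plane → S} {W : Set Plane} (h : IsLocalParam Θ W)
    {q : Plane} (hq : q ∈ W) {r : ℝ} (hr : Real.exp (-(2 * κ * r)) ≤ 1 / 2) {f : S → ℝ}
    (hf : ContMDiff (𝓡 2) 𝓘(ℝ, ℝ) ∞ f) :
    laplacian (D.metric r) f (Θ q) = Real.exp (-(2 * κ * r)) *
      lapEmb (D.slice (Real.exp (-(2 * κ * r))) ∘ Θ) (f ∘ Θ) q := by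
  set s := Real.exp (-(2 * κ * r)) with hs
  have hs0 : 0 < s := Real.exp_pos _
  have hsI : s ∈ Icc (0 : ℝ) (1 / 2) := ⟨hs0.le, hr⟩
  have hpos := (D.gram_slice_pos hκ h hq hsI).2
  have hG := D.gram_flow h hq r
  have hdet : 0 < (gram (D.flow r ∘ Θ) (D.flow r ∘ Θ) q).det := by
    rw [hG, Matrix.det_smul]
    positivity
  have h1 := h.laplacian_eq hq (D.flow_smooth r) hf hdet
  have e : D.flow r ∘ Θ = fun z => Real.exp (κ * r) • (D.slice s ∘ Θ) z := by
    rw [flow_eq_slice]; rfl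
  have hexp : (Real.exp (κ * r) ^ 2)⁻¹ = s := by
    rw [hs, ← Real.exp_nat_mul, ← Real.exp_neg]; push_cast; ring_nf
  change laplacian (D.metric r) f (Θ q) = lapEmb (D.flow r ∘ Θ) (f ∘ Θ) q at h1
  rw [h1, e, lapEmb_smul h.isOpen (h.comp_smooth (D.slice_smooth s)) _ hq (Real.exp_pos _).ne',
    hexp]

end ConvexSurface

/-! ### Uniform estimates on the leaves -/

theorem continuousOn_mink {Z : Type*} [TopologicalSpace Z] {X Y : Z → Mink} {U : Set Z}
    (hX : ContinuousOn X U) (hY : ContinuousOn Y U) :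
    ContinuousOn (fun z => mink (X z) (Y z)) U :=
  (contDiff_mink (n := 0)).continuous.comp_continuousOn (hX.prodMk hY)

/-- A family of functions on a compact surface which is continuous in charts, jointly with a
parameter in a compact set, is bounded. -/
theorem exists_bound_of_charts {S : Type*} [TopologicalSpace S] [ChartedSpace Plane S]
    [CompactSpace S] {f : ℝ → S → ℝ} {K : Set ℝ} (hK : IsCompact K)
    (h : ∀ x : S, ContinuousOn (fun z : Plane × ℝ => f z.2 ((extChartAt (𝓡 2) x).symm z.1))
      ((extChartAt (𝓡 2) x).target ×ˢ K)) :
    ∃ C, 0 ≤ C ∧ ∀ s ∈ K, ∀ p, |f s p| ≤ C := by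
  have hc : ContinuousOn (fun z : S × ℝ => f z.2 z.1) (univ ×ˢ K) := by
    rintro ⟨x, s⟩ ⟨-, hs⟩
    have h1 : ContinuousOn (fun z : S × ℝ => f z.2 ((extChartAt (𝓡 2) x).symm
        (extChartAt (𝓡 2) x z.1))) ((extChartAt (𝓡 2) x).source ×ˢ K) := by
      refine (h x).comp (f := fun z : S × ℝ => (extChartAt (𝓡 2) x z.1, z.2)) ?_ ?_
      · exact ((continuousOn_extChartAt x).comp continuousOn_fst fun z hz => hz.1).prodMk
          continuousOn_snd
      · rintro z ⟨hz, hz'⟩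
        exact ⟨(extChartAt (𝓡 2) x).map_source hz, hz'⟩
    have h2 : ContinuousOn (fun z : S × ℝ => f z.2 z.1) ((extChartAt (𝓡 2) x).source ×ˢ K) :=
      h1.congr fun z hz => by simp only [(extChartAt (𝓡 2) x).left_inv hz.1]
    refine (h2 (x, s) ⟨mem_extChartAt_source x, hs⟩).mono_of_mem_nhdsWithin ?_
    rw [mem_nhdsWithin]
    exact ⟨(extChartAt (𝓡 2) x).source ×ˢ univ, (isOpen_extChartAt_source x).prod isOpen_univ,
      ⟨mem_extChartAt_source x, mem_univ _⟩, fun z hz => ⟨hz.1.1, hz.2.2⟩⟩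
  obtain ⟨C, hC⟩ := (isCompact_univ.prod hK).exists_bound_of_continuousOn hc
  exact ⟨max C 0, le_max_right _ _, fun s hs p => (hC (p, s) ⟨mem_univ _, hs⟩).trans
    (le_max_left _ _)⟩

namespace ConvexSurface

variable {S : Type*} [TopologicalSpace S] [ChartedSpace Plane S] {κ : ℝ} (D : ConvexSurface S κ)

theorem continuousOn_pdv_slice {Θ : Plane → S} {W : Set Plane} (h : IsLocalParam Θ W) (i : Fin 2) :
    ContinuousOn (fun z : Plane × ℝ => pdv i (D.slice z.2 ∘ Θ) z.1) (W ×ˢ univ) := by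
  have h1 : ∀ {f : S → Mink}, ContMDiff (𝓡 2) 𝓘(ℝ, Mink) ∞ f →
      ContinuousOn (fun z : Plane × ℝ => pdv i (f ∘ Θ) z.1) (W ×ˢ univ) := fun hf =>
    (contDiffOn_pdv h.isOpen (h.comp_smooth hf) (by norm_cast : (0 : WithTop ℕ∞) + 1 ≤ ∞)
      i).continuousOn.comp continuousOn_fst fun z hz => hz.1
  have h2 : ContinuousOn (fun z : Plane × ℝ => ((1 + z.2) / 2) • pdv i (D.F₀ ∘ Θ) z.1
      + ((1 - z.2) / (2 * κ)) • pdv i (D.N ∘ Θ) z.1) (W ×ˢ univ) :=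
    (ContinuousOn.smul (f := fun z : Plane × ℝ => (1 + z.2) / 2) (by fun_prop)
      (h1 D.F₀_smooth)).add (ContinuousOn.smul (f := fun z : Plane × ℝ => (1 - z.2) / (2 * κ))
        (by fun_prop) (h1 D.N_smooth))
  exact h2.congr fun z hz => D.pdv_comp_comb h _ _ hz.1 i

theorem continuousOn_pdv_pdv_slice {Θ : Plane → S} {W : Set Plane} (h : IsLocalParam Θ W)
    (i j : Fin 2) :
    ContinuousOn (fun z : Plane × ℝ => pdv i (pdv j (D.slice z.2 ∘ Θ)) z.1) (W ×ˢ univ) := by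
  have h1 : ∀ {f : S → Mink}, ContMDiff (𝓡 2) 𝓘(ℝ, Mink) ∞ f →
      ContinuousOn (fun z : Plane × ℝ => pdv i (pdv j (f ∘ Θ)) z.1) (W ×ˢ univ) := fun hf =>
    (contDiffOn_pdv h.isOpen (contDiffOn_pdv h.isOpen (h.comp_smooth hf)
      (by norm_cast : (1 : WithTop ℕ∞) + 1 ≤ ∞) j) (by norm_num : (0 : WithTop ℕ∞) + 1 ≤ 1)
      i).continuousOn.comp continuousOn_fst fun z hz => hz.1
  have h2 : ContinuousOn (fun z : Plane × ℝ => ((1 + z.2) / 2) • pdv i (pdv j (D.F₀ ∘ Θ)) z.1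
      + ((1 - z.2) / (2 * κ)) • pdv i (pdv j (D.N ∘ Θ)) z.1) (W ×ˢ univ) :=
    (ContinuousOn.smul (f := fun z : Plane × ℝ => (1 + z.2) / 2) (by fun_prop)
      (h1 D.F₀_smooth)).add (ContinuousOn.smul (f := fun z : Plane × ℝ => (1 - z.2) / (2 * κ))
        (by fun_prop) (h1 D.N_smooth))
  exact h2.congr fun z hz => D.pdv_pdv_comp_comb h _ _ hz.1 i j

theorem continuousOn_gram_slice {Θ : Plane → S} {W : Set Plane} (h : IsLocalParam Θ W)
    (i j : Fin 2) :
    ContinuousOn (fun z : Plane × ℝ => gram (D.slice z.2 ∘ Θ) (D.slice z.2 ∘ Θ) z.1 i j)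
      (W ×ˢ univ) :=
  continuousOn_mink (D.continuousOn_pdv_slice h i) (D.continuousOn_pdv_slice h j)

theorem continuousOn_det_gram_slice {Θ : Plane → S} {W : Set Plane} (h : IsLocalParam Θ W) :
    ContinuousOn (fun z : Plane × ℝ => (gram (D.slice z.2 ∘ Θ) (D.slice z.2 ∘ Θ) z.1).det)
      (W ×ˢ univ) := by
  simp only [Matrix.det_fin_two]
  exact ((D.continuousOn_gram_slice h 0 0).mul (D.continuousOn_gram_slice h 1 1)).sub
    ((D.continuousOn_gram_slice h 0 1).mul (D.continuousOn_gram_slice h 1 0))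

theorem continuousOn_inv_gram_slice (hκ : 0 < κ) {Θ : Plane → S} {W : Set Plane}
    (h : IsLocalParam Θ W) (i j : Fin 2) :
    ContinuousOn (fun z : Plane × ℝ => (gram (D.slice z.2 ∘ Θ) (D.slice z.2 ∘ Θ) z.1)⁻¹ i j)
      (W ×ˢ Icc 0 (1 / 2)) := by
  have hsub : W ×ˢ Icc (0 : ℝ) (1 / 2) ⊆ W ×ˢ univ := prod_mono_right (subset_univ _)
  have hd : ContinuousOn (fun z : Plane × ℝ =>
      (gram (D.slice z.2 ∘ Θ) (D.slice z.2 ∘ Θ) z.1).det⁻¹) (W ×ˢ Icc 0 (1 / 2)) :=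
    ((D.continuousOn_det_gram_slice h).mono hsub).inv₀ fun z hz =>
      (D.gram_slice_pos hκ h hz.1 hz.2).2.ne'
  have hg := fun i j => (D.continuousOn_gram_slice h i j).mono hsub
  simp only [inv_two, Matrix.smul_apply, smul_eq_mul]
  refine hd.mul ?_
  fin_cases i <;> fin_cases j <;> simp [-one_div]
  exacts [hg 1 1, (hg 0 1).neg, (hg 1 0).neg, hg 0 0]

theorem continuousOn_gram_sliceDeriv {Θ : Plane → S} {W : Set Plane} (h : IsLocalParam Θ W)
    (i j : Fin 2) :
    ContinuousOn (fun z : Plane × ℝ => gram (D.sliceDeriv ∘ Θ) (D.slice z.2 ∘ Θ) z.1 i j)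
      (W ×ˢ univ) :=
  continuousOn_mink ((contDiffOn_pdv h.isOpen (h.comp_smooth D.sliceDeriv_smooth)
    (by norm_cast : (0 : WithTop ℕ∞) + 1 ≤ ∞) i).continuousOn.comp continuousOn_fst
      fun z hz => hz.1) (D.continuousOn_pdv_slice h j)

variable [IsManifold (𝓡 2) ∞ S]

theorem continuousOn_traceTerm (hκ : 0 < κ) {Θ : Plane → S} {W : Set Plane}
    (h : IsLocalParam Θ W) :
    ContinuousOn (fun z : Plane × ℝ => D.traceTerm z.2 (Θ z.1)) (W ×ˢ Icc 0 (1 / 2)) := by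
  have hsub : W ×ˢ Icc (0 : ℝ) (1 / 2) ⊆ W ×ˢ univ := prod_mono_right (subset_univ _)
  have hg := fun i j => (D.continuousOn_gram_sliceDeriv h i j).mono hsub
  have hi := D.continuousOn_inv_gram_slice hκ h
  have h1 : ContinuousOn (fun z : Plane × ℝ => ((gram (D.slice z.2 ∘ Θ) (D.slice z.2 ∘ Θ) z.1)⁻¹ *
      gram (D.sliceDeriv ∘ Θ) (D.slice z.2 ∘ Θ) z.1).trace) (W ×ˢ Icc 0 (1 / 2)) := by
    simp only [Matrix.trace_fin_two, Matrix.mul_apply, Fin.sum_univ_two]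
    exact (((hi 0 0).mul (hg 0 0)).add ((hi 0 1).mul (hg 1 0))).add
      (((hi 1 0).mul (hg 0 1)).add ((hi 1 1).mul (hg 1 1)))
  exact h1.congr fun z hz => D.traceTerm_eq hκ h hz.1 hz.2

theorem continuousOn_detTerm (hκ : 0 < κ) {Θ : Plane → S} {W : Set Plane}
    (h : IsLocalParam Θ W) :
    ContinuousOn (fun z : Plane × ℝ => D.detTerm z.2 (Θ z.1)) (W ×ˢ Icc 0 (1 / 2)) := by
  have hsub : W ×ˢ Icc (0 : ℝ) (1 / 2) ⊆ W ×ˢ univ := prod_mono_right (subset_univ _)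
  have hg := fun i j => (D.continuousOn_gram_sliceDeriv h i j).mono hsub
  have h1 : ContinuousOn (fun z : Plane × ℝ => (gram (D.sliceDeriv ∘ Θ) (D.slice z.2 ∘ Θ) z.1).det /
      (gram (D.slice z.2 ∘ Θ) (D.slice z.2 ∘ Θ) z.1).det) (W ×ˢ Icc 0 (1 / 2)) := by
    refine ContinuousOn.div ?_ ((D.continuousOn_det_gram_slice h).mono hsub) fun z hz =>
      (D.gram_slice_pos hκ h hz.1 hz.2).2.ne'
    simp only [Matrix.det_fin_two]
    exact ((hg 0 0).mul (hg 1 1)).sub ((hg 0 1).mul (hg 1 0))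
  exact h1.congr fun z hz => D.detTerm_eq hκ h hz.1 hz.2

/-- The mean curvature and the scalar curvature of the leaves tend to those of a horosphere, at
the rate `e^{-2κr}`. -/
theorem exists_curvature_bound (hκ : 0 < κ) [CompactSpace S] :
    ∃ C, 0 ≤ C ∧ ∀ r, Real.exp (-(2 * κ * r)) ≤ 1 / 2 → ∀ p,
      |D.meanCurv r p - 2 * κ| ≤ C * Real.exp (-(2 * κ * r)) ∧
      |scalarCurvature (D.metric r) p| ≤ C * Real.exp (-(2 * κ * r)) := by
  obtain ⟨C₁, hC₁, h₁⟩ := exists_bound_of_charts isCompact_Icc fun x =>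
    D.continuousOn_traceTerm hκ (isLocalParam_chart x)
  obtain ⟨C₂, hC₂, h₂⟩ := exists_bound_of_charts isCompact_Icc fun x =>
    D.continuousOn_detTerm hκ (isLocalParam_chart x)
  refine ⟨2 * κ * C₁ + κ ^ 2 * (4 * C₁ + 8 * C₂), by positivity, fun r hr p => ?_⟩
  rw [D.meanCurv_eq hκ hr, D.scalarCurvature_eq hκ hr]
  set s := Real.exp (-(2 * κ * r)) with hs
  have hs0 : 0 < s := Real.exp_pos _
  have hT := h₁ s ⟨hs0.le, hr⟩ p
  have hd := h₂ s ⟨hs0.le, hr⟩ p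
  constructor
  · rw [show 2 * κ - 2 * κ * s * D.traceTerm s p - 2 * κ = -(s * (2 * κ * D.traceTerm s p)) by ring,
      abs_neg, abs_mul, abs_of_pos hs0, mul_comm, abs_mul, abs_of_pos (by positivity : 0 < 2 * κ)]
    refine mul_le_mul_of_nonneg_right ?_ hs0.le
    nlinarith [mul_le_mul_of_nonneg_left hT (by positivity : 0 ≤ 2 * κ),
      (by positivity : 0 ≤ κ ^ 2 * (4 * C₁ + 8 * C₂))]
  · rw [abs_mul, abs_of_pos hs0, mul_comm, abs_mul, abs_of_pos (by positivity : 0 < κ ^ 2)]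
    refine mul_le_mul_of_nonneg_right ?_ hs0.le
    have e : |(-4 * D.traceTerm s p + 8 * s * D.detTerm s p)| ≤ 4 * C₁ + 8 * C₂ := by
      refine (abs_add_le _ _).trans (add_le_add ?_ ?_)
      · rw [abs_mul]; norm_num; linarith
      · rw [abs_mul, abs_of_pos (by positivity : 0 < 8 * s)]
        nlinarith [abs_nonneg (D.detTerm s p)]
    nlinarith [mul_le_mul_of_nonneg_left e (by positivity : 0 ≤ κ ^ 2),
      (by positivity : 0 ≤ 2 * κ * C₁)]

end ConvexSurface

/-! ### Decay of the lapse -/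

/-- The second derivative test for the Laplacian of an embedded metric; with `σ = 1` at a minimum
and `σ = -1` at a maximum. -/
theorem lapEmb_sign_of_extremum {U : Set Plane} (hU : IsOpen U) {X : Plane → Mink} {f : Plane → ℝ}
    (hf : ContDiffOn ℝ 2 f U) {y : Plane} (hy : y ∈ U) (hG : 0 < gram X X y 0 0)
    (hdet : 0 < (gram X X y).det) {σ : ℝ} (hσ : σ = 1 ∨ σ = -1)
    (hle : ∀ z, σ * f y ≤ σ * f z) : 0 ≤ σ * lapEmb X f y := by
  have key : ∀ v : Plane, v 0 * pd 0 f y + v 1 * pd 1 f y = 0 ∧ 0 ≤ σ * hess f y v := by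
    intro v
    have hc : ContDiffOn ℝ 2 (fun _ : Plane => (0 : ℝ)) U := contDiffOn_const
    have h0 : ∀ i, pd i (fun _ : Plane => (0 : ℝ)) y = 0 := fun i => by simp [pd]
    have h00 : hess (fun _ : Plane => (0 : ℝ)) y v = 0 := by
      have : ∀ i, pd i (fun _ : Plane => (0 : ℝ)) = fun _ => 0 := fun i => by ext; simp [pd]
      simp [hess, this]
    rcases hσ with rfl | rfl
    · have := touching_pair (v := v) (v' := v) (β := 0) (γ := 0) hU hc hf hy hy
        (Eventually.of_forall fun t => by simpa using hle (y + t • v))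
      simp only [h0, h00] at this
      exact ⟨by linarith [this.1], by linarith [this.2]⟩
    · have := touching_pair (v := v) (v' := v) (β := 0) (γ := 0) hU hf hc hy hy
        (Eventually.of_forall fun t => by have := hle (y + t • v); simp; linarith)
      simp only [h0, h00] at this
      exact ⟨by linarith [this.1], by linarith [this.2]⟩
  have hgrad : ∀ i, pd i f y = 0 := by
    intro i
    have := (key (EuclideanSpace.single i 1)).1
    fin_cases i <;> simpa using this
  have hs := gram_symm X y 1 0
  have hd := Matrix.det_fin_two (gram X X y)
  have h11 : 0 < gram X X y 1 1 := by
    rw [hs] at hd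
    have : 0 < gram X X y 0 0 * gram X X y 1 1 := by
      nlinarith [mul_self_nonneg (gram X X y 0 1)]
    exact pos_of_mul_pos_right this hG.le
  have hgv : gradVec X f y = 0 := by simp [gradVec, hgrad]
  have htr := trace_mul_le (a := gram X X y 1 1) (b := -gram X X y 0 1) (d := gram X X y 0 0)
    (w00 := -σ * pd 0 (pd 0 f) y) (w01 := -σ * pd 0 (pd 1 f) y)
    (w10 := -σ * pd 1 (pd 0 f) y) (w11 := -σ * pd 1 (pd 1 f) y) (c := 0) h11.le hG.le
    (by rw [hs] at hd; nlinarith) (by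
      intro v0 v1
      have := (key !₂[v0, v1]).2
      simp [hess, Fin.sum_univ_two] at this
      linarith)
  have e : σ * lapEmb X f y = (gram X X y).det⁻¹ *
      (σ * (gram X X y 1 1 * pd 0 (pd 0 f) y - gram X X y 0 1 * pd 0 (pd 1 f) y
        - gram X X y 0 1 * pd 1 (pd 0 f) y + gram X X y 0 0 * pd 1 (pd 1 f) y)) := by
    rw [lapEmb, hgv, inv_two]
    simp [Fin.sum_univ_two, mink_zero_left, hs, -Matrix.smul_of]
    ring
  rw [e]
  exact mul_nonneg (inv_nonneg.2 hdet.le) (by linarith)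

namespace ConvexSurface

variable {S : Type*} [TopologicalSpace S] [ChartedSpace Plane S] {κ : ℝ} (D : ConvexSurface S κ)

/-- The second derivative test on a leaf: `Δf ≥ 0` at a minimum (`σ = 1`), and `Δf ≤ 0` at a maximum
(`σ = -1`). -/
theorem laplacian_sign_of_extremum [IsManifold (𝓡 2) ∞ S] (hκ : 0 < κ) {r : ℝ}
    (hr : Real.exp (-(2 * κ * r)) ≤ 1 / 2) {f : S → ℝ} (hf : ContMDiff (𝓡 2) 𝓘(ℝ, ℝ) ∞ f)
    {σ : ℝ} (hσ : σ = 1 ∨ σ = -1) {p : S}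
    (hle : ∀ q, σ * f p ≤ σ * f q) : 0 ≤ σ * laplacian (D.metric r) f p := by
  have hl := isLocalParam_chart p
  have hq := mem_extChartAt_target (I := 𝓡 2) p
  have hp : (extChartAt (𝓡 2) p).symm (extChartAt (𝓡 2) p p) = p := extChartAt_to_inv p
  have h := D.laplacian_metric_eq hκ hl hq hr hf
  rw [hp] at h
  have hpos := D.gram_slice_pos hκ hl hq ⟨(Real.exp_pos _).le, hr⟩
  rw [h, mul_left_comm]
  refine mul_nonneg (Real.exp_pos _).le (lapEmb_sign_of_extremum hl.isOpen
    ((hl.comp_smooth hf).of_le (by norm_cast)) hq hpos.1 hpos.2 hσ fun z => ?_)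
  simp only [Function.comp_apply, hp]
  exact hle _

namespace IsLapse

variable {D} {Hbd : S → ℝ} {u : S → ℝ → ℝ}

theorem smooth_slice (hu : D.IsLapse Hbd u) {r : ℝ} (hr : 0 < r) :
    ContMDiff (𝓡 2) 𝓘(ℝ, ℝ) ∞ fun p => u p r := by
  have h : ContMDiff (𝓡 2) ((𝓡 2).prod 𝓘(ℝ, ℝ)) ∞ fun p : S => (p, r) :=
    contMDiff_id.prodMk contMDiff_const
  exact contMDiffOn_univ.1 (hu.smooth.comp (h.contMDiffOn (s := univ))
    fun p _ => ⟨mem_univ _, hr⟩)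

theorem hasDerivAt (hu : D.IsLapse Hbd u) (p : S) {r : ℝ} (hr : 0 < r) :
    HasDerivAt (u p) (deriv (u p) r) r := by
  have h : ContMDiff 𝓘(ℝ, ℝ) ((𝓡 2).prod 𝓘(ℝ, ℝ)) ∞ fun t : ℝ => (p, t) :=
    contMDiff_const.prodMk contMDiff_id
  have h1 : ContMDiffOn 𝓘(ℝ, ℝ) 𝓘(ℝ, ℝ) ∞ (u p) (Ioi 0) :=
    hu.smooth.comp (h.contMDiffOn (s := Ioi 0)) fun t ht => ⟨mem_univ _, ht⟩
  exact ((contMDiffOn_iff_contDiffOn.1 h1).contDiffAt (Ioi_mem_nhds hr)).differentiableAt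
    (by simp) |>.hasDerivAt

theorem abs_sub_one_le {x v : ℝ} (hx : 0 < x) (hv : (x ^ 2)⁻¹ - 1 = v) (h : |v| ≤ 1 / 2) :
    |x - 1| ≤ 2 * |v| := by
  have h1 : x ^ 2 * (1 + v) = 1 := by rw [← hv]; field_simp; ring
  have h2 : x ^ 2 ≤ 2 := by nlinarith [(abs_le.1 h).1, sq_nonneg x]
  have h3 : |x - 1| * (x + 1) = |v| * x ^ 2 := by
    have a1 : |x - 1| * (x + 1) = |(x - 1) * (x + 1)| := by
      rw [abs_mul, abs_of_pos (by linarith : 0 < x + 1)]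
    have a2 : |v| * x ^ 2 = |v * x ^ 2| := by rw [abs_mul, abs_of_nonneg (sq_nonneg x)]
    rw [a1, a2, ← abs_neg]
    congr 1; linarith
  nlinarith [abs_nonneg (x - 1), abs_nonneg v]

/-- The lapse converges to `1` at the rate `e^{-3κr}`: the maximum principle for
`(u⁻² - 1) e^{3κr + b s}`, with `s = e^{-2κr}` and `b` large. -/
theorem exists_decay [IsManifold (𝓡 2) ∞ S] (hu : D.IsLapse Hbd u) (hκ : 0 < κ) [CompactSpace S] :
    ∃ C r₁, 0 < r₁ ∧ 0 ≤ C ∧ ∀ r, r₁ ≤ r → ∀ p, |u p r - 1| ≤ C * Real.exp (-(3 * κ * r)) := by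
  obtain ⟨C, hC, hcurv⟩ := D.exists_curvature_bound hκ
  have hst : Tendsto (fun r : ℝ => Real.exp (-(2 * κ * r))) atTop (𝓝 0) :=
    Real.tendsto_exp_neg_atTop_nhds_zero.comp (tendsto_id.const_mul_atTop (by positivity))
  obtain ⟨r₀, hr₀, hsmall⟩ : ∃ r₀ : ℝ, 0 < r₀ ∧ ∀ r, r₀ ≤ r →
      Real.exp (-(2 * κ * r)) ≤ 1 / 2 ∧ C * Real.exp (-(2 * κ * r)) ≤ κ := by
    have h1 := hst.eventually (ge_mem_nhds (by norm_num : (0 : ℝ) < 1 / 2))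
    have h2 := (hst.const_mul C).eventually (ge_mem_nhds (by simpa using hκ))
    obtain ⟨r₀, h⟩ := eventually_atTop.1 ((h1.and h2).and (eventually_gt_atTop 0))
    exact ⟨r₀, (h r₀ le_rfl).2, fun r hr => (h r hr).1⟩
  set B := (C + 3 * κ * C) / κ with hB
  set b := (B + 1) / (2 * κ) with hb
  have hB0 : 0 ≤ B := by positivity
  have hb0 : 0 ≤ b := by positivity
  have hBκ : B * κ = C + 3 * κ * C := by rw [hB]; field_simp
  have hbκ : 2 * κ * b = B + 1 := by rw [hb]; field_simp
  set E : ℝ → ℝ := fun r => Real.exp (3 * κ * r + b * Real.exp (-(2 * κ * r))) with hE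
  have hEd : ∀ r, HasDerivAt E (E r * (3 * κ - (B + 1) * Real.exp (-(2 * κ * r)))) r := by
    intro r
    have h1 : HasDerivAt (fun r : ℝ => -(2 * κ * r)) (-(2 * κ)) r := by
      simpa using ((hasDerivAt_id r).const_mul (2 * κ)).fun_neg
    have h2 : HasDerivAt (fun r : ℝ => 3 * κ * r) (3 * κ) r := by
      simpa using (hasDerivAt_id r).const_mul (3 * κ)
    refine (h2.add (h1.exp.const_mul b)).exp.congr_deriv ?_
    simp only [hE, Pi.add_apply]
    rw [← hbκ]; ring
  have hEc : Continuous E := by simp only [hE]; fun_prop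
  have hE0 : ∀ r, 0 < E r := fun r => Real.exp_pos _
  -- the quantity to which the maximum principle applies
  set Q : ℝ → S × ℝ → ℝ := fun σ z => σ * (((u z.1 z.2) ^ 2)⁻¹ - 1) * E z.2 with hQ
  have hQc : ∀ σ, ContinuousOn (Q σ) (univ ×ˢ Ici r₀) := by
    intro σ
    have hc := hu.cont.mono (prod_mono_right (Ici_subset_Ici.2 hr₀.le) : univ ×ˢ Ici r₀ ⊆ _)
    refine (((hc.pow 2).inv₀ fun z hz => ?_).sub continuousOn_const).const_smul σ |>.mul
      (hEc.comp continuous_snd).continuousOn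
    exact (pow_pos (hu.pos z.1 z.2 (hr₀.le.trans hz.2)) 2).ne'
  obtain ⟨M, hM⟩ : ∃ M, ∀ p, |Q 1 (p, r₀)| ≤ M := by
    obtain ⟨M, hM⟩ :=
      (isCompact_univ.prod (isCompact_singleton (x := r₀))).exists_bound_of_continuousOn
      ((hQc 1).mono (prod_mono_right (by simp) : (univ : Set S) ×ˢ {r₀} ⊆ _))
    exact ⟨M, fun p => hM (p, r₀) ⟨mem_univ _, rfl⟩⟩
  have hmax : ∀ σ : ℝ, σ = 1 ∨ σ = -1 → ∀ p r, r₀ ≤ r → Q σ (p, r) ≤ max M 0 := by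
    intro σ hσ p R hR
    obtain ⟨⟨p', r'⟩, ⟨-, hr'⟩, hmx⟩ :=
      (isCompact_univ.prod (isCompact_Icc (a := r₀) (b := R))).exists_isMaxOn
      ⟨(p, R), mem_univ _, hR, le_rfl⟩
      ((hQc σ).mono (prod_mono_right Icc_subset_Ici_self : (univ : Set S) ×ˢ Icc r₀ R ⊆ _))
    refine (hmx ⟨mem_univ _, hR, le_rfl⟩ : Q σ (p, R) ≤ Q σ (p', r')).trans ?_
    by_contra! hcon
    have hQpos : 0 < Q σ (p', r') := (le_max_right _ _).trans_lt hcon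
    have hrr : r₀ < r' := by
      rcases hr'.1.eq_or_lt with h | h
      · exfalso
        simp only at h
        rw [← h] at hcon
        have h1 : Q σ (p', r₀) ≤ |Q 1 (p', r₀)| := by
          have e : Q σ (p', r₀) = σ * Q 1 (p', r₀) := by simp only [hQ]; ring
          rw [e]
          rcases hσ with rfl | rfl
          · rw [one_mul]; exact le_abs_self _
          · rw [neg_one_mul]; exact neg_le_abs _
        exact absurd (h1.trans ((hM p').trans (le_max_left _ _))) (not_le.2 hcon)
      · exact h
    have hr0' : 0 < r' := hr₀.trans hrr
    have hup := hu.pos p' r' hr0'.le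
    obtain ⟨hs1, hs2⟩ := hsmall r' hr'.1
    obtain ⟨hc1, hc2⟩ := hcurv r' hs1 p'
    -- `x ↦ x⁻²` is decreasing, so a maximum of `σ (u⁻² - 1)` is a minimum of `σ u`
    have hlap : 0 ≤ σ * laplacian (D.metric r') (fun q => u q r') p' := by
      refine D.laplacian_sign_of_extremum hκ hs1 (hu.smooth_slice hr0') hσ fun q => ?_
      have h1 : Q σ (q, r') ≤ Q σ (p', r') := hmx ⟨mem_univ _, hr'⟩
      have h2 : σ * (((u q r') ^ 2)⁻¹ - 1) ≤ σ * (((u p' r') ^ 2)⁻¹ - 1) :=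
        le_of_mul_le_mul_right h1 (hE0 r')
      have huq := hu.pos q r' hr0'.le
      rcases hσ with rfl | rfl
      · have h3 : ((u q r') ^ 2)⁻¹ ≤ ((u p' r') ^ 2)⁻¹ := by linarith
        rw [inv_le_inv₀ (by positivity) (by positivity)] at h3
        simpa using (sq_le_sq₀ hup.le huq.le).1 h3
      · have h3 : ((u p' r') ^ 2)⁻¹ ≤ ((u q r') ^ 2)⁻¹ := by linarith
        rw [inv_le_inv₀ (by positivity) (by positivity)] at h3
        simpa using (sq_le_sq₀ huq.le hup.le).1 h3
    -- the time derivative is nonnegative at the maximum, but the equation makes it negative: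
    -- `b` was chosen so that the reaction coefficient is positive
    have hd : HasDerivAt (fun r => Q σ (p', r))
        (σ * (-(2 * u p' r' * deriv (u p') r') / ((u p' r') ^ 2) ^ 2) * E r'
          + σ * (((u p' r') ^ 2)⁻¹ - 1) *
            (E r' * (3 * κ - (B + 1) * Real.exp (-(2 * κ * r'))))) r' := by
      have h1 := ((hu.hasDerivAt p' hr0').pow 2).inv (pow_pos hup 2).ne'
      refine (((h1.sub_const 1).const_mul σ).mul (hEd r')).congr_deriv ?_
      simp
    have hd0 := deriv_nonneg_of_le_left hrr hd fun r hr =>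
      hmx ⟨mem_univ _, hr.1, hr.2.trans hr'.2⟩
    have heq := hu.eqn p' r' hr0'
    set x := u p' r'
    set s := Real.exp (-(2 * κ * r'))
    set H := D.meanCurv r' p'
    set R' := scalarCurvature (D.metric r') p'
    set Λ := laplacian (D.metric r') (fun q => u q r') p'
    have hs0 : 0 < s := Real.exp_pos _
    have hH : κ ≤ H := by linarith [(abs_le.1 hc1).1]
    have hv : 0 < σ * ((x ^ 2)⁻¹ - 1) := pos_of_mul_pos_left hQpos (hE0 r').le
    have hm : 0 < R' + 6 * κ ^ 2 - H * (3 * κ - (B + 1) * s) := by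
      have a1 := (abs_le.1 hc2).1
      have a2 := (abs_le.1 hc1).2
      have a3 : B * s * κ ≤ B * s * H := mul_le_mul_of_nonneg_left hH (by positivity)
      have a4 : 3 * κ * (H - 2 * κ) ≤ 3 * κ * (C * s) :=
        mul_le_mul_of_nonneg_left a2 (by positivity)
      have a5 : B * s * κ = (C + 3 * κ * C) * s := by rw [← hBκ]; ring
      have a6 : 0 < s * H := mul_pos hs0 (hκ.trans_le hH)
      nlinarith
    have e : (σ * (-(2 * x * deriv (u p') r') / (x ^ 2) ^ 2) * E r'
          + σ * ((x ^ 2)⁻¹ - 1) * (E r' * (3 * κ - (B + 1) * s))) * (H * x ^ 3) =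
        -(E r' * (2 * x ^ 2 * (σ * Λ) + x ^ 3 * (σ * ((x ^ 2)⁻¹ - 1)) *
          (R' + 6 * κ ^ 2 - H * (3 * κ - (B + 1) * s)))) := by
      have hx := hup.ne'
      have e1 : (σ * (-(2 * x * deriv (u p') r') / (x ^ 2) ^ 2) * E r'
          + σ * ((x ^ 2)⁻¹ - 1) * (E r' * (3 * κ - (B + 1) * s))) * (H * x ^ 3) =
          E r' * (-σ * (2 * H * deriv (u p') r') +
            x ^ 3 * (σ * ((x ^ 2)⁻¹ - 1)) * (H * (3 * κ - (B + 1) * s))) := by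
        field_simp
      rw [e1, heq]
      field_simp
      ring
    have hneg : 0 < E r' * (2 * x ^ 2 * (σ * Λ) + x ^ 3 * (σ * ((x ^ 2)⁻¹ - 1)) *
          (R' + 6 * κ ^ 2 - H * (3 * κ - (B + 1) * s))) := by
      have h1 := hE0 r'
      have h2 : 0 < x ^ 3 * (σ * ((x ^ 2)⁻¹ - 1)) := by positivity
      have h3 := mul_pos h2 hm
      have h4 : 0 ≤ 2 * x ^ 2 * (σ * Λ) := mul_nonneg (by positivity) hlap
      exact mul_pos h1 (by linarith)
    have hnn := mul_nonneg hd0 (by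
      have : 0 < H := hκ.trans_le hH
      positivity : 0 ≤ H * x ^ 3)
    linarith
  set M' := max M 0 with hM'
  have hM0 : 0 ≤ M' := le_max_right _ _
  have hv : ∀ r, r₀ ≤ r → ∀ p, |((u p r) ^ 2)⁻¹ - 1| ≤ M' * Real.exp (-(3 * κ * r)) := by
    intro r hr p
    have h1 := hmax 1 (Or.inl rfl) p r hr
    have h2 := hmax (-1) (Or.inr rfl) p r hr
    simp only [hQ] at h1 h2
    have h3 : |((u p r) ^ 2)⁻¹ - 1| * E r ≤ M' := by
      have a1 : |((u p r) ^ 2)⁻¹ - 1| * E r = |(((u p r) ^ 2)⁻¹ - 1) * E r| := by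
        rw [abs_mul, abs_of_pos (hE0 r)]
      rw [a1, abs_le]
      constructor <;> linarith
    have h4 : Real.exp (3 * κ * r) ≤ E r := Real.exp_le_exp.2 (by
      have := mul_nonneg hb0 (Real.exp_pos (-(2 * κ * r))).le; linarith)
    rw [Real.exp_neg, ← div_eq_mul_inv, le_div_iff₀ (Real.exp_pos _)]
    exact (mul_le_mul_of_nonneg_left h4 (abs_nonneg _)).trans h3
  have h3t : Tendsto (fun r : ℝ => M' * Real.exp (-(3 * κ * r))) atTop (𝓝 (M' * 0)) :=
    (Real.tendsto_exp_neg_atTop_nhds_zero.comp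
      (tendsto_id.const_mul_atTop (by positivity))).const_mul M'
  rw [mul_zero] at h3t
  obtain ⟨r₁, h₁⟩ := eventually_atTop.1 ((h3t.eventually
    (ge_mem_nhds (by norm_num : (0 : ℝ) < 1 / 2))).and (eventually_ge_atTop r₀))
  refine ⟨2 * M', r₁, hr₀.trans_le (h₁ r₁ le_rfl).2, by positivity, fun r hr p => ?_⟩
  obtain ⟨h2, h3⟩ := h₁ r hr
  have := hv r h3 p
  have := abs_sub_one_le (hu.pos p r (hr₀.le.trans h3)) rfl (this.trans h2)
  linarith

end IsLapse

end ConvexSurface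

/-! ### Pointwise convergence of the rescaled lapse -/

/-- The first order coefficients `-g^{ij} Γ_{ij}^k` of the Laplace-Beltrami operator. -/
def drift (X : Plane → Mink) (k : Fin 2) (y : Plane) : ℝ :=
  -∑ i : Fin 2, ∑ j : Fin 2, ∑ l : Fin 2, (gram X X y)⁻¹ i j * (gram X X y)⁻¹ k l *
    mink (pdv l X y) (pdv i (pdv j X) y)

theorem lapEmb_expand (X : Plane → Mink) (f : Plane → ℝ) (y : Plane) :
    lapEmb X f y = ∑ i, ∑ j, (gram X X y)⁻¹ i j * pd i (pd j f) y
      + ∑ k, drift X k y * pd k f y := by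
  simp only [lapEmb, gradVec, drift, Fin.sum_univ_two, mink_add_left, mink_smul_left]
  ring

theorem lapEmb_affine (X : Plane → Mink) {U : Set Plane} (hU : IsOpen U) {f : Plane → ℝ}
    (hf : ContDiffOn ℝ 2 f U) {y : Plane} (hy : y ∈ U) (a b : ℝ) :
    lapEmb X (fun z => a * (f z - b)) y = a * lapEmb X f y := by
  have hg : ∀ x : ℝ, HasDerivAt (fun x : ℝ => a * (x - b)) a x := fun x => by
    simpa using ((hasDerivAt_id x).sub_const b).const_mul a
  have hm : ∀ x : ℝ, HasDerivAt (fun x : ℝ => a * x) a x := fun x => by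
    simpa using (hasDerivAt_id x).const_mul a
  have h1 : ∀ z ∈ U, ∀ i, pd i (fun z => a * (f z - b)) z = a * pd i f z := fun z hz i =>
    pd_comp_real (differentiableAt_of_smooth hU (hf.of_le (by norm_num)) hz) (hg _) i
  have h2 : ∀ i j, pd i (pd j fun z => a * (f z - b)) y = a * pd i (pd j f) y := by
    intro i j
    have e : (pd j fun z => a * (f z - b)) =ᶠ[𝓝 y] fun z => a * pd j f z := by
      filter_upwards [hU.mem_nhds hy] with z hz using h1 z hz j
    rw [pd_congr e]
    exact pd_comp_real (differentiableAt_of_smooth hU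
      (contDiffOn_pd hU hf (by norm_num [one_add_one_eq_two]) j) hy) (hm _) i
  simp only [lapEmb_expand, h1 y hy, h2, Fin.sum_univ_two]
  ring

/-- Linear coordinates which are orthonormal for a given inner product. -/
theorem exists_orthonormalizing {G : Matrix (Fin 2) (Fin 2) ℝ} (hs : G 1 0 = G 0 1)
    (h0 : 0 < G 0 0) (hdet : 0 < G.det) : ∃ L : Plane ≃L[ℝ] Plane, ∀ y₀ q : Plane,
      (jac (fun y => y₀ + L y) q).transpose * G * jac (fun y => y₀ + L y) q = 1 := by
  set α := √(G 0 0) with hα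
  have hα0 : 0 < α := Real.sqrt_pos.2 h0
  have hα2 : α ^ 2 = G 0 0 := Real.sq_sqrt h0.le
  set γ := √(G.det) with hγ
  have hγ0 : 0 < γ := Real.sqrt_pos.2 hdet
  have hγ2 : γ ^ 2 = G.det := Real.sq_sqrt hdet.le
  rw [Matrix.det_fin_two, hs] at hγ2
  set b := G 0 1 with hb
  -- Gram-Schmidt for the standard basis
  let L₀ : Plane ≃ₗ[ℝ] Plane :=
    { toFun := fun v => !₂[v 0 / α - b / (α * γ) * v 1, α / γ * v 1]
      invFun := fun v => !₂[α * v 0 + b / α * v 1, γ / α * v 1]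
      map_add' := fun v w => by
        ext i; fin_cases i <;> simp <;> ring
      map_smul' := fun c v => by
        ext i; fin_cases i <;> simp <;> ring
      left_inv := fun v => by
        ext i; fin_cases i <;> simp <;> field_simp
        ring
      right_inv := fun v => by
        ext i; fin_cases i <;> simp <;> field_simp
        ring }
  refine ⟨L₀.toContinuousLinearEquiv, fun y₀ q => ?_⟩
  have hp : ∀ i, pdv i (fun y => y₀ + L₀.toContinuousLinearEquiv y) q =
      L₀ (EuclideanSpace.single i 1) := by
    intro i
    have h : HasFDerivAt (fun y => y₀ + L₀.toContinuousLinearEquiv y)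
        (L₀.toContinuousLinearEquiv : Plane →L[ℝ] Plane) q :=
      (L₀.toContinuousLinearEquiv.hasFDerivAt).const_add y₀
    rw [pdv, h.fderiv]; rfl
  have hJ : jac (fun y => y₀ + L₀.toContinuousLinearEquiv y) q =
      !![1 / α, -(b / (α * γ)); 0, α / γ] := by
    ext a i
    rw [jac, Matrix.of_apply, hp]
    fin_cases a <;> fin_cases i <;> simp [L₀]
  rw [hJ]
  have hG : G = !![α ^ 2, b; b, (γ ^ 2 + b * b) / α ^ 2] := by
    ext i j
    fin_cases i <;> fin_cases j <;> simp [hα2, hs, hb]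
    rw [hγ2]; field_simp; ring
  rw [hG]
  ext i j
  fin_cases i <;> fin_cases j <;> simp [Matrix.mul_apply, Fin.sum_univ_two] <;> field_simp <;>
    first | ring1 | simp

namespace ConvexSurface

variable {S : Type*} [TopologicalSpace S] [ChartedSpace Plane S] {κ : ℝ} (D : ConvexSurface S κ)

theorem continuousOn_drift_slice (hκ : 0 < κ) {Θ : Plane → S} {W : Set Plane}
    (h : IsLocalParam Θ W) (k : Fin 2) :
    ContinuousOn (fun z : Plane × ℝ => drift (D.slice z.2 ∘ Θ) k z.1) (W ×ˢ Icc 0 (1 / 2)) := by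
  have hsub : W ×ˢ Icc (0 : ℝ) (1 / 2) ⊆ W ×ˢ univ := prod_mono_right (subset_univ _)
  refine ContinuousOn.neg (continuousOn_finsetSum _ fun i _ => continuousOn_finsetSum _
    fun j _ => continuousOn_finsetSum _ fun l _ => ?_)
  exact ((D.continuousOn_inv_gram_slice hκ h i j).mul (D.continuousOn_inv_gram_slice hκ h k l)).mul
    (continuousOn_mink ((D.continuousOn_pdv_slice h l).mono hsub)
      ((D.continuousOn_pdv_pdv_slice h i j).mono hsub))

/-- In suitable coordinates around a point, the rescaled metrics are close to the Euclidean metric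
for small `s`, and the first order coefficients of their Laplacians are bounded. -/
theorem exists_good_param [IsManifold (𝓡 2) ∞ S] (hκ : 0 < κ) (p : S) {ε : ℝ} (hε : 0 < ε) :
    ∃ (Θ : Plane → S) (W : Set Plane) (δ s₀ C : ℝ), IsLocalParam Θ W ∧ Θ 0 = p ∧ 0 < δ ∧ 0 < s₀ ∧
      s₀ ≤ 1 / 2 ∧ Metric.ball 0 δ ⊆ W ∧ ∀ y ∈ Metric.ball (0 : Plane) δ, ∀ s ∈ Icc 0 s₀,
        (∀ i j, |(gram (D.slice s ∘ Θ) (D.slice s ∘ Θ) y)⁻¹ i j -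
          (1 : Matrix (Fin 2) (Fin 2) ℝ) i j| ≤ ε) ∧
        ∀ k, |drift (D.slice s ∘ Θ) k y| ≤ C := by
  have hl := isLocalParam_chart p
  set y₀ := extChartAt (𝓡 2) p p with hy₀
  have hy₀W : y₀ ∈ (extChartAt (𝓡 2) p).target := mem_extChartAt_target p
  have hI0 : (0 : ℝ) ∈ Icc (0 : ℝ) (1 / 2) := ⟨le_rfl, by norm_num⟩
  obtain ⟨hp1, hp2⟩ := D.gram_slice_pos hκ hl hy₀W hI0
  obtain ⟨L, hL⟩ := exists_orthonormalizing (gram_symm _ _ _ _) hp1 hp2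
  have h := isLocalParam_affine p L y₀
  set Θ : Plane → S := fun y => (extChartAt (𝓡 2) p).symm (y₀ + L y) with hΘ
  set W := (fun y => y₀ + L y) ⁻¹' (extChartAt (𝓡 2) p).target with hW
  have h0W : (0 : Plane) ∈ W := by
    change y₀ + L 0 ∈ (extChartAt (𝓡 2) p).target
    rwa [map_zero, add_zero]
  have hg : gram (D.slice 0 ∘ Θ) (D.slice 0 ∘ Θ) 0 = 1 := by
    have e : y₀ + L 0 = y₀ := by simp
    have d : DifferentiableAt ℝ (D.slice 0 ∘ (extChartAt (𝓡 2) p).symm) (y₀ + L 0) := by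
      rw [e]
      exact differentiableAt_of_smooth hl.isOpen
        ((hl.comp_smooth (D.slice_smooth 0)).of_le (by norm_cast)) hy₀W
    have := gram_comp (τ := fun y => y₀ + L y) (q := 0) d d (by fun_prop)
    rw [e, hL] at this
    exact this
  have hev : ∀ i j, ∀ᶠ z in 𝓝[W ×ˢ Icc 0 (1 / 2)] ((0 : Plane), (0 : ℝ)),
      |(gram (D.slice z.2 ∘ Θ) (D.slice z.2 ∘ Θ) z.1)⁻¹ i j -
          (1 : Matrix (Fin 2) (Fin 2) ℝ) i j| < ε := by
    intro i j
    have hc := D.continuousOn_inv_gram_slice hκ h i j (0, 0) ⟨h0W, hI0⟩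
    have := (hc.sub (continuousWithinAt_const (b := (1 : Matrix (Fin 2) (Fin 2) ℝ) i j))).abs
    refine this.eventually (gt_mem_nhds ?_)
    simp only [Pi.sub_apply, hg, inv_one, sub_self, abs_zero, hε]
  have hdr : ∀ k, ∀ᶠ z in 𝓝[W ×ˢ Icc 0 (1 / 2)] ((0 : Plane), (0 : ℝ)),
      |drift (D.slice z.2 ∘ Θ) k z.1| < |drift (D.slice 0 ∘ Θ) k 0| + 1 := by
    intro k
    have hc := (D.continuousOn_drift_slice hκ h k (0, 0) ⟨h0W, hI0⟩).abs
    exact hc.eventually (gt_mem_nhds (by simp))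
  have hall := (eventually_all.2 fun i => eventually_all.2 fun j => hev i j).and
    (eventually_all.2 hdr)
  rw [eventually_nhdsWithin_iff, Metric.eventually_nhds_iff] at hall
  obtain ⟨d, hd, hall⟩ := hall
  obtain ⟨d', hd', hball⟩ := Metric.isOpen_iff.1 h.isOpen 0 h0W
  refine ⟨Θ, W, min d d', min (d / 2) (1 / 2), ∑ k, (|drift (D.slice 0 ∘ Θ) k 0| + 1), h, ?_,
    lt_min hd hd', lt_min (by linarith) (by norm_num), min_le_right _ _,
    (Metric.ball_subset_ball (min_le_right _ _)).trans hball, fun y hy s hs => ?_⟩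
  · simp only [hΘ, map_zero, add_zero]
    exact extChartAt_to_inv p
  · have hyW : y ∈ W := hball (Metric.ball_subset_ball (min_le_right _ _) hy)
    have h1 : dist (y, s) ((0 : Plane), (0 : ℝ)) < d := by
      rw [Prod.dist_eq, max_lt_iff]
      refine ⟨(Metric.mem_ball.1 hy).trans_le (min_le_left _ _), ?_⟩
      rw [Real.dist_0_eq_abs, abs_of_nonneg hs.1]
      have := hs.2.trans (min_le_left _ _)
      linarith
    have h2 := hall h1 ⟨hyW, hs.1, hs.2.trans (min_le_right _ _)⟩
    refine ⟨fun i j => (h2.1 i j).le, fun k => (h2.2 k).le.trans ?_⟩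
    exact Finset.single_le_sum (f := fun k => |drift (D.slice 0 ∘ Θ) k 0| + 1)
      (fun k _ => by positivity) (Finset.mem_univ k)

/-- The reaction coefficient of the equation for `u - 1` agrees with `3κ` up to `O(e^{-2κr})`. -/
theorem reaction_bound {κ H R x s C C' : ℝ} (hκ : 0 < κ)
    (hH : |H - 2 * κ| ≤ C * s) (hR : |R| ≤ C * s) (h1 : C * s ≤ κ) (h2 : C * s ≤ κ ^ 2)
    (hx : |x - 1| ≤ C' * s) (h3 : C' * s ≤ 1) :
    |3 * κ - x * (x + 1) * (R + 6 * κ ^ 2) / (2 * H)| ≤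
      (6 * κ * C + 2 * C + 28 * κ ^ 2 * C') / (2 * κ) * s := by
  have hHκ : κ ≤ H := by linarith [(abs_le.1 hH).1]
  have hH0 : 0 < H := hκ.trans_le hHκ
  have e : 3 * κ - x * (x + 1) * (R + 6 * κ ^ 2) / (2 * H) =
      (6 * κ * (H - 2 * κ) - 2 * R - (x - 1) * ((x + 2) * (R + 6 * κ ^ 2))) / (2 * H) := by
    field_simp; ring
  have hxb : |x + 2| ≤ 4 := by
    have := abs_le.1 (hx.trans h3)
    rw [abs_le]; constructor <;> linarith
  have hRb : |R + 6 * κ ^ 2| ≤ 7 * κ ^ 2 := by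
    have := abs_le.1 (hR.trans h2)
    rw [abs_le]; constructor <;> nlinarith [sq_nonneg κ]
  have hC's : 0 ≤ C' * s := (abs_nonneg _).trans hx
  have hN : |6 * κ * (H - 2 * κ) - 2 * R - (x - 1) * ((x + 2) * (R + 6 * κ ^ 2))| ≤
      (6 * κ * C + 2 * C + 28 * κ ^ 2 * C') * s := by
    have a1 : |6 * κ * (H - 2 * κ)| ≤ 6 * κ * (C * s) := by
      rw [abs_mul, abs_of_pos (by positivity : 0 < 6 * κ)]
      exact mul_le_mul_of_nonneg_left hH (by positivity)
    have a2 : |2 * R| ≤ 2 * (C * s) := by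
      rw [abs_mul, abs_two]; linarith
    have a3 : |(x - 1) * ((x + 2) * (R + 6 * κ ^ 2))| ≤ C' * s * (4 * (7 * κ ^ 2)) := by
      rw [abs_mul, abs_mul]
      exact mul_le_mul hx (mul_le_mul hxb hRb (abs_nonneg _) (by norm_num)) (by positivity) hC's
    calc _ ≤ |6 * κ * (H - 2 * κ)| + |2 * R| + |(x - 1) * ((x + 2) * (R + 6 * κ ^ 2))| :=
          (abs_sub _ _).trans (add_le_add (abs_sub _ _) le_rfl)
      _ ≤ _ := by linarith
  rw [e, abs_div, abs_of_pos (by positivity : 0 < 2 * H), div_mul_eq_mul_div]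
  exact div_le_div₀ ((abs_nonneg _).trans hN) hN (by positivity) (by linarith)

/-- If a matrix is close to the identity, so that the ellipticity constants are close to one
another, the structure conditions of `IsParabolicSolution` hold. -/
theorem ellipticity_of_close {P a b d : ℝ} (hP : |P - 1| ≤ 1 / 1000) (ha : |a - 1| ≤ 1 / 1000)
    (hb : |b| ≤ 1 / 1000) (hd : |d - 1| ≤ 1 / 1000) :
    19 / 20 ≤ P * a ∧ 19 / 20 ≤ P * d ∧
      (P * b) ^ 2 ≤ (P * a - 19 / 20) * (P * d - 19 / 20) ∧ P * a + P * d ≤ 9 / 4 * (19 / 20) := by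
  rw [abs_le] at *
  have h1 : 99 / 100 ≤ P * a := by nlinarith
  have h2 : 99 / 100 ≤ P * d := by nlinarith
  have h3 : P * a ≤ 101 / 100 := by nlinarith
  have h4 : P * d ≤ 101 / 100 := by nlinarith
  have h5 : |P * b| ≤ 1 / 100 := by
    rw [abs_mul]
    calc |P| * |b| ≤ 2 * (1 / 1000) :=
          mul_le_mul (abs_le.2 ⟨by linarith, by linarith⟩) (abs_le.2 hb) (abs_nonneg _)
            (by norm_num)
      _ ≤ _ := by norm_num
  have h6 : (P * b) ^ 2 ≤ (1 / 100) ^ 2 := sq_le_sq' (abs_le.1 h5).1 (abs_le.1 h5).2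
  refine ⟨by linarith, by linarith, ?_, by linarith⟩
  nlinarith

/-- The factor `u² / H₀` of the second order term is close to `1 / (2κ)`. -/
theorem abs_ratio_sub_one_le {κ H x : ℝ} (hκ : 0 < κ) (hH : |H - 2 * κ| ≤ κ / 1000)
    (hx : |x - 1| ≤ 1 / 10000) : |2 * κ * (x ^ 2 / H) - 1| ≤ 1 / 1000 := by
  rw [abs_le] at *
  have hH0 : 0 < H := by linarith
  have e : 2 * κ * (x ^ 2 / H) - 1 = (2 * κ * x ^ 2 - H) / H := by field_simp
  have h1 : x ^ 2 ≤ 1 + 3 / 10000 := by nlinarith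
  have h2 : 1 - 3 / 10000 ≤ x ^ 2 := by nlinarith
  rw [e, le_div_iff₀ hH0, div_le_iff₀ hH0]
  constructor <;> nlinarith

variable {D} in
/-- The rescaled lapse converges at every point: in suitable coordinates it is a bounded solution of
a uniformly parabolic equation with finite final time. -/
theorem IsLapse.exists_tendsto [IsManifold (𝓡 2) ∞ S] [CompactSpace S] {Hbd : S → ℝ}
    {u : S → ℝ → ℝ} (hu : D.IsLapse Hbd u) (hκ : 0 < κ) (p : S) :
    ∃ l, Tendsto (fun r => Real.exp (3 * κ * r) * (u p r - 1)) atTop (𝓝 l) := by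
  obtain ⟨C₁, hC₁, hcurv⟩ := D.exists_curvature_bound hκ
  obtain ⟨C₂, r₁, hr₁, hC₂, hdec⟩ := hu.exists_decay hκ
  obtain ⟨Θ, W, δ, s₀, C₃, h, hΘ0, hδ, hs₀, hs₀', hball, hgood⟩ :=
    D.exists_good_param hκ p (ε := 1 / 1000) (by norm_num)
  have hst : Tendsto (fun r : ℝ => Real.exp (-(2 * κ * r))) atTop (𝓝 0) :=
    Real.tendsto_exp_neg_atTop_nhds_zero.comp (tendsto_id.const_mul_atTop (by positivity))
  have hev : ∀ c ε : ℝ, 0 < ε → ∀ᶠ r in atTop, c * Real.exp (-(2 * κ * r)) ≤ ε := fun c ε hε =>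
    (hst.const_mul c).eventually (ge_mem_nhds (by simpa using hε))
  obtain ⟨r₀, hr₀⟩ := eventually_atTop.1 ((((hev 1 s₀ hs₀).and (hev C₁ (κ / 1000)
    (by positivity))).and ((hev C₁ (κ ^ 2) (by positivity)).and
      (hev C₂ (1 / 10000) (by norm_num)))).and (eventually_ge_atTop r₁))
  set σ : ℝ → ℝ := fun r => Real.exp (-(2 * κ * r)) with hσ
  have hσ0 : ∀ r, 0 < σ r := fun r => Real.exp_pos _
  set w : Plane → ℝ → ℝ := fun y r => Real.exp (3 * κ * r) * (u (Θ y) r - 1) with hw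
  set G : Plane → ℝ → Matrix (Fin 2) (Fin 2) ℝ := fun y r =>
    (gram (D.slice (σ r) ∘ Θ) (D.slice (σ r) ∘ Θ) y)⁻¹ with hG
  set A : Plane → ℝ → Matrix (Fin 2) (Fin 2) ℝ := fun y r =>
    (u (Θ y) r ^ 2 / D.meanCurv r (Θ y)) • G y r with hA
  set B : Plane → ℝ → Fin 2 → ℝ := fun y r k =>
    u (Θ y) r ^ 2 / D.meanCurv r (Θ y) * drift (D.slice (σ r) ∘ Θ) k y with hB
  set c : Plane → ℝ → ℝ := fun y r => (σ r)⁻¹ * (w y r * (3 * κ - u (Θ y) r * (u (Θ y) r + 1) *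
    (scalarCurvature (D.metric r) (Θ y) + 6 * κ ^ 2) / (2 * D.meanCurv r (Θ y)))) with hc
  set K := (6 * κ * C₁ + 2 * C₁ + 28 * κ ^ 2 * C₂) / (2 * κ) with hK
  have hwb : ∀ y r, r₀ ≤ r → |w y r| ≤ C₂ := by
    intro y r hr
    have h1 := hdec r (hr₀ r hr).2 (Θ y)
    rw [hw, abs_mul, abs_of_pos (Real.exp_pos _)]
    calc Real.exp (3 * κ * r) * |u (Θ y) r - 1|
        ≤ Real.exp (3 * κ * r) * (C₂ * Real.exp (-(3 * κ * r))) :=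
          mul_le_mul_of_nonneg_left h1 (Real.exp_pos _).le
      _ = C₂ := by rw [Real.exp_neg]; field_simp
  have hub : ∀ y r, r₀ ≤ r → |u (Θ y) r - 1| ≤ C₂ * σ r := by
    intro y r hr
    refine (hdec r (hr₀ r hr).2 (Θ y)).trans (mul_le_mul_of_nonneg_left ?_ hC₂)
    refine Real.exp_le_exp.2 ?_
    have : 0 < κ * r := mul_pos hκ (hr₁.trans_le (hr₀ r hr).2)
    linarith
  have hs1 : ∀ r, r₀ ≤ r → σ r ≤ s₀ := fun r hr => by simpa using (hr₀ r hr).1.1.1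
  have hPb : ∀ y r, r₀ ≤ r → |2 * κ * (u (Θ y) r ^ 2 / D.meanCurv r (Θ y)) - 1| ≤ 1 / 1000 :=
    fun y r hr => abs_ratio_sub_one_le hκ
      ((hcurv r ((hs1 r hr).trans hs₀') (Θ y)).1.trans (hr₀ r hr).1.1.2)
      ((hub y r hr).trans (hr₀ r hr).1.2.2)
  have hell := fun y (hy : y ∈ Metric.ball (0 : Plane) δ) r (hr : r₀ ≤ r) =>
    have hg := (hgood y hy (σ r) ⟨(hσ0 r).le, hs1 r hr⟩).1
    ellipticity_of_close (hPb y r hr) (by simpa using hg 0 0) (by simpa using hg 0 1)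
      (by simpa using hg 1 1)
  have hAP : ∀ y r i j, A y r i j =
      1 / (2 * κ) * (2 * κ * (u (Θ y) r ^ 2 / D.meanCurv r (Θ y)) * G y r i j) := by
    intro y r i j
    simp only [hA, Matrix.smul_apply, smul_eq_mul]
    field_simp
  have hκ' : 0 < 1 / (2 * κ) := by positivity
  set M := max C₂ (max (1 / κ * |C₃|) (C₂ * K)) with hM
  have hsol : IsParabolicSolution κ M (1 / (2 * κ) * (19 / 20)) δ r₀ w A B c :=
    { smooth := by
        intro r hr
        have hr0 : 0 < r := hr₁.trans_le (hr₀ r hr).2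
        have h1 : ContDiffOn ℝ 2 ((fun q => u q r) ∘ Θ) W :=
          (h.comp_smooth (hu.smooth_slice hr0)).of_le (by norm_cast)
        exact contDiffOn_const.mul ((h1.mono hball).sub contDiffOn_const)
      cont := by
        have h1 : ContinuousOn (fun q : Plane × ℝ => u (Θ q.1) q.2)
            (Metric.ball 0 δ ×ˢ Ici r₀) := by
          refine hu.cont.comp (f := fun q : Plane × ℝ => (Θ q.1, q.2)) ?_ ?_
          · exact ((h.smooth.continuousOn.mono hball).comp continuousOn_fst
              fun z hz => hz.1).prodMk continuousOn_snd
          · intro z hz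
            exact ⟨mem_univ _, hr₁.le.trans (hr₀ z.2 hz.2).2⟩
        exact ContinuousOn.mul (by fun_prop) (h1.sub continuousOn_const)
      eqn := by
        intro y hy r hr
        have hr0 : 0 < r := hr₁.trans_le (hr₀ r hr).2
        have hsr := (hs1 r hr).trans hs₀'
        have hyW := hball hy
        have hd := hu.hasDerivAt (Θ y) hr0
        have hE : HasDerivAt (fun r => Real.exp (3 * κ * r))
            (Real.exp (3 * κ * r) * (3 * κ)) r := by
          simpa using ((hasDerivAt_id r).const_mul (3 * κ)).exp
        refine (hE.mul (hd.sub_const 1)).congr_deriv ?_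
        have hf : ContDiffOn ℝ 2 ((fun q => u q r) ∘ Θ) W :=
          (h.comp_smooth (hu.smooth_slice hr0)).of_le (by norm_cast)
        have hlapw : lapEmb (D.slice (σ r) ∘ Θ) (fun z => w z r) y =
            Real.exp (3 * κ * r) * lapEmb (D.slice (σ r) ∘ Θ) ((fun q => u q r) ∘ Θ) y :=
          lapEmb_affine _ h.isOpen hf hyW _ _
        have hlap := D.laplacian_metric_eq hκ h hyW hsr (hu.smooth_slice hr0)
        have heq := hu.eqn (Θ y) r hr0
        have hH : 0 < D.meanCurv r (Θ y) := by
          have := (abs_le.1 ((hcurv r hsr (Θ y)).1.trans (hr₀ r hr).1.1.2)).1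
          linarith
        have hsum : ∑ i, ∑ j, A y r i j * pd i (pd j fun z => w z r) y
            + ∑ i, B y r i * pd i (fun z => w z r) y =
            u (Θ y) r ^ 2 / D.meanCurv r (Θ y) * lapEmb (D.slice (σ r) ∘ Θ) (fun z => w z r) y := by
          rw [lapEmb_expand]
          simp only [hA, hB, hG, Matrix.smul_apply, smul_eq_mul, Fin.sum_univ_two]
          ring
        change _ = σ r * _
        rw [hsum, hlapw]
        change laplacian (D.metric r) (fun q => u q r) (Θ y) = σ r * _ at hlap
        have hlap' : lapEmb (D.slice (σ r) ∘ Θ) ((fun q => u q r) ∘ Θ) y =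
            (σ r)⁻¹ * laplacian (D.metric r) (fun q => u q r) (Θ y) := by
          rw [hlap, inv_mul_cancel_left₀ (hσ0 r).ne']
        have hder : deriv (u (Θ y)) r = (2 * u (Θ y) r ^ 2 *
            laplacian (D.metric r) (fun q => u q r) (Θ y) + (u (Θ y) r - u (Θ y) r ^ 3) *
            (scalarCurvature (D.metric r) (Θ y) + 6 * κ ^ 2)) / (2 * D.meanCurv r (Θ y)) := by
          rw [eq_div_iff (by positivity), ← heq]; ring
        rw [hlap', hder]
        simp only [hc, hw]
        have hσr := (hσ0 r).ne'
        field_simp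
        ring
      w_le := fun y _ r hr => (hwb y r hr).trans (le_max_left _ _)
      B_le := by
        intro y hy r hr i
        have h1 := (hgood y hy (σ r) ⟨(hσ0 r).le, hs1 r hr⟩).2 i
        refine le_trans ?_ ((le_max_left _ _).trans (le_max_right _ _))
        simp only [hB]
        rw [abs_mul]
        refine mul_le_mul ?_ (h1.trans (le_abs_self _)) (abs_nonneg _) (by positivity)
        have h2 := abs_le.1 (hPb y r hr)
        rw [abs_le]
        constructor
        · rw [← mul_le_mul_iff_right₀ (by positivity : 0 < 2 * κ)]
          have : 2 * κ * -(1 / κ) = -2 := by field_simp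
          linarith
        · rw [← mul_le_mul_iff_right₀ (by positivity : 0 < 2 * κ)]
          have : 2 * κ * (1 / κ) = 2 := by field_simp
          linarith
      c_le := by
        intro y hy r hr
        have hsr := (hs1 r hr).trans hs₀'
        refine le_trans ?_ ((le_max_right _ _).trans (le_max_right _ _))
        have h1 := reaction_bound hκ (hcurv r hsr (Θ y)).1 (hcurv r hsr (Θ y)).2
          ((hr₀ r hr).1.1.2.trans (by linarith)) (hr₀ r hr).1.2.1 (hub y r hr)
          ((hr₀ r hr).1.2.2.trans (by norm_num))
        simp only [hc]
        rw [abs_mul, abs_mul, abs_inv, abs_of_pos (hσ0 r), inv_mul_le_iff₀ (hσ0 r)]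
        refine (mul_le_mul (hwb y r hr) h1 (abs_nonneg _) hC₂).trans (le_of_eq ?_)
        ring
      symm := by
        intro y hy r hr
        rw [hAP, hAP]
        congr 2
        simp only [hG, inv_two, Matrix.smul_apply, smul_eq_mul]
        have := gram_symm (D.slice (σ r) ∘ Θ) y 1 0
        simp [this]
      le₀ := by
        intro y hy r hr
        rw [hAP]
        exact mul_le_mul_of_nonneg_left (hell y hy r hr).1 hκ'.le
      le₁ := by
        intro y hy r hr
        rw [hAP]
        exact mul_le_mul_of_nonneg_left (hell y hy r hr).2.1 hκ'.le
      det_le := by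
        intro y hy r hr
        rw [hAP, hAP, hAP, ← mul_sub, ← mul_sub]
        have := mul_le_mul_of_nonneg_left (hell y hy r hr).2.2.1 (sq_nonneg (1 / (2 * κ)))
        rw [← mul_pow] at this
        exact this.trans (le_of_eq (by ring))
      trace_le := by
        intro y hy r hr
        rw [hAP, hAP, ← mul_add]
        have := mul_le_mul_of_nonneg_left (hell y hy r hr).2.2.2 hκ'.le
        exact this.trans (le_of_eq (by ring)) }
  obtain ⟨l, hl⟩ := hsol.exists_tendsto hδ (by positivity) hκ
  refine ⟨l, ?_⟩
  simpa only [hw, hΘ0] using hl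

end ConvexSurface

/-! ### The norm of the Killing spinor -/

/-- The square norm of a Killing spinor is the linear function of the position attached to the
vector `ζ(a)`. -/
theorem norm_sq_killingComp (κ : ℝ) (hκ : 0 < κ) (a : EuclideanSpace ℂ (Fin 2)) (r' θ ψ : ℝ) :
    ‖killingComp κ a r' θ ψ‖ ^ 2 = -κ * mink (polarPoint κ r' θ ψ) (zeta a) := by
  obtain ⟨E, hE⟩ : ∃ E, E = Real.exp (κ * r' / 2) := ⟨_, rfl⟩
  obtain ⟨E', hE'⟩ : ∃ E', E' = Real.exp (-(κ * r') / 2) := ⟨_, rfl⟩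
  have hcosh : Real.cosh (κ * r') = (E ^ 2 + E' ^ 2) / 2 := by
    rw [Real.cosh_eq, hE, hE', ← Real.exp_nat_mul, ← Real.exp_nat_mul]
    push_cast; ring_nf
  have hsinh : Real.sinh (κ * r') = (E ^ 2 - E' ^ 2) / 2 := by
    rw [Real.sinh_eq, hE, hE', ← Real.exp_nat_mul, ← Real.exp_nat_mul]
    push_cast; ring_nf
  have e1 : Complex.exp (κ * r' / 2 + Complex.I * ψ / 2) =
      ⟨E * Real.cos (ψ / 2), E * Real.sin (ψ / 2)⟩ := by
    apply Complex.ext <;> simp [Complex.exp_re, Complex.exp_im, hE]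
  have e2 : Complex.exp (κ * r' / 2 - Complex.I * ψ / 2) =
      ⟨E * Real.cos (ψ / 2), -(E * Real.sin (ψ / 2))⟩ := by
    apply Complex.ext <;> simp [Complex.exp_re, Complex.exp_im, hE]
  have e3 : Complex.exp (-(κ * r') / 2 + Complex.I * ψ / 2) =
      ⟨E' * Real.cos (ψ / 2), E' * Real.sin (ψ / 2)⟩ := by
    apply Complex.ext <;> simp [Complex.exp_re, Complex.exp_im, hE']
  have e4 : Complex.exp (-(κ * r') / 2 - Complex.I * ψ / 2) =
      ⟨E' * Real.cos (ψ / 2), -(E' * Real.sin (ψ / 2))⟩ := by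
    apply Complex.ext <;> simp [Complex.exp_re, Complex.exp_im, hE']
  have hθ1 : Real.cos θ = Real.cos (θ / 2) ^ 2 - Real.sin (θ / 2) ^ 2 := by
    rw [← Real.cos_two_mul', mul_div_cancel₀ _ two_ne_zero]
  have hθ2 : Real.sin θ = 2 * Real.sin (θ / 2) * Real.cos (θ / 2) := by
    rw [← Real.sin_two_mul, mul_div_cancel₀ _ two_ne_zero]
  have hψ1 : Real.cos ψ = Real.cos (ψ / 2) ^ 2 - Real.sin (ψ / 2) ^ 2 := by
    rw [← Real.cos_two_mul', mul_div_cancel₀ _ two_ne_zero]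
  have hψ2 : Real.sin ψ = 2 * Real.sin (ψ / 2) * Real.cos (ψ / 2) := by
    rw [← Real.sin_two_mul, mul_div_cancel₀ _ two_ne_zero]
  have p1 := Real.sin_sq_add_cos_sq (θ / 2)
  have p2 := Real.sin_sq_add_cos_sq (ψ / 2)
  rw [EuclideanSpace.norm_sq_eq, Fin.sum_univ_two]
  simp only [killingComp, mink, polarPoint, zeta, hcosh, hsinh, hθ1, hθ2, hψ1, hψ2, e1, e2, e3, e4]
  generalize Real.cos (θ / 2) = c at *
  generalize Real.sin (θ / 2) = s at *
  generalize Real.cos (ψ / 2) = C at *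
  generalize Real.sin (ψ / 2) = T at *
  simp only [Complex.sq_norm, Complex.normSq_apply]
  simp
  set x0 := (a 0).re
  set y0 := (a 0).im
  set x1 := (a 1).re
  set y1 := (a 1).im
  field_simp
  linear_combination (2 * ((E ^ 2 * (c ^ 2 * (x0 ^ 2 + y0 ^ 2) + s ^ 2 * (x1 ^ 2 + y1 ^ 2))
    + E' ^ 2 * (s ^ 2 * (x0 ^ 2 + y0 ^ 2) + c ^ 2 * (x1 ^ 2 + y1 ^ 2))))) * p2
    + ((E ^ 2 + E' ^ 2) * (x0 ^ 2 + y0 ^ 2 + x1 ^ 2 + y1 ^ 2)) * p1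

namespace ConvexSurface

variable {S : Type*} [TopologicalSpace S] [ChartedSpace Plane S] {κ : ℝ} (D : ConvexSurface S κ)

/-- The gauge transformation keeps the components in an orthonormal frame, hence the norm. -/
theorem normSq_asympKilling (hκ : 0 < κ) (a : EuclideanSpace ℂ (Fin 2)) {u : S → ℝ → ℝ} {r : ℝ}
    {p : S} (hu : 0 < u p r) :
    (D.asympKilling hκ a hu).normSq = -κ * mink (D.flow r p) (zeta a) := by
  have h := norm_sq_killingComp κ hκ a (polarR κ (D.flow r p)) (polarθ (D.flow r p))
    (polarψ (D.flow r p))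
  rw [polarPoint_polar hκ (D.flow_mem hκ r p)] at h
  exact h

/-! ### The mean curvature of the leaves in the metric with lapse -/

/-- The differential of the embedding, as a vector of Minkowski space. -/
def dF₀ (p : S) (V : TangentSpace (𝓡 2) p) : Mink := mfderiv (𝓡 2) 𝓘(ℝ, Mink) D.F₀ p V

/-- The differential of the normal, as a vector of Minkowski space. -/
def dN (p : S) (V : TangentSpace (𝓡 2) p) : Mink := mfderiv (𝓡 2) 𝓘(ℝ, Mink) D.N p V

theorem mfderiv_comb (a b : ℝ) (p : S) (V : TangentSpace (𝓡 2) p) :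
    (mfderiv (𝓡 2) 𝓘(ℝ, Mink) (D.comb a b) p V : Mink) = a • D.dF₀ p V + b • D.dN p V := by
  have h1 := (D.F₀_smooth.mdifferentiableAt (x := p) (by simp)).hasMFDerivAt
  have h2 := (D.N_smooth.mdifferentiableAt (x := p) (by simp)).hasMFDerivAt
  have h := ((h1.const_smul a).add (h2.const_smul b)).mfderiv
  change mfderiv (𝓡 2) 𝓘(ℝ, Mink) (a • D.F₀ + b • D.N) p V = _
  rw [h]
  rfl

theorem pullback_comb (a b c d : ℝ) (p : S) (V W : TangentSpace (𝓡 2) p) :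
    pullback (D.comb a b) (D.comb c d) p V W =
      mink (a • D.dF₀ p V + b • D.dN p V) (c • D.dF₀ p W + d • D.dN p W) :=
  congrArg₂ mink (D.mfderiv_comb a b p V) (D.mfderiv_comb c d p W)

/-- The first variation of the metric; the second fundamental form appears in symmetrized shape,
which spares a separate proof that it is symmetric. -/
theorem hasDerivAt_metric (hκ : 0 < κ) (p : S) (V W : TangentSpace (𝓡 2) p) (r : ℝ) :
    HasDerivAt (fun s => D.metric s p V W)
      (pullback (D.normal r) (D.flow r) p V W + pullback (D.normal r) (D.flow r) p W V) r := by
  have h0 : HasDerivAt (fun s : ℝ => κ * s) κ r := by simpa using (hasDerivAt_id r).const_mul κ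
  have hd : ∀ x y : Mink, HasDerivAt (fun s => Real.cosh (κ * s) • x + (Real.sinh (κ * s) / κ) • y)
      ((κ * Real.sinh (κ * r)) • x + Real.cosh (κ * r) • y) r := by
    intro x y
    refine ((h0.cosh.smul_const x).add ((h0.sinh.div_const κ).smul_const y)).congr_deriv ?_
    rw [mul_div_cancel_right₀ _ hκ.ne', mul_comm (Real.sinh _)]
  set f : Mink := D.dF₀ p V
  set n : Mink := D.dN p V
  set f' : Mink := D.dF₀ p W
  set n' : Mink := D.dN p W
  have h1 : HasDerivAt (fun s => mink (Real.cosh (κ * s) • f + (Real.sinh (κ * s) / κ) • n)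
      (Real.cosh (κ * s) • f' + (Real.sinh (κ * s) / κ) • n'))
      (mink (Real.cosh (κ * r) • f + (Real.sinh (κ * r) / κ) • n)
        ((κ * Real.sinh (κ * r)) • f' + Real.cosh (κ * r) • n') +
      mink ((κ * Real.sinh (κ * r)) • f + Real.cosh (κ * r) • n)
        (Real.cosh (κ * r) • f' + (Real.sinh (κ * r) / κ) • n')) r :=
    minkL.hasDerivAt_of_bilinear (fun _ => hd f n) (fun _ => hd f' n')
  simp only [metric, flow_eq_comb, normal_eq_comb, pullback_comb]
  refine h1.congr_deriv ?_
  rw [add_comm, mink_comm (Real.cosh (κ * r) • f + _)]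

/-- The lapse divides the mean curvature. If `u p r = 0` both sides vanish by the convention for
inverses. -/
theorem meanCurv''_eq (hκ : 0 < κ) (u : S → ℝ → ℝ) (r : ℝ) (p : S) :
    D.meanCurv'' u r p = D.meanCurv r p / u p r := by
  have hp : (extChartAt (𝓡 2) p).symm (extChartAt (𝓡 2) p p) = p := extChartAt_to_inv p
  set y := extChartAt (𝓡 2) p p with hy
  set T := coordMatrix (pullback (D.normal r) (D.flow r)) p y with hT
  set G := coordMatrix (D.metric r) p y with hG
  have h1 : coordMatrix (D.secondFF'' u r) p y = (1 / 2 * (u p r)⁻¹) • (T + T.transpose) := by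
    ext i j
    simp only [coordMatrix, Matrix.of_apply, secondFF'', (D.hasDerivAt_metric hκ _ _ _ r).deriv, hp,
      hT, Matrix.smul_apply, Matrix.add_apply, Matrix.transpose_apply, smul_eq_mul, mul_assoc]
  have hs : G 1 0 = G 0 1 := mink_comm _ _
  have htr : (G⁻¹ * T.transpose).trace = (G⁻¹ * T).trace := by
    simp only [inv_two, Matrix.trace_fin_two, Matrix.mul_apply, Fin.sum_univ_two,
      Matrix.transpose_apply, Matrix.smul_apply, hs]
    simp
    ring
  change (G⁻¹ * coordMatrix (D.secondFF'' u r) p y).trace = (G⁻¹ * T).trace / _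
  rw [h1, Matrix.mul_smul, Matrix.trace_smul, Matrix.mul_add, Matrix.trace_add, htr, smul_eq_mul]
  ring

/-! ### Limits of the leaves -/

theorem slice_zero (hκ : 0 < κ) : D.slice 0 = fun p => κ⁻¹ • D.gaussMap p := by
  funext p
  simp only [slice, comb, gaussMap]
  match_scalars <;> field_simp <;> ring

theorem continuous_slice (p : S) : Continuous fun s => D.slice s p := by
  unfold slice comb
  fun_prop

theorem tendsto_exp_neg (hκ : 0 < κ) :
    Tendsto (fun r : ℝ => Real.exp (-(2 * κ * r))) atTop (𝓝 0) :=
  Real.tendsto_exp_neg_atTop_nhds_zero.comp (tendsto_id.const_mul_atTop (by positivity))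

theorem tendsto_flow (hκ : 0 < κ) (p : S) :
    Tendsto (fun r : ℝ => (Real.exp (-(κ * r)) * κ) • D.flow r p) atTop (𝓝 (D.gaussMap p)) := by
  have h := (((D.continuous_slice p).tendsto 0).comp (tendsto_exp_neg hκ)).const_smul κ
  rw [slice_zero D hκ, smul_inv_smul₀ hκ.ne'] at h
  refine h.congr fun r => ?_
  have e : Real.exp (-(κ * r)) * κ * Real.exp (κ * r) = κ := by
    rw [mul_right_comm, ← Real.exp_add]; simp
  rw [flow_eq_slice, smul_smul, e]
  rfl

/-- The identity `e^{-2κr} g(r) = ⟨dX_s, dX_s⟩`, without coordinates. -/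
theorem metric_eq_slice (r : ℝ) (p : S) (V W : TangentSpace (𝓡 2) p) :
    Real.exp (-(2 * κ * r)) * D.metric r p V W =
      pullback (D.slice (Real.exp (-(2 * κ * r)))) (D.slice (Real.exp (-(2 * κ * r)))) p V W := by
  set s := Real.exp (-(2 * κ * r)) with hs
  have e : D.flow r = D.comb (Real.exp (κ * r) * ((1 + s) / 2))
      (Real.exp (κ * r) * ((1 - s) / (2 * κ))) := by
    rw [flow_eq_slice]
    funext p
    simp only [slice, comb, smul_add, smul_smul, ← hs]
  have h1 : Real.exp (κ * r) * Real.exp (κ * r) * s = 1 := by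
    rw [hs, ← Real.exp_add, ← Real.exp_add, ← Real.exp_zero]; ring_nf
  simp only [metric, e, slice, pullback_comb, mink_add_left, mink_add_right,
    mink_smul_left, mink_smul_right]
  linear_combination ((1 + s) / 2 * ((1 + s) / 2) * mink (D.dF₀ p V)
      (D.dF₀ p W)
    + (1 + s) / 2 * ((1 - s) / (2 * κ)) * (mink (D.dF₀ p V)
      (D.dN p W) + mink (D.dN p V)
      (D.dF₀ p W))
    + (1 - s) / (2 * κ) * ((1 - s) / (2 * κ)) * mink (D.dN p V)
      (D.dN p W)) * h1

theorem metricInfty_eq (hκ : 0 < κ) : D.metricInfty = pullback (D.slice 0) (D.slice 0) := by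
  rw [slice_zero D hκ]; rfl

theorem tendsto_metric (hκ : 0 < κ) (p : S) (V W : TangentSpace (𝓡 2) p) :
    Tendsto (fun r : ℝ => Real.exp (-(2 * κ * r)) * D.metric r p V W) atTop
      (𝓝 (D.metricInfty p V W)) := by
  have hc : Continuous fun s => pullback (D.slice s) (D.slice s) p V W := by
    simp only [slice, pullback_comb, mink_add_left, mink_add_right,
      mink_smul_left, mink_smul_right]
    fun_prop
  rw [metricInfty_eq D hκ]
  exact ((hc.tendsto 0).comp (tendsto_exp_neg hκ)).congr fun r => (D.metric_eq_slice r p V W).symm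

end ConvexSurface

/-! ### Convergence of the surface integrals -/

section Partition

variable {S : Type*} [TopologicalSpace S] [ChartedSpace Plane S] [IsManifold (𝓡 2) ∞ S]
  [CompactSpace S] [T2Space S]

variable (S) in
/-- Only finitely many charts contribute to a surface integral. -/
theorem exists_finset_surfaceIntegral : ∃ T : Finset S, ∀ (g : TwoTensor S) (f : S → ℝ),
    surfaceIntegral g f = ∑ x ∈ T, ∫ y in (extChartAt (𝓡 2) x).target,
      chartPartition S x ((extChartAt (𝓡 2) x).symm y) * f ((extChartAt (𝓡 2) x).symm y) *
        √(coordMatrix g x y).det := by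
  have hfin := (chartPartition S).locallyFinite.finite_nonempty_of_compact
  refine ⟨hfin.toFinset, fun g f => finsum_eq_sum_of_support_subset _ fun x hx => ?_⟩
  rw [Finite.coe_toFinset]
  by_contra hne
  refine hx ?_
  have h0 : ∀ p, chartPartition S x p = 0 := fun p => by
    by_contra hp
    exact hne ⟨p, hp⟩
  simp [h0]

/-- In the coordinates of the chart, each member of the partition of unity has compact support. -/
theorem exists_compact_chartPartition (x : S) : ∃ K : Set Plane, IsCompact K ∧
    K ⊆ (extChartAt (𝓡 2) x).target ∧ ∀ y ∈ (extChartAt (𝓡 2) x).target, y ∉ K →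
      chartPartition S x ((extChartAt (𝓡 2) x).symm y) = 0 := by
  have hsub : tsupport (chartPartition S x) ⊆ (extChartAt (𝓡 2) x).source := by
    rw [extChartAt_source]
    exact chartPartition_isSubordinate x
  refine ⟨extChartAt (𝓡 2) x '' tsupport (chartPartition S x),
    (isClosed_tsupport _).isCompact.image_of_continuousOn
      ((continuousOn_extChartAt x).mono hsub), ?_, fun y hy hyK => ?_⟩
  · rintro _ ⟨p, hp, rfl⟩
    exact (extChartAt (𝓡 2) x).map_source (hsub hp)
  · by_contra hne
    exact hyK ⟨_, subset_tsupport _ hne, (extChartAt (𝓡 2) x).right_inv hy⟩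

end Partition

namespace ConvexSurface

variable {S : Type*} [TopologicalSpace S] [ChartedSpace Plane S] [IsManifold (𝓡 2) ∞ S]
  {κ : ℝ} (D : ConvexSurface S κ)

/-- In two dimensions the area element of a leaf is `s⁻¹` times that of the rescaled leaf. -/
theorem sqrt_det_coordMatrix_metric (x : S) {y : Plane} (hy : y ∈ (extChartAt (𝓡 2) x).target)
    (r : ℝ) : √(coordMatrix (D.metric r) x y).det = (Real.exp (-(2 * κ * r)))⁻¹ *
      √(gram (D.slice (Real.exp (-(2 * κ * r))) ∘ (extChartAt (𝓡 2) x).symm)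
        (D.slice (Real.exp (-(2 * κ * r))) ∘ (extChartAt (𝓡 2) x).symm) y).det := by
  rw [metric, coordMatrix_pullback (D.flow_smooth r) (D.flow_smooth r) x hy,
    D.gram_flow (isLocalParam_chart x) hy, Matrix.det_smul, Fintype.card_fin,
    Real.sqrt_mul (by positivity), Real.sqrt_sq (by positivity)]

variable {D} [CompactSpace S] [T2Space S]

/-- The contribution of one chart to the integral converges, by dominated convergence on the compact
support of the member of the partition of unity. -/
theorem IsLapse.tendsto_chart_integral {Hbd : S → ℝ} {u : S → ℝ → ℝ} (hu : D.IsLapse Hbd u)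
    (hκ : 0 < κ) {v : S → ℝ}
    (hv : ∀ p, Tendsto (fun r => Real.exp (3 * κ * r) * (u p r - 1)) atTop (𝓝 (v p)))
    (ζ : Mink) (x : S) :
    Tendsto (fun r : ℝ => ∫ y in (extChartAt (𝓡 2) x).target,
      chartPartition S x ((extChartAt (𝓡 2) x).symm y) *
        ((D.meanCurv r ((extChartAt (𝓡 2) x).symm y) -
            D.meanCurv'' u r ((extChartAt (𝓡 2) x).symm y)) *
          (-κ * mink (D.flow r ((extChartAt (𝓡 2) x).symm y)) ζ)) *
        √(coordMatrix (D.metric r) x y).det) atTop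
      (𝓝 (-2 * κ * ∫ y in (extChartAt (𝓡 2) x).target,
        chartPartition S x ((extChartAt (𝓡 2) x).symm y) *
          (v ((extChartAt (𝓡 2) x).symm y) *
            mink (D.gaussMap ((extChartAt (𝓡 2) x).symm y)) ζ) *
        √(coordMatrix D.metricInfty x y).det)) := by
  obtain ⟨C₁, hC₁, hcurv⟩ := D.exists_curvature_bound hκ
  obtain ⟨C₂, r₁, hr₁, hC₂, hdec⟩ := hu.exists_decay hκ
  obtain ⟨K, hK, hKW, hK0⟩ := exists_compact_chartPartition x
  have h := isLocalParam_chart x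
  set Θ : Plane → S := ⇑(extChartAt (𝓡 2) x).symm with hΘ
  set W := (extChartAt (𝓡 2) x).target with hW
  set σ : ℝ → ℝ := fun r => Real.exp (-(2 * κ * r)) with hσ
  have hσ0 : ∀ r, 0 < σ r := fun r => Real.exp_pos _
  have hst : Tendsto σ atTop (𝓝 0) := tendsto_exp_neg hκ
  set ρ : Plane → ℝ := fun y => chartPartition S x (Θ y) with hρ
  -- the geometric factor, including the area element, continuous up to `s = 0`
  set Φ : Plane × ℝ → ℝ := fun z => -κ * mink (D.slice z.2 (Θ z.1)) ζ *
    √(gram (D.slice z.2 ∘ Θ) (D.slice z.2 ∘ Θ) z.1).det with hΦ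
  have hΦc : ContinuousOn Φ (W ×ˢ univ) := by
    have h1 : ∀ {f : S → Mink}, ContMDiff (𝓡 2) 𝓘(ℝ, Mink) ∞ f →
        ContinuousOn (fun z : Plane × ℝ => f (Θ z.1)) (W ×ˢ univ) := fun hf =>
      (h.comp_smooth hf).continuousOn.comp continuousOn_fst fun z hz => hz.1
    have h2 : ContinuousOn (fun z : Plane × ℝ => D.slice z.2 (Θ z.1)) (W ×ˢ univ) :=
      (ContinuousOn.smul (f := fun z : Plane × ℝ => (1 + z.2) / 2) (by fun_prop)
        (h1 D.F₀_smooth)).add (ContinuousOn.smul (f := fun z : Plane × ℝ => (1 - z.2) / (2 * κ))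
          (by fun_prop) (h1 D.N_smooth))
    exact (continuousOn_const.mul (continuousOn_mink h2 continuousOn_const)).mul
      (D.continuousOn_det_gram_slice h).sqrt
  obtain ⟨C₃, hC₃⟩ :=
    (hK.prod (isCompact_Icc (a := (0 : ℝ)) (b := 1 / 2))).exists_bound_of_continuousOn
    (hΦc.mono (prod_mono hKW (subset_univ _)))
  set F : ℝ → Plane → ℝ := fun r y => ρ y * (D.meanCurv r (Θ y) / u (Θ y) r *
    (Real.exp (3 * κ * r) * (u (Θ y) r - 1)) * Φ (y, σ r)) with hF
  set F' : Plane → ℝ := fun y => ρ y * (2 * κ / 1 * v (Θ y) * Φ (y, 0)) with hF'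
  obtain ⟨r₀, hr₀⟩ := eventually_atTop.1 ((((hst.eventually
    (ge_mem_nhds (by norm_num : (0 : ℝ) < 1 / 2))).and ((hst.const_mul C₁).eventually
      (ge_mem_nhds (by simpa using hκ)))).and ((hst.const_mul C₂).eventually
        (ge_mem_nhds (by simp : C₂ * 0 < (1 : ℝ) / 2)))).and (eventually_ge_atTop r₁))
  have hub : ∀ r, r₀ ≤ r → ∀ p, |u p r - 1| ≤ C₂ * σ r := by
    intro r hr p
    refine (hdec r (hr₀ r hr).2 p).trans (mul_le_mul_of_nonneg_left ?_ hC₂)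
    refine Real.exp_le_exp.2 ?_
    have : 0 < κ * r := mul_pos hκ (hr₁.trans_le (hr₀ r hr).2)
    linarith
  have hlim : Tendsto (fun r => ∫ y in W, F r y) atTop (𝓝 (∫ y in W, F' y)) := by
    refine MeasureTheory.tendsto_integral_filter_of_dominated_convergence
      (K.indicator fun _ => 6 * κ * C₂ * C₃) ?_ ?_ ?_ ?_
    · filter_upwards [eventually_ge_atTop r₀] with r hr
      have hr0 : 0 < r := hr₁.trans_le (hr₀ r hr).2
      have hs : σ r ≤ 1 / 2 := (hr₀ r hr).1.1.1
      refine ContinuousOn.aestronglyMeasurable ?_ h.isOpen.measurableSet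
      have hH : ContinuousOn (fun y => D.meanCurv r (Θ y)) W := by
        have h1 : ContinuousOn (fun y => D.traceTerm (σ r) (Θ y)) W :=
          (D.continuousOn_traceTerm hκ h).comp (f := fun y : Plane => (y, σ r)) (by fun_prop)
            fun y hy => ⟨hy, (hσ0 r).le, hs⟩
        have h2 : ContinuousOn (fun y => 2 * κ - 2 * κ * σ r * D.traceTerm (σ r) (Θ y)) W :=
          continuousOn_const.sub (continuousOn_const.mul h1)
        exact h2.congr fun y _ => D.meanCurv_eq hκ hs (Θ y)
      have hu' : ContinuousOn (fun y => u (Θ y) r) W :=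
        (h.comp_smooth (hu.smooth_slice hr0)).continuousOn
      have hρ' : ContinuousOn ρ W :=
        (chartPartition S x).2.continuous.comp_continuousOn h.smooth.continuousOn
      have hΦ' : ContinuousOn (fun y => Φ (y, σ r)) W :=
        hΦc.comp (f := fun y : Plane => (y, σ r)) (by fun_prop) fun y hy => ⟨hy, mem_univ _⟩
      exact hρ'.mul (((hH.div hu' fun y _ => (hu.pos _ r hr0.le).ne').mul
        (continuousOn_const.mul (hu'.sub continuousOn_const))).mul hΦ')
    · filter_upwards [eventually_ge_atTop r₀] with r hr
      have hr0 : 0 < r := hr₁.trans_le (hr₀ r hr).2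
      have hs : σ r ≤ 1 / 2 := (hr₀ r hr).1.1.1
      refine (MeasureTheory.ae_restrict_iff' h.isOpen.measurableSet).2 (Eventually.of_forall
        fun y hy => ?_)
      by_cases hyK : y ∈ K
      · rw [indicator_of_mem hyK, Real.norm_eq_abs]
        have h1 : |ρ y| ≤ 1 := by
          rw [abs_of_nonneg ((chartPartition S).nonneg _ _)]
          exact (chartPartition S).le_one _ _
        have h2 : |D.meanCurv r (Θ y) / u (Θ y) r| ≤ 6 * κ := by
          have a1 := abs_le.1 ((hcurv r hs (Θ y)).1.trans (hr₀ r hr).1.1.2)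
          have a2 := abs_le.1 ((hub r hr (Θ y)).trans (hr₀ r hr).1.2)
          have a3 : 0 < u (Θ y) r := by linarith
          rw [abs_div, abs_of_pos a3, div_le_iff₀ a3, abs_le]
          constructor <;> nlinarith
        have h3 : |Real.exp (3 * κ * r) * (u (Θ y) r - 1)| ≤ C₂ := by
          rw [abs_mul, abs_of_pos (Real.exp_pos _)]
          calc Real.exp (3 * κ * r) * |u (Θ y) r - 1|
              ≤ Real.exp (3 * κ * r) * (C₂ * Real.exp (-(3 * κ * r))) :=
                mul_le_mul_of_nonneg_left (hdec r (hr₀ r hr).2 (Θ y)) (Real.exp_pos _).le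
            _ = C₂ := by rw [Real.exp_neg]; field_simp
        have h4 : |Φ (y, σ r)| ≤ C₃ := hC₃ (y, σ r) ⟨hyK, (hσ0 r).le, hs⟩
        simp only [hF]
        rw [abs_mul, abs_mul, abs_mul]
        calc |ρ y| * (|D.meanCurv r (Θ y) / u (Θ y) r| *
              |Real.exp (3 * κ * r) * (u (Θ y) r - 1)| * |Φ (y, σ r)|)
            ≤ 1 * (6 * κ * C₂ * C₃) := by gcongr
          _ = _ := one_mul _
      · rw [indicator_of_notMem hyK]
        simp only [hF, hρ, hK0 y hy hyK, zero_mul, norm_zero, le_refl]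
    · refine MeasureTheory.Integrable.restrict ?_
      rw [MeasureTheory.integrable_indicator_iff hK.measurableSet]
      exact MeasureTheory.integrableOn_const hK.measure_lt_top.ne
    · refine (MeasureTheory.ae_restrict_iff' h.isOpen.measurableSet).2 (Eventually.of_forall
        fun y hy => ?_)
      have h1 : Tendsto (fun r => D.meanCurv r (Θ y)) atTop (𝓝 (2 * κ)) := by
        rw [tendsto_iff_norm_sub_tendsto_zero]
        refine squeeze_zero' (Eventually.of_forall fun _ => norm_nonneg _) ?_
          (by simpa using hst.const_mul C₁)
        filter_upwards [eventually_ge_atTop r₀] with r hr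
        exact (hcurv r (hr₀ r hr).1.1.1 (Θ y)).1
      have h2 : Tendsto (fun r => u (Θ y) r) atTop (𝓝 1) := by
        rw [tendsto_iff_norm_sub_tendsto_zero]
        refine squeeze_zero' (Eventually.of_forall fun _ => norm_nonneg _) ?_
          (by simpa using hst.const_mul C₂)
        filter_upwards [eventually_ge_atTop r₀] with r hr
        exact hub r hr (Θ y)
      have h3 : Tendsto (fun r => Φ (y, σ r)) atTop (𝓝 (Φ (y, 0))) := by
        have hc : Continuous fun s => Φ (y, s) := by
          rw [← continuousOn_univ]
          exact hΦc.comp (f := fun s : ℝ => (y, s)) (by fun_prop) fun s _ => ⟨hy, mem_univ _⟩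
        exact (hc.tendsto 0).comp hst
      exact (((h1.div h2 one_ne_zero).mul (hv (Θ y))).mul h3).const_mul (ρ y)
  have hF'eq : ∫ y in W, F' y = -2 * κ * ∫ y in W, ρ y * (v (Θ y) * mink (D.gaussMap (Θ y)) ζ) *
      √(coordMatrix D.metricInfty x y).det := by
    rw [← MeasureTheory.integral_const_mul]
    refine MeasureTheory.setIntegral_congr_fun h.isOpen.measurableSet fun y hy => ?_
    have e : mink (D.gaussMap (Θ y)) ζ = κ * mink (D.slice 0 (Θ y)) ζ := by
      rw [slice_zero D hκ, mink_smul_left, mul_inv_cancel_left₀ hκ.ne']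
    simp only [hF', hΦ]
    rw [metricInfty_eq D hκ, coordMatrix_pullback (D.slice_smooth 0) (D.slice_smooth 0) x hy, e]
    ring
  rw [← hF'eq]
  refine hlim.congr' ?_
  filter_upwards [eventually_ge_atTop r₀] with r hr
  refine MeasureTheory.setIntegral_congr_fun h.isOpen.measurableSet fun y hy => ?_
  have hr0 : 0 < r := hr₁.trans_le (hr₀ r hr).2
  have hu0 := hu.pos (Θ y) r hr0.le
  have e1 : Real.exp (3 * κ * r) = Real.exp (κ * r) * (σ r)⁻¹ := by
    rw [hσ, ← Real.exp_neg, ← Real.exp_add]; ring_nf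
  have e2 : √(coordMatrix (D.metric r) x y).det =
      (σ r)⁻¹ * √(gram (D.slice (σ r) ∘ Θ) (D.slice (σ r) ∘ Θ) y).det :=
    D.sqrt_det_coordMatrix_metric x hy r
  have e3 : mink (D.flow r (Θ y)) ζ = Real.exp (κ * r) * mink (D.slice (σ r) (Θ y)) ζ := by
    rw [flow_eq_slice, mink_smul_left]
  change F r y = ρ y * ((D.meanCurv r (Θ y) - D.meanCurv'' u r (Θ y)) *
    (-κ * mink (D.flow r (Θ y)) ζ)) * √(coordMatrix (D.metric r) x y).det
  simp only [hF, hΦ]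
  rw [e2, D.meanCurv''_eq hκ, e3, e1]
  generalize σ r = s
  field_simp

end ConvexSurface

end WangYau

end

theorem proposition4p2 {S : Type*} [TopologicalSpace S]
    [ChartedSpace (EuclideanSpace ℝ (Fin 2)) S] [IsManifold (𝓡 2) ∞ S]
    [CompactSpace S] [T2Space S] [ConnectedSpace S]
    {κ : ℝ} (hκ : 0 < κ) (D : WangYau.ConvexSurface S κ)
    (Hbd : S → ℝ) (hHbd : ∀ p, 0 < Hbd p)
    (u : S → ℝ → ℝ) (hu : D.IsLapse Hbd u) :
    (∀ p, Tendsto (fun r : ℝ => (Real.exp (-(κ * r)) * κ) • D.flow r p) atTop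
      (𝓝 (D.gaussMap p))) ∧
    (∀ (p : S) (V W : TangentSpace (𝓡 2) p),
      Tendsto (fun r : ℝ => Real.exp (-(2 * κ * r)) * D.metric r p V W) atTop
        (𝓝 (D.metricInfty p V W))) ∧
    ∃ vInf : S → ℝ,
      (∀ p, Tendsto (fun r : ℝ => Real.exp (3 * κ * r) * (u p r - 1)) atTop (𝓝 (vInf p))) ∧
      ∀ a : EuclideanSpace ℂ (Fin 2),
        Tendsto
          (fun r : NNReal => WangYau.surfaceIntegral (D.metric r) fun p =>
            (D.meanCurv r p - D.meanCurv'' u r p) *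
              (D.asympKilling hκ a (hu.pos p r r.2)).normSq)
          atTop
          (𝓝 (-2 * κ * WangYau.surfaceIntegral D.metricInfty fun p =>
            vInf p * WangYau.mink (D.gaussMap p) (WangYau.zeta a))) := by
  choose vInf hv using fun p => hu.exists_tendsto hκ p
  refine ⟨D.tendsto_flow hκ, D.tendsto_metric hκ, vInf, hv, fun a => ?_⟩
  obtain ⟨T, hT⟩ := WangYau.exists_finset_surfaceIntegral S
  simp only [hT, WangYau.ConvexSurface.normSq_asympKilling, Finset.mul_sum]
  exact tendsto_finsetSum _ fun x _ => (hu.tendsto_chart_integral hκ hv (WangYau.zeta a) x).comp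
    (NNReal.tendsto_coe_atTop.2 tendsto_id)
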